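/- A \emph{rational parametrization of degree $d$} is a map $P:\mathbb{C}P^1\to\mathbb{C}P^3$ that is a smooth embedding and whose coordinate functions are real homogeneous polynomials of degree $d$ in two variables; it parametrizes the knot $P(\mathbb{R}P^1)\subset\mathbb{R}P^3$. Let $K$ and $K'$ be knots in $\mathbb{R}P^3$ with rational parametrizations of degrees $m$ and $n$. Suppose that $K\cap K'=\{p\}$ is a single point and that the tangent lines of $K$ and $K'$ at $p$ are linearly independent. Then for every open neighbourhood $U$ of $p$ there is a smooth open embedding $\psi:\mathbb{R}^3\to U$ with $\psi(0)=p$, in whose coordinates $(x,y,z)$ the knot $K$ is exactly the $x$-axis and $K'$ exactly the $y$-axis, such that for each of the two signs $\varepsilon=\pm1$ there is a rational parametrization $R$ of degree $m+n$ for which $R(\mathbb{R}P^1)$ is smoothly isotopic to $$\bigl((K\cup K')\setminus\psi(\mathbb{R}^3)\bigr)\ \cup\ \psi\bigl(\{(x,y,0):\ \varepsilon xy=\beta(x-\varepsilon y)\}\bigr).$$ Here $\beta:\mathbb{R}\to[0,1]$ is a fixed smooth function, positive on $(-1,1)$ and zero elsewhere, so that the last set is $K\cup K'$ with the crossing at $p$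 replaced, inside a bounded part of the coordinate neighbourhood, by two disjoint smooth arcs lying in opposite quadrants (the two signs give the two possible resolutions of the crossing). Smoothly isotopic means: the two sets are the images of the two ends of a smooth family $h_t$, $0\le t\le1$, of smooth embeddings of the circle in $\mathbb{R}P^3$. -/

import Mathlib

open scoped LinearAlgebra.Projectivization ContDiff

namespace RatKnot

/-- Real projective three-space. -/
abbrev RP3 : Type := ℙ ℝ (Fin 4 → ℝ)

/-- The quotient topology on real projective three-space. -/
noncomputable instance instTopologicalSpaceRP3 : TopologicalSpace RP3 :=
  TopologicalSpace.coinduced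
    (Projectivization.mk' ℝ : {v : Fin 4 → ℝ // v ≠ 0} → RP3) inferInstance

/-- The vector `v` is a vector of homogeneous coordinates of the point `q`. -/
def Represents (v : Fin 4 → ℝ) (q : RP3) : Prop :=
  ∃ h : v ≠ 0, Projectivization.mk ℝ v h = q

/-! ### Rational parametrizations -/

/-- Four real polynomials in two variables, evaluated at a point with coordinates in `A`
(used for `A = ℝ` and `A = ℂ`). -/
noncomputable def evalAt (A : Type) [CommRing A] [Algebra ℝ A]
    (P : Fin 4 → MvPolynomial (Fin 2) ℝ) (z : Fin 2 → A) : Fin 4 → A :=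
  fun i => MvPolynomial.aeval z (P i)

/-- The differential at `z` of the polynomial map `A² → A⁴` given by `P` (its Jacobian matrix). -/
noncomputable def differential (A : Type) [CommRing A] [Algebra ℝ A]
    (P : Fin 4 → MvPolynomial (Fin 2) ℝ) (z : Fin 2 → A) : (Fin 2 → A) →ₗ[A] (Fin 4 → A) :=
  Matrix.mulVecLin
    (Matrix.of fun i j => (MvPolynomial.aeval z (MvPolynomial.pderiv j (P i)) : A))

/-- `P` is a rational knot parametrization of degree `d`: its entries are real homogeneous
polynomials of degree `d`, and `(z₀ : z₁) ↦ P (z₀, z₁)` is a well-defined smooth embedding of the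
complex projective line in complex projective three-space, that is, an injective immersion of
this compact manifold. The tangent space of the projective space of `V` at the line of `z` is
`Hom (⟨z⟩, V / ⟨z⟩)`, whence the form of `immersion`. -/
structure IsRationalParametrization (d : ℕ) (P : Fin 4 → MvPolynomial (Fin 2) ℝ) : Prop where
  homogeneous : ∀ i, (P i).IsHomogeneous d
  ne_zero : ∀ z : Fin 2 → ℂ, z ≠ 0 → evalAt ℂ P z ≠ 0
  injective : ∀ z w : Fin 2 → ℂ, z ≠ 0 → w ≠ 0 →
    (∃ c : ℂ, evalAt ℂ P z = c • evalAt ℂ P w) → ∃ b : ℂ, z = b • w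
  immersion : ∀ z w : Fin 2 → ℂ, z ≠ 0 →
    (∃ c : ℂ, differential ℂ P z w = c • evalAt ℂ P z) → ∃ b : ℂ, w = b • z

/-- The image of the real projective line under `P`: the knot parametrized by `P`. -/
def realImage (P : Fin 4 → MvPolynomial (Fin 2) ℝ) : Set RP3 :=
  {q | ∃ x : Fin 2 → ℝ, x ≠ 0 ∧ Represents (evalAt ℝ P x) q}

/-- The tangent line of the curve `P` at the point with parameter `x`, as the
linear subspace of `ℝ⁴` (of dimension two, if `P` is an immersion) whose projectivization it is. -/
noncomputable def tangentLine (P : Fin 4 → MvPolynomial (Fin 2) ℝ) (x : Fin 2 → ℝ) :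
    Submodule ℝ (Fin 4 → ℝ) :=
  Submodule.span ℝ {evalAt ℝ P x} ⊔ LinearMap.range (differential ℝ P x)

/-! ### Smooth isotopy -/

/-- Two subsets of real projective space are the images of the two ends of a smooth isotopy
`h t`, `0 ≤ t ≤ 1`, of smooth embeddings of the circle. A map to projective space is smooth
if it has smooth homogeneous coordinates; they exist globally in the variables `(t, θ)`, where
`θ` is the angle on the circle, because the `(t, θ)`-strip is simply connected. -/
def SmoothlyIsotopic (L M : Set RP3) : Prop :=
  ∃ (h : ℝ → Circle → RP3) (H : ℝ × ℝ → (Fin 4 → ℝ)),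
    ContDiff ℝ ∞ H ∧
    (∀ t ∈ Set.Icc (0 : ℝ) 1,
      Function.Injective (h t) ∧
      ∀ θ : ℝ, Represents (H (t, θ)) (h t (Circle.exp θ)) ∧
        ∀ c : ℝ, fderiv ℝ H (t, θ) (0, 1) ≠ c • H (t, θ)) ∧
    Set.range (h 0) = L ∧ Set.range (h 1) = M

/-! ### Resolving a crossing -/

/-- `ψ` is a smooth open embedding of `ℝ³` in real projective three-space (the inverse of a
smooth chart): it has smooth homogeneous coordinates, is injective, and its differential is
injective everywhere. -/
def IsSmoothOpenEmbedding (ψ : (Fin 3 → ℝ) → RP3) : Prop :=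
  Function.Injective ψ ∧
  ∃ Ψ : (Fin 3 → ℝ) → (Fin 4 → ℝ), ContDiff ℝ ∞ Ψ ∧
    (∀ x, Represents (Ψ x) (ψ x)) ∧
    ∀ (x v : Fin 3 → ℝ) (c : ℝ), fderiv ℝ Ψ x v = c • Ψ x → v = 0

/-- In the coordinates `ψ`, the curves `K` and `K'` are the first and the second coordinate
axis. -/
structure IsCrossingChart (K K' : Set RP3) (p : RP3) (ψ : (Fin 3 → ℝ) → RP3) : Prop where
  embedding : IsSmoothOpenEmbedding ψ
  map_zero : ψ 0 = p
  first_axis : ∀ x, ψ x ∈ K ↔ x 1 = 0 ∧ x 2 = 0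
  second_axis : ∀ x, ψ x ∈ K' ↔ x 0 = 0 ∧ x 2 = 0

/-- The two standard resolutions of the crossing `x₀ x₁ = 0` of the first two coordinate axes,
for `ε = 1` and `ε = -1`. The smooth bump `u ↦ smoothTransition (1 - u²)` is positive for
`|u| < 1` and zero otherwise, so the set coincides with the two axes off a bounded set. It is the
disjoint union of two smooth arcs in the plane `x₂ = 0`, one in the quadrant `x₀ ≥ 0`,
`ε x₁ ≥ 0` and one in the opposite quadrant. -/
def standardResolution (ε : ℝ) : Set (Fin 3 → ℝ) :=
  {x | x 2 = 0 ∧ ε * (x 0 * x 1) = Real.smoothTransition (1 - (x 0 - ε * x 1) ^ 2)}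

/-- The union of `K` and `K'`, with the crossing in the coordinate neighbourhood `ψ` replaced by
the standard resolution of sign `ε`. -/
def resolvedUnion (K K' : Set RP3) (ψ : (Fin 3 → ℝ) → RP3) (ε : ℝ) : Set RP3 :=
  ((K ∪ K') \ Set.range ψ) ∪ ψ '' standardResolution ε

end RatKnot

/-! Lift both knots to homogeneous maps `f` and `g` with the common value `e` at the parameter (1 :
0), and add the two curves in the affine chart `l ≠ 0` with origin `e`. Homogenized, this is
`affineSum`, a map of bidegree (m, n) on the product of the two parameter lines, equal to `f` and
`g` on the two axes. Let u and v be the affine parameters (second coordinate over first). The curve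
u v = κ² on this surface is rational of degree m + n: take z = (sin, κ cos) and w = (cos, κ sin) of
a half angle. For small κ > 0 it follows one knot where |u| is not small, the other where |v| is not
small, and it is a hyperbola near the crossing. The other resolution comes from reversing the
parameter of `g` (`reflect`).

The isotopy is explicit: `resolutionCurve` keeps u - v = 2κ cot θ and moves the product u v from κ²
to κ² times the bump, so at time 1 it is the standard resolution in the coordinates u / κ and v / κ
(`curveImage_resolutionCurve_one`). For small κ all intermediate curves are embedded
(`eventually_resolutionCurve_embedded`). Away from the crossing the bump vanishes and the curve is u
v = a with the constant a = κ² (1 - s), a perturbation of an arc of one of the knots; embeddings of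
compact arcs are stable (`eventually_wedge_ne_zero`). Near the crossing it is an explicit plane
curve in a chart (`exists_localChart_embedded`).

The polynomial curve at time 0 is embedded over the reals but perhaps not over the complex numbers,
so μ times a `frame` of four monomials is added. A small μ does not change the isotopy class
(`eventually_smoothlyIsotopic`). If μ is transcendental over the coefficients, then 1 / μ lies in
the maximal ideal of a valuation ring of ℂ that contains them; divided by μ, the map reduces to the
frame, an embedding, and this property lifts (`isRationalParametrization_of_reduction`).
Algebraically, a generic μ behaves like an infinitely large one, however small it is as a real
number. -/

namespace RatKnot

/-! ### Plücker coordinates of secants and stability of embeddings -/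

open Filter Topology Set

/-- The Plücker coordinates of a pair of vectors. -/
def wedge (v w : Fin 4 → ℝ) : Fin 4 → Fin 4 → ℝ := fun i j => v i * w j - v j * w i

lemma wedge_self (v : Fin 4 → ℝ) : wedge v v = 0 := by
  funext i j; simp [wedge, mul_comm]

lemma wedge_add_right (v w w' : Fin 4 → ℝ) : wedge v (w + w') = wedge v w + wedge v w' := by
  funext i j; simp [wedge]; ring

lemma wedge_smul_right (c : ℝ) (v w : Fin 4 → ℝ) : wedge v (c • w) = c • wedge v w := by
  funext i j; simp [wedge]; ring

lemma wedge_smul_left (c : ℝ) (v w : Fin 4 → ℝ) : wedge (c • v) w = c • wedge v w := by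
  funext i j; simp [wedge]; ring

lemma wedge_swap (v w : Fin 4 → ℝ) : wedge w v = - wedge v w := by
  funext i j; simp [wedge]; ring

lemma wedge_comm_eq_zero {v w : Fin 4 → ℝ} : wedge v w = 0 ↔ wedge w v = 0 := by
  rw [wedge_swap v w, neg_eq_zero]

lemma wedge_smul_self (c : ℝ) (v : Fin 4 → ℝ) : wedge (c • v) v = 0 := by
  rw [wedge_smul_left, wedge_self, smul_zero]

lemma exists_smul_of_wedge_eq_zero {v w : Fin 4 → ℝ} (hw : w ≠ 0) (h : wedge v w = 0) :
    ∃ c : ℝ, v = c • w := by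
  obtain ⟨i, hi⟩ := Function.ne_iff.1 hw
  simp only [Pi.zero_apply] at hi
  refine ⟨v i / w i, ?_⟩
  funext j
  have := congrFun (congrFun h i) j
  simp only [wedge, Pi.zero_apply] at this
  simp only [Pi.smul_apply, smul_eq_mul]
  field_simp
  linarith

lemma continuous_wedge : Continuous fun p : (Fin 4 → ℝ) × (Fin 4 → ℝ) => wedge p.1 p.2 := by
  unfold wedge; fun_prop

lemma _root_.Continuous.wedge {X : Type*} [TopologicalSpace X] {v w : X → Fin 4 → ℝ}
    (hv : Continuous v) (hw : Continuous w) : Continuous fun x => RatKnot.wedge (v x) (w x) :=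
  continuous_wedge.comp (hv.prodMk hw)

lemma Represents.wedge_eq_zero {v w : Fin 4 → ℝ} {q : RP3} (hv : Represents v q)
    (hw : Represents w q) : wedge v w = 0 := by
  obtain ⟨h, rfl⟩ := hv
  obtain ⟨h', e⟩ := hw
  obtain ⟨a, ha⟩ := (Projectivization.mk_eq_mk_iff' ℝ _ _ h' h).1 e
  rw [← ha, wedge_smul_right, wedge_self, smul_zero]

lemma Represents.of_wedge {v w : Fin 4 → ℝ} {q : RP3} (hv : Represents v q) (hw : w ≠ 0)
    (h : wedge v w = 0) : Represents w q := by
  obtain ⟨hv0, rfl⟩ := hv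
  obtain ⟨c, rfl⟩ := exists_smul_of_wedge_eq_zero hw h
  exact ⟨hw, ((Projectivization.mk_eq_mk_iff' ℝ _ _ hv0 hw).2 ⟨c, rfl⟩).symm⟩

lemma Represents.unique {v : Fin 4 → ℝ} {q q' : RP3} (h : Represents v q)
    (h' : Represents v q') : q = q' := by
  obtain ⟨_, rfl⟩ := h
  obtain ⟨_, rfl⟩ := h'
  rfl

lemma represents_mk {v : Fin 4 → ℝ} (hv : v ≠ 0) : Represents v (Projectivization.mk ℝ v hv) :=
  ⟨hv, rfl⟩

lemma Represents.eq_of_wedge {v w : Fin 4 → ℝ} {q q' : RP3} (hv : Represents v q)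
    (hw : Represents w q') (h : wedge v w = 0) : q = q' :=
  (hv.of_wedge hw.1 h).unique hw

/-- The Plücker coordinates of the secants of a family of curves, divided by the difference of the
parameters, extend continuously to the tangents. -/
lemma exists_divided_wedge {X : Type*} [TopologicalSpace X] {F F' : X → ℝ → Fin 4 → ℝ}
    (hF : Continuous fun p : X × ℝ => F p.1 p.2) (hF' : Continuous fun p : X × ℝ => F' p.1 p.2)
    (hd : ∀ x α, HasDerivAt (F x) (F' x α) α) :
    ∃ B : X → ℝ × ℝ → Fin 4 → Fin 4 → ℝ, (Continuous fun p : X × (ℝ × ℝ) => B p.1 p.2) ∧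
      (∀ x α α', wedge (F x α) (F x α') = (α' - α) • B x (α, α')) ∧
      ∀ x α, B x (α, α) = wedge (F x α) (F' x α) := by
  -- The difference quotient of `F x` is the mean of its derivative over the segment, which is
  -- continuous up to the diagonal. Wedging with the first point replaces the second point by the
  -- difference.
  refine ⟨fun x p => wedge (F x p.1) (∫ σ in (0:ℝ)..1, F' x (p.1 + σ * (p.2 - p.1))), ?_, ?_, ?_⟩
  · refine Continuous.wedge (hF.comp (by fun_prop :
      Continuous fun p : X × (ℝ × ℝ) => (p.1, p.2.1))) ?_
    apply intervalIntegral.continuous_parametric_intervalIntegral_of_continuous'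
    exact hF'.comp (by fun_prop : Continuous fun p : (X × (ℝ × ℝ)) × ℝ =>
      (p.1.1, p.1.2.1 + p.2 * (p.1.2.2 - p.1.2.1)))
  · intro x α α'
    have key : F x α' - F x α = (α' - α) • ∫ σ in (0:ℝ)..1, F' x (α + σ * (α' - α)) := by
      have h1 : ∀ σ ∈ uIcc (0:ℝ) 1, HasDerivAt (fun σ => F x (α + σ * (α' - α)))
          ((α' - α) • F' x (α + σ * (α' - α))) σ := by
        intro σ _
        have h := (hd x (α + σ * (α' - α))).scomp σ
          (((hasDerivAt_id σ).mul_const (α' - α)).const_add α)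
        rw [one_mul] at h
        exact h
      have hc0 : Continuous fun σ => F' x (α + σ * (α' - α)) :=
        hF'.comp (by fun_prop : Continuous fun σ : ℝ => (x, α + σ * (α' - α)))
      have hc : Continuous fun σ => (α' - α) • F' x (α + σ * (α' - α)) :=
        hc0.const_smul (α' - α)
      have := intervalIntegral.integral_eq_sub_of_hasDerivAt h1 (hc.intervalIntegrable 0 1)
      rw [intervalIntegral.integral_smul] at this
      rw [this]; simp
    simp only
    rw [← wedge_smul_right, ← key]
    have : F x α' = F x α + (F x α' - F x α) := by abel
    conv_lhs => rw [this, wedge_add_right, wedge_self, zero_add]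
  · intro x α
    simp

/-- Being an injective immersion on a compact set of pairs of parameters is stable. -/
lemma eventually_wedge_ne_zero {X Y : Type*} [TopologicalSpace X] [TopologicalSpace Y]
    {F F' : X × Y → ℝ → Fin 4 → ℝ}
    (hF : Continuous fun p : (X × Y) × ℝ => F p.1 p.2)
    (hF' : Continuous fun p : (X × Y) × ℝ => F' p.1 p.2)
    (hd : ∀ x α, HasDerivAt (F x) (F' x α) α) (x₀ : X) {C : Set Y} (hC : IsCompact C)
    {K : Set (ℝ × ℝ)} (hK : IsCompact K)
    (h1 : ∀ y ∈ C, ∀ α α', (α, α') ∈ K → α ≠ α' → wedge (F (x₀, y) α) (F (x₀, y) α') ≠ 0)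
    (h2 : ∀ y ∈ C, ∀ α, (α, α) ∈ K → wedge (F (x₀, y) α) (F' (x₀, y) α) ≠ 0) :
    ∀ᶠ x in 𝓝 x₀, ∀ y ∈ C,
      (∀ α α', (α, α') ∈ K → α ≠ α' → wedge (F (x, y) α) (F (x, y) α') ≠ 0) ∧
      (∀ α, (α, α) ∈ K → wedge (F (x, y) α) (F' (x, y) α) ≠ 0) := by
  obtain ⟨B, hB, hs, hdiag⟩ := exists_divided_wedge hF hF' hd
  -- The divided secant is nonzero off the diagonal by injectivity and on it by immersion. On a
  -- compact set this is an open condition on the parameter.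
  have hne : ∀ y ∈ C, ∀ k ∈ K, B (x₀, y) k ≠ 0 := by
    rintro y hy ⟨α, α'⟩ hk h0
    by_cases h : α = α'
    · subst h
      rw [hdiag] at h0
      exact h2 y hy α hk h0
    · exact h1 y hy α α' hk h (by rw [hs, h0, smul_zero])
  have hev : ∀ᶠ x in 𝓝 x₀, ∀ q ∈ C ×ˢ K, B (x, q.1) q.2 ≠ 0 := by
    refine (hC.prod hK).eventually_forall_of_forall_eventually ?_
    rintro ⟨y, k⟩ ⟨hy, hk⟩
    have hcont : Continuous fun z : X × (Y × (ℝ × ℝ)) => B (z.1, z.2.1) z.2.2 :=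
      hB.comp (by fun_prop : Continuous fun z : X × (Y × (ℝ × ℝ)) => ((z.1, z.2.1), z.2.2))
    exact hcont.continuousAt.eventually_ne (hne y hy k hk)
  filter_upwards [hev] with x hx y hy
  refine ⟨fun α α' hk hn h0 => ?_, fun α hk h0 => ?_⟩
  · rw [hs] at h0
    rcases smul_eq_zero.1 h0 with h | h
    · exact hn (by linarith)
    · exact hx (y, (α, α')) ⟨hy, hk⟩ h
  · exact hx (y, (α, α)) ⟨hy, hk⟩ (by rw [hdiag]; exact h0)

end RatKnot

/-! ### Explicit plane curves from the hyperbola to the standard resolution -/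

namespace RatKnot

open Filter Topology Set Real

/-- The bump function of `standardResolution` as a function of the angle `θ` with
`x₀ - ε x₁ = 2 cot θ`. -/
noncomputable def bump (θ : ℝ) : ℝ :=
  if sin θ = 0 then 0 else smoothTransition (1 - (2 * cos θ / sin θ) ^ 2)

/-- One minus the product of the coordinates on the resolved axes at time `s`. -/
noncomputable def excess (s θ : ℝ) : ℝ := s * (1 - bump θ)

/-- The half-sum of the two coordinates on the resolved axes, up to the factor `sin θ / 2`. -/
noncomputable def halfSum (s θ : ℝ) : ℝ := √(1 - excess s θ * sin θ ^ 2)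

/-- The first coordinate on the resolved axes is `cot (θ / 2)` times this factor. -/
noncomputable def factorA (s θ : ℝ) : ℝ :=
  1 - (1 - cos θ) * excess s θ / (1 + halfSum s θ)

/-- The second coordinate on the resolved axes is `tan (θ / 2)` times this factor. -/
noncomputable def factorB (s θ : ℝ) : ℝ :=
  1 - (1 + cos θ) * excess s θ / (1 + halfSum s θ)

lemma bump_nonneg (θ : ℝ) : 0 ≤ bump θ := by
  unfold bump; split_ifs
  · rfl
  · exact smoothTransition.nonneg _

lemma bump_le_one (θ : ℝ) : bump θ ≤ 1 := by
  unfold bump; split_ifs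
  · exact zero_le_one
  · exact smoothTransition.le_one _

/-- Off the zeros of the sine, the hypothesis says `|2 cot θ| ≥ 1`. -/
lemma bump_eq_zero {θ : ℝ} (h : sin θ ^ 2 ≤ 4 * cos θ ^ 2) : bump θ = 0 := by
  unfold bump; split_ifs with h0
  · rfl
  · apply smoothTransition.zero_of_nonpos
    have : 0 < sin θ ^ 2 := by positivity
    have : 1 ≤ (2 * cos θ / sin θ) ^ 2 := by
      rw [div_pow, le_div_iff₀ this]; nlinarith
    linarith

lemma bump_eq_one {θ : ℝ} (h : cos θ = 0) : bump θ = 1 := by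
  have h0 : sin θ ≠ 0 := fun h0 => by have := sin_sq_add_cos_sq θ; simp [h, h0] at this
  simp [bump, h0, h, smoothTransition.one]

lemma bump_of_sin_ne_zero {θ : ℝ} (h : sin θ ≠ 0) :
    bump θ = smoothTransition (1 - (2 * cos θ / sin θ) ^ 2) := by simp [bump, h]

/-- Near a zero of the sine the cotangent is large, so the bump vanishes identically there. -/
lemma contDiff_bump : ContDiff ℝ ∞ bump := by
  rw [contDiff_iff_contDiffAt]
  intro θ
  by_cases h : sin θ = 0
  · have hc : sin θ ^ 2 < 4 * cos θ ^ 2 := by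
      have := sin_sq_add_cos_sq θ; rw [h] at this ⊢; nlinarith
    have hev : ∀ᶠ t in 𝓝 θ, sin t ^ 2 < 4 * cos t ^ 2 :=
      (by fun_prop : Continuous fun t => sin t ^ 2).continuousAt.eventually_lt
        (by fun_prop : Continuous fun t => 4 * cos t ^ 2).continuousAt hc
    refine contDiffAt_const (c := (0:ℝ)) |>.congr_of_eventuallyEq ?_
    filter_upwards [hev] with t ht using bump_eq_zero ht.le
  · have hev : ∀ᶠ t in 𝓝 θ, sin t ≠ 0 := continuous_sin.continuousAt.eventually_ne h
    have : ContDiffAt ℝ ∞ (fun t => smoothTransition (1 - (2 * cos t / sin t) ^ 2)) θ := by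
      refine smoothTransition.contDiff.contDiffAt.comp θ ?_
      exact contDiffAt_const.sub (((contDiffAt_const.mul contDiff_cos.contDiffAt).div
        contDiff_sin.contDiffAt h).pow 2)
    refine this.congr_of_eventuallyEq ?_
    filter_upwards [hev] with t ht using bump_of_sin_ne_zero ht

section

variable {s θ : ℝ} (hs : s ∈ Icc (0:ℝ) 1)
include hs

lemma excess_mem : excess s θ ∈ Icc (0:ℝ) 1 := by
  have h1 := bump_nonneg θ
  have h2 := bump_le_one θ
  unfold excess
  exact ⟨mul_nonneg hs.1 (by linarith), mul_le_one₀ hs.2 (by linarith) (by linarith)⟩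

/-- The square of the sine reaches one only where the cosine vanishes, and there the bump is one and
the excess zero. -/
lemma halfSum_radicand_pos : 0 < 1 - excess s θ * sin θ ^ 2 := by
  have h := excess_mem (θ := θ) hs
  have h1 := sin_sq_add_cos_sq θ
  by_cases hc : cos θ = 0
  · simp [excess, bump_eq_one hc]
  · have : 0 < cos θ ^ 2 := by positivity
    nlinarith [mul_le_of_le_one_left (sq_nonneg (sin θ)) h.2]

lemma halfSum_pos : 0 < halfSum s θ := sqrt_pos.2 (halfSum_radicand_pos hs)

lemma halfSum_sq : halfSum s θ ^ 2 = 1 - excess s θ * sin θ ^ 2 :=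
  sq_sqrt (halfSum_radicand_pos hs).le

/-- `factorA` is `(halfSum + cos) / (1 + cos)` with the division removed through `1 - halfSum =
excess * sin² / (1 + halfSum)`; this keeps it smooth where the cosine is -1. -/
lemma one_add_cos_mul_factorA : (1 + cos θ) * factorA s θ = halfSum s θ + cos θ := by
  have h := halfSum_pos (θ := θ) hs
  have h2 := halfSum_sq (θ := θ) hs
  have := sin_sq_add_cos_sq θ
  unfold factorA
  field_simp
  have : sin θ ^ 2 = 1 - cos θ ^ 2 := by linarith
  rw [this] at h2
  linear_combination (-1) * h2

lemma one_sub_cos_mul_factorB : (1 - cos θ) * factorB s θ = halfSum s θ - cos θ := by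
  have h := halfSum_pos (θ := θ) hs
  have h2 := halfSum_sq (θ := θ) hs
  have := sin_sq_add_cos_sq θ
  unfold factorB
  field_simp
  have : sin θ ^ 2 = 1 - cos θ ^ 2 := by linarith
  rw [this] at h2
  linear_combination (-1) * h2

lemma factorA_mul_factorB : factorA s θ * factorB s θ = 1 - excess s θ := by
  have h := halfSum_pos (θ := θ) hs
  have h2 := halfSum_sq (θ := θ) hs
  have := sin_sq_add_cos_sq θ
  unfold factorA factorB
  field_simp
  have : sin θ ^ 2 = 1 - cos θ ^ 2 := by linarith
  rw [this] at h2
  linear_combination (excess s θ) * h2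

lemma factorA_pos (hc : 0 < cos θ) : 0 < factorA s θ := by
  have h := halfSum_pos (θ := θ) hs
  have := one_add_cos_mul_factorA (θ := θ) hs
  by_contra h'
  nlinarith

lemma contDiffAt_halfSum : ContDiffAt ℝ ∞ (fun p : ℝ × ℝ => halfSum p.1 p.2) (s, θ) := by
  unfold halfSum excess
  refine ContDiffAt.sqrt ?_ (halfSum_radicand_pos (θ := θ) hs).ne'
  have := contDiff_bump
  fun_prop

lemma contDiffAt_factorA : ContDiffAt ℝ ∞ (fun p : ℝ × ℝ => factorA p.1 p.2) (s, θ) := by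
  have h := halfSum_pos (θ := θ) hs
  have h1 := contDiffAt_halfSum (θ := θ) hs
  have := contDiff_bump
  unfold factorA
  refine contDiffAt_const.sub (ContDiffAt.div ?_ (contDiffAt_const.add h1) (by simp only; linarith))
  unfold excess
  fun_prop

lemma contDiffAt_factorB : ContDiffAt ℝ ∞ (fun p : ℝ × ℝ => factorB p.1 p.2) (s, θ) := by
  have h := halfSum_pos (θ := θ) hs
  have h1 := contDiffAt_halfSum (θ := θ) hs
  have := contDiff_bump
  unfold factorB
  refine contDiffAt_const.sub (ContDiffAt.div ?_ (contDiffAt_const.add h1) (by simp only; linarith))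
  unfold excess
  fun_prop

end

lemma bump_periodic (θ : ℝ) : bump (θ + 2 * π) = bump θ := by simp [bump]

lemma factorA_periodic (s θ : ℝ) : factorA s (θ + 2 * π) = factorA s θ := by
  simp [factorA, halfSum, excess, bump_periodic]

lemma factorB_periodic (s θ : ℝ) : factorB s (θ + 2 * π) = factorB s θ := by
  simp [factorB, halfSum, excess, bump_periodic]

/-- The reflection `θ ↦ π - θ` exchanges the two coordinates and reduces statements on the second
axis to the first. -/
lemma bump_pi_sub (θ : ℝ) : bump (π - θ) = bump θ := by
  simp [bump, sin_pi_sub, cos_pi_sub, neg_div]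

lemma factorA_pi_sub (s θ : ℝ) : factorA s (π - θ) = factorB s θ := by
  simp [factorA, factorB, halfSum, excess, bump_pi_sub]

lemma factorB_pi_sub (s θ : ℝ) : factorB s (π - θ) = factorA s θ := by
  rw [← factorA_pi_sub, sub_sub_cancel]

lemma factorA_zero (θ : ℝ) : factorA 0 θ = 1 := by simp [factorA, excess]

lemma factorB_zero (θ : ℝ) : factorB 0 θ = 1 := by simp [factorB, excess]

/-- The two coordinates on the resolved axes. -/
noncomputable def coordA (s θ : ℝ) : ℝ := (halfSum s θ + cos θ) / sin θ

/-- The second coordinate on the resolved axes. -/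
noncomputable def coordB (s θ : ℝ) : ℝ := (halfSum s θ - cos θ) / sin θ

lemma sin_eq_two_mul (θ : ℝ) : sin θ = 2 * sin (θ / 2) * cos (θ / 2) := by
  rw [← sin_two_mul]; ring_nf

lemma one_add_cos_eq (θ : ℝ) : 1 + cos θ = 2 * cos (θ / 2) ^ 2 := by
  rw [cos_sq]; ring_nf

lemma one_sub_cos_eq (θ : ℝ) : 1 - cos θ = 2 * sin (θ / 2) ^ 2 := by
  have := one_add_cos_eq θ
  have := sin_sq_add_cos_sq (θ / 2)
  linarith

section

variable {s θ : ℝ} (hs : s ∈ Icc (0:ℝ) 1)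
include hs

lemma cos_half_mul_factorA (h : sin θ ≠ 0) :
    cos (θ / 2) * factorA s θ = sin (θ / 2) * coordA s θ := by
  have h1 := one_add_cos_mul_factorA (θ := θ) hs
  have h2 := sin_eq_two_mul θ
  have ha : cos (θ / 2) ≠ 0 := fun h0 => h (by rw [h2, h0, mul_zero])
  have hb : sin (θ / 2) ≠ 0 := fun h0 => h (by rw [h2, h0]; simp)
  unfold coordA
  rw [← h1, one_add_cos_eq, h2]
  field_simp

lemma sin_half_mul_factorB (h : sin θ ≠ 0) :
    sin (θ / 2) * factorB s θ = cos (θ / 2) * coordB s θ := by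
  have h1 := one_sub_cos_mul_factorB (θ := θ) hs
  have h2 := sin_eq_two_mul θ
  have ha : cos (θ / 2) ≠ 0 := fun h0 => h (by rw [h2, h0, mul_zero])
  have hb : sin (θ / 2) ≠ 0 := fun h0 => h (by rw [h2, h0]; simp)
  unfold coordB
  rw [← h1, one_sub_cos_eq, h2]
  field_simp

lemma coordA_mul_coordB (h : sin θ ≠ 0) : coordA s θ * coordB s θ = 1 - excess s θ := by
  have h2 := halfSum_sq (θ := θ) hs
  have := sin_sq_add_cos_sq θ
  unfold coordA coordB
  field_simp
  linear_combination h2 - this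

/-- The difference of the coordinates is `2 cot θ`, which fixes `θ` modulo `π`; their sum `2 *
halfSum / sin θ` has the sign of the sine and separates the two branches. -/
lemma coord_injective {θ' : ℝ} (h : sin θ ≠ 0) (h' : sin θ' ≠ 0)
    (hA : coordA s θ = coordA s θ') (hB : coordB s θ = coordB s θ') :
    cos θ = cos θ' ∧ sin θ = sin θ' := by
  have p := halfSum_pos (θ := θ) hs
  have p' := halfSum_pos (θ := θ') hs
  unfold coordA at hA
  unfold coordB at hB
  rw [div_eq_div_iff h h'] at hA hB
  have e1 : halfSum s θ * sin θ' = halfSum s θ' * sin θ := by linarith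
  have e2 : cos θ * sin θ' = cos θ' * sin θ := by linarith
  have q := sin_sq_add_cos_sq θ
  have q' := sin_sq_add_cos_sq θ'
  have e3 : sin θ ^ 2 = sin θ' ^ 2 := by
    linear_combination (-sin θ ^ 2) * q' + sin θ' ^ 2 * q
      - (cos θ * sin θ' + cos θ' * sin θ) * e2
  have hss : sin θ = sin θ' := by
    rcases sq_eq_sq_iff_eq_or_eq_neg.1 e3 with e | e
    · exact e
    · exfalso
      rw [e] at e1
      have : (halfSum s θ + halfSum s θ') * sin θ' = 0 := by linarith
      rcases mul_eq_zero.1 this with e | e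
      · linarith
      · exact h' e
  refine ⟨?_, hss⟩
  rw [hss] at e2
  exact mul_right_cancel₀ h' e2

/-- In the outer region, where `bump` vanishes, the first homogeneous coordinate determines
the point. -/
lemma outer_injective {θ' : ℝ} (hc : 0 < cos θ) (hc' : 0 < cos θ')
    (hb : bump θ = 0) (hb' : bump θ' = 0)
    (h : sin (θ / 2) * (cos (θ' / 2) * factorA s θ') = sin (θ' / 2) * (cos (θ / 2) * factorA s θ)) :
    cos θ = cos θ' ∧ sin θ = sin θ' := by
  have p := halfSum_pos (θ := θ) hs
  have p' := halfSum_pos (θ := θ') hs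
  have m := halfSum_sq (θ := θ) hs
  have m' := halfSum_sq (θ := θ') hs
  have k := one_add_cos_mul_factorA (θ := θ) hs
  have k' := one_add_cos_mul_factorA (θ := θ') hs
  have q := sin_sq_add_cos_sq θ
  have q' := sin_sq_add_cos_sq θ'
  have x1 : excess s θ = s := by simp [excess, hb]
  have x1' : excess s θ' = s := by simp [excess, hb']
  rw [x1] at m
  rw [x1'] at m'
  have hS : sin θ * (halfSum s θ' + cos θ') = sin θ' * (halfSum s θ + cos θ) := by
    rw [← k, ← k', one_add_cos_eq, one_add_cos_eq, sin_eq_two_mul θ, sin_eq_two_mul θ']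
    linear_combination (4 * cos (θ/2) * cos (θ'/2)) * h
  set N := halfSum s θ + cos θ with hN
  set N' := halfSum s θ' + cos θ' with hN'
  have pN : 0 < N := by linarith
  have pN' : 0 < N' := by linarith
  set y := sin θ / N with hy
  have eS : sin θ = y * N := by rw [hy]; field_simp
  have eS' : sin θ' = y * N' := by
    rw [hy]; field_simp; linarith
  have ec : 2 * cos θ = N * (1 - (1 - s) * y ^ 2) := by
    have : N * (2 * cos θ) = N * (N * (1 - (1 - s) * y ^ 2)) := by
      have : (y * N) ^ 2 = 1 - cos θ ^ 2 := by rw [← eS]; linarith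
      have hM : halfSum s θ = N - cos θ := by rw [hN]; ring
      rw [hM, eS] at m
      linear_combination (-1) * m + this
    exact mul_left_cancel₀ pN.ne' this
  have ec' : 2 * cos θ' = N' * (1 - (1 - s) * y ^ 2) := by
    have : N' * (2 * cos θ') = N' * (N' * (1 - (1 - s) * y ^ 2)) := by
      have : (y * N') ^ 2 = 1 - cos θ' ^ 2 := by rw [← eS']; linarith
      have hM : halfSum s θ' = N' - cos θ' := by rw [hN']; ring
      rw [hM, eS'] at m'
      linear_combination (-1) * m' + this
    exact mul_left_cancel₀ pN'.ne' this
  set r := (1 - (1 - s) * y ^ 2) with hr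
  have hrpos : 0 < r := by
    by_contra h0
    nlinarith
  have e1 : N ^ 2 * (4 * y ^ 2 + r ^ 2) = 4 := by
    rw [eS] at q; linear_combination 4 * q - (2 * cos θ + N * r) * ec
  have e2 : N' ^ 2 * (4 * y ^ 2 + r ^ 2) = 4 := by
    rw [eS'] at q'; linear_combination 4 * q' - (2 * cos θ' + N' * r) * ec'
  have hNN : N = N' := by
    have : N ^ 2 = N' ^ 2 := mul_right_cancel₀ (b := 4 * y ^ 2 + r ^ 2) (by positivity)
      (e1.trans e2.symm)
    exact (pow_left_inj₀ pN.le pN'.le two_ne_zero).1 this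
  refine ⟨?_, ?_⟩
  · rw [hNN] at ec; linarith
  · rw [eS, eS', hNN]

/-- The difference of the coordinates is `2 cot θ`, whose derivative has no zero. -/
lemma hasDerivAt_coordA (h : sin θ ≠ 0) : ∃ dA dB : ℝ, HasDerivAt (coordA s) dA θ ∧
    HasDerivAt (coordB s) dB θ ∧ dA ≠ dB := by
  have hM : DifferentiableAt ℝ (halfSum s) θ :=
    ((contDiffAt_halfSum (θ := θ) hs).comp θ (contDiffAt_const.prodMk contDiffAt_id)).differentiableAt
      (by simp)
  have dM := hM.hasDerivAt
  refine ⟨_, _, (dM.add (hasDerivAt_cos θ)).div (hasDerivAt_sin θ) h,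
    (dM.sub (hasDerivAt_cos θ)).div (hasDerivAt_sin θ) h, ?_⟩
  simp only [Pi.add_apply, Pi.sub_apply]
  intro e
  rw [div_left_inj' (by positivity)] at e
  have := sin_sq_add_cos_sq θ
  nlinarith

/-- In the outer region, the first homogeneous coordinate is an immersion. -/
lemma outer_immersion (hc : 0 < cos θ) (hb : sin θ ^ 2 < 4 * cos θ ^ 2) :
    ∃ d1 d2 : ℝ, HasDerivAt (fun t => sin (t / 2)) d1 θ ∧
      HasDerivAt (fun t => cos (t / 2) * factorA s t) d2 θ ∧
      sin (θ / 2) * d2 - d1 * (cos (θ / 2) * factorA s θ) ≠ 0 := by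
  have p := halfSum_pos (θ := θ) hs
  have hA : DifferentiableAt ℝ (factorA s) θ :=
    ((contDiffAt_factorA (θ := θ) hs).comp θ (contDiffAt_const.prodMk contDiffAt_id)).differentiableAt
      (by simp)
  have hhalf : HasDerivAt (fun t : ℝ => t / 2) (1 / 2) θ := (hasDerivAt_id θ).div_const 2
  have h1 : HasDerivAt (fun t => sin (t / 2)) (cos (θ / 2) * (1 / 2)) θ :=
    hhalf.sin
  have h1c : HasDerivAt (fun t => cos (t / 2)) (-sin (θ / 2) * (1 / 2)) θ :=
    hhalf.cos
  have h2 := h1c.mul hA.hasDerivAt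
  refine ⟨_, _, h1, h2, ?_⟩
  have hev : ∀ᶠ t in 𝓝 θ, sin t ^ 2 < 4 * cos t ^ 2 :=
    (by fun_prop : Continuous fun t => sin t ^ 2).continuousAt.eventually_lt
      (by fun_prop : Continuous fun t => 4 * cos t ^ 2).continuousAt hb
  have hx : excess s θ = s := by simp [excess, bump_eq_zero hb.le]
  have hMd : HasDerivAt (halfSum s) (-(s * sin θ * cos θ) / halfSum s θ) θ := by
    have hpos := halfSum_radicand_pos (θ := θ) hs
    rw [hx] at hpos
    have h3 : HasDerivAt (fun t => √(1 - s * sin t ^ 2))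
        (-(s * (2 * sin θ * cos θ)) / (2 * √(1 - s * sin θ ^ 2))) θ := by
      have h4 : HasDerivAt (fun t => 1 - s * sin t ^ 2) (-(s * (2 * sin θ * cos θ))) θ := by
        have := (((hasDerivAt_sin θ).pow 2).const_mul s).const_sub 1
        simpa using this
      exact h4.sqrt hpos.ne'
    have e : halfSum s θ = √(1 - s * sin θ ^ 2) := by rw [halfSum, hx]
    have h5 : HasDerivAt (halfSum s) (-(s * (2 * sin θ * cos θ)) / (2 * √(1 - s * sin θ ^ 2))) θ := by
      refine h3.congr_of_eventuallyEq ?_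
      filter_upwards [hev] with t ht
      simp [halfSum, excess, bump_eq_zero ht.le]
    rw [← e] at h5
    convert h5 using 1
    field_simp
  have hprod := h1c.mul h2
  have hN : HasDerivAt (fun t => halfSum s t + cos t)
      (-(s * sin θ * cos θ) / halfSum s θ + -sin θ) θ := hMd.add (hasDerivAt_cos θ)
  have hN' : HasDerivAt (fun t => halfSum s t + cos t) (2 * (-sin (θ / 2) * (1 / 2) *
      (cos (θ / 2) * factorA s θ) + cos (θ / 2) * (-sin (θ / 2) * (1 / 2) * factorA s θ +
        cos (θ / 2) * deriv (factorA s) θ))) θ := by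
    refine (hprod.const_mul 2).congr_of_eventuallyEq (Eventually.of_forall fun t => ?_)
    have := one_add_cos_mul_factorA (θ := t) hs
    simp only [Pi.mul_apply]
    rw [← this, one_add_cos_eq]; ring
  have e := hN.unique hN'
  have k := one_add_cos_mul_factorA (θ := θ) hs
  rw [one_add_cos_eq] at k
  have hcos : cos θ = 2 * cos (θ/2) ^ 2 - 1 := by have := one_add_cos_eq θ; linarith
  have hcos' : cos θ = cos (θ/2) ^ 2 - sin (θ/2) ^ 2 := by
    have := sin_sq_add_cos_sq (θ/2); linarith
  have hsin := sin_eq_two_mul θ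
  have q := sin_sq_add_cos_sq θ
  intro h0
  -- The pair `(sin, halfSum + cos)` is `2 cos (θ / 2)` times the pair in the goal, so the
  -- Wronskians differ by the square of this factor; the Wronskian of the former is negative.
  have key : sin θ * (-(s * sin θ * cos θ) / halfSum s θ + -sin θ)
      - cos θ * (halfSum s θ + cos θ) = 0 := by
    rw [e, ← k, hsin, hcos']
    linear_combination (4 * cos (θ/2) ^ 2) * h0
  have : 0 < s * sin θ ^ 2 * cos θ / halfSum s θ + 1 + cos θ * halfSum s θ := by
    have := hs.1
    positivity
  have e3 : sin θ * (-(s * sin θ * cos θ) / halfSum s θ + -sin θ)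
      - cos θ * (halfSum s θ + cos θ) =
      -(s * sin θ ^ 2 * cos θ / halfSum s θ + 1 + cos θ * halfSum s θ) := by
    linear_combination (-1) * q
  linarith

end

end RatKnot

/-! ### Homogeneous lifts, crossings and the sum surface -/

namespace RatKnot

open Filter Topology Set Real

/-- A smooth homogeneous map of degree `d` from the plane to `ℝ⁴`. -/
structure IsHomogeneousMap (d : ℕ) (F : ℝ × ℝ → Fin 4 → ℝ) : Prop where
  contDiff : ContDiff ℝ ∞ F
  homog : ∀ (c : ℝ) z, F (c • z) = c ^ d • F z

/-- A smooth homogeneous map from the plane to `ℝ⁴` that induces an embedding of the real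
projective line in real projective three-space. -/
structure IsEmbeddedLift (d : ℕ) (F : ℝ × ℝ → Fin 4 → ℝ) : Prop extends IsHomogeneousMap d F where
  ne_zero : ∀ z, z ≠ 0 → F z ≠ 0
  injective : ∀ z w, z ≠ 0 → w ≠ 0 → wedge (F z) (F w) = 0 → z.1 * w.2 = z.2 * w.1
  immersion : ∀ z w, z ≠ 0 → wedge (F z) (fderiv ℝ F z w) = 0 → z.1 * w.2 = z.2 * w.1

lemma exists_polar {z : ℝ × ℝ} (hz : z ≠ 0) :
    ∃ c α : ℝ, 0 < c ∧ α ∈ Icc (-π) π ∧ z = c • (cos α, sin α) := by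
  set w : ℂ := ⟨z.1, z.2⟩ with hw
  have hw0 : w ≠ 0 := fun h => hz (Prod.ext (congrArg Complex.re h) (congrArg Complex.im h))
  refine ⟨‖w‖, w.arg, norm_pos_iff.2 hw0, ⟨(Complex.neg_pi_lt_arg w).le, Complex.arg_le_pi w⟩, ?_⟩
  ext
  · simp only [Complex.cos_arg hw0, Prod.smul_mk, smul_eq_mul]; rw [mul_div_cancel₀ _ (norm_ne_zero_iff.2 hw0)]
  · simp only [Complex.sin_arg, Prod.smul_mk, smul_eq_mul]; rw [mul_div_cancel₀ _ (norm_ne_zero_iff.2 hw0)]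

/-- A factor `c` of either sign is allowed, because only the projective point matters; this is what
brings the angle within `π / 2` of `α`. -/
lemma exists_polar_near {z : ℝ × ℝ} (hz : z ≠ 0) (α : ℝ) :
    ∃ c α' : ℝ, c ≠ 0 ∧ |α' - α| ≤ π / 2 ∧ z = c • (cos α', sin α') := by
  set p := z.1 * cos α + z.2 * sin α with hp
  set q := z.2 * cos α - z.1 * sin α with hq
  have hsc := sin_sq_add_cos_sq α
  have e1 : z.1 = p * cos α - q * sin α := by
    rw [hp, hq]; linear_combination (-z.1) * hsc
  have e2 : z.2 = p * sin α + q * cos α := by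
    rw [hp, hq]; linear_combination (-z.2) * hsc
  by_cases h : p = 0
  · refine ⟨q, α + π / 2, ?_, ?_, ?_⟩
    · rintro h'
      exact hz (Prod.ext (by simp [e1, h, h']) (by simp [e2, h, h']))
    · rw [add_sub_cancel_left, abs_of_pos (by positivity)]
    · ext
      · rw [e1, h]; simp [cos_add]
      · rw [e2, h]; simp [sin_add]
  · have hb := arctan_lt_pi_div_two (q / p)
    have hb' := neg_pi_div_two_lt_arctan (q / p)
    have hc := cos_arctan_pos (q / p)
    have ht : sin (arctan (q / p)) * p = q * cos (arctan (q / p)) := by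
      have h3 := tan_arctan (q / p)
      rw [tan_eq_sin_div_cos, div_eq_div_iff hc.ne' h] at h3
      exact h3
    refine ⟨p / cos (arctan (q / p)), α + arctan (q / p), div_ne_zero h hc.ne', ?_, ?_⟩
    · rw [add_sub_cancel_left]; exact abs_le.2 ⟨by linarith, hb.le⟩
    · ext
      · rw [e1]; simp only [cos_add, Prod.smul_mk, smul_eq_mul]
        field_simp
        linear_combination sin α * ht
      · rw [e2]; simp only [sin_add, Prod.smul_mk, smul_eq_mul]
        field_simp
        linear_combination (-cos α) * ht

namespace IsHomogeneousMap

variable {d : ℕ} {F : ℝ × ℝ → Fin 4 → ℝ} (hF : IsHomogeneousMap d F)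
include hF

lemma differentiable : Differentiable ℝ F := hF.contDiff.differentiable (by simp)

lemma fderiv_self (z : ℝ × ℝ) : fderiv ℝ F z z = (d : ℝ) • F z := by
  have h1 : HasDerivAt (fun t : ℝ => F (t • z)) (fderiv ℝ F z z) 1 := by
    have h2 : HasFDerivAt F (fderiv ℝ F z) ((1:ℝ) • z) := by
      rw [one_smul]; exact (hF.differentiable z).hasFDerivAt
    have h3 : HasDerivAt (fun t : ℝ => t • z) z 1 := by
      simpa using (hasDerivAt_id (1:ℝ)).smul_const z
    exact h2.comp_hasDerivAt (1:ℝ) h3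
  have h2 : HasDerivAt (fun t : ℝ => t ^ d • F z) ((d : ℝ) • F z) 1 := by
    simpa using (hasDerivAt_pow d (1:ℝ)).smul_const (F z)
  simp only [hF.homog] at h1
  exact h1.unique h2

lemma smul_fderiv_smul (c : ℝ) (z h : ℝ × ℝ) :
    c • fderiv ℝ F (c • z) h = c ^ d • fderiv ℝ F z h := by
  have h1 : HasFDerivAt (fun w : ℝ × ℝ => F (c • w))
      ((fderiv ℝ F (c • z)).comp (c • ContinuousLinearMap.id ℝ (ℝ × ℝ))) z :=
    (hF.differentiable (c • z)).hasFDerivAt.comp z ((hasFDerivAt_id z).const_smul c)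
  have h2 : HasFDerivAt (fun w : ℝ × ℝ => F (c • w)) (c ^ d • fderiv ℝ F z) z := by
    simp only [hF.homog]
    exact (hF.differentiable z).hasFDerivAt.const_smul (c ^ d)
  have := congrArg (fun L : (ℝ × ℝ) →L[ℝ] (Fin 4 → ℝ) => L h) (h1.unique h2)
  simpa using this

/-- By Euler's identity the radial derivative is proportional to the value, so only the angular
derivative has to be independent of it. -/
lemma cross_eq_zero_of_wedge {c α : ℝ} (hc : c ≠ 0) {h : ℝ × ℝ}
    (hne : wedge (F (cos α, sin α)) (fderiv ℝ F (cos α, sin α) (-sin α, cos α)) ≠ 0)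
    (hw : wedge (F (c • (cos α, sin α))) (fderiv ℝ F (c • (cos α, sin α)) h) = 0) :
    (c • (cos α, sin α)).1 * h.2 = (c • (cos α, sin α)).2 * h.1 := by
  set u : ℝ × ℝ := (cos α, sin α) with hu
  set u' : ℝ × ℝ := (-sin α, cos α) with hu'
  have hsc := sin_sq_add_cos_sq α
  set p := h.1 * cos α + h.2 * sin α with hp
  set q := h.2 * cos α - h.1 * sin α with hq
  have e : h = p • u + q • u' := by
    ext
    · simp [hu, hu', hp, hq]; linear_combination (-h.1) * hsc
    · simp [hu, hu', hp, hq]; linear_combination (-h.2) * hsc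
  have h1 : c • fderiv ℝ F (c • u) h = c ^ d • (p * d) • F u + (c ^ d * q) • fderiv ℝ F u u' := by
    rw [hF.smul_fderiv_smul, e, map_add, map_smul, map_smul, hF.fderiv_self]
    simp only [smul_add, smul_smul]
  have h2 : wedge (F (c • u)) (c • fderiv ℝ F (c • u) h) = 0 := by
    rw [wedge_smul_right, hw, smul_zero]
  rw [h1, hF.homog, wedge_add_right, wedge_smul_left, wedge_smul_left, wedge_smul_right,
    wedge_smul_right, wedge_smul_right, wedge_self, smul_zero, smul_zero, smul_zero, zero_add,
    smul_smul, smul_eq_zero] at h2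
  have hq0 : q = 0 := by
    rcases h2 with h2 | h2
    · simpa [hc] using h2
    · exact absurd h2 hne
  simp only [Prod.smul_fst, Prod.smul_snd, hu, smul_eq_mul]
  linear_combination c * hq0

end IsHomogeneousMap

/-- The sum of the curves `f` and `g` in the affine chart `l ≠ 0` with origin `e`, in homogeneous
coordinates. -/
def affineSum (f g : ℝ × ℝ → Fin 4 → ℝ) (l : (Fin 4 → ℝ) →L[ℝ] ℝ) (e : Fin 4 → ℝ)
    (z w : ℝ × ℝ) : Fin 4 → ℝ :=
  l (g w) • f z + l (f z) • g w - (l (f z) * l (g w)) • e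

/-- Two embedded curves that meet in one point `e`, transversely and at the parameter `(1 : 0)`
on both, where `l e = 1`. -/
structure IsCrossing (m n : ℕ) (f g : ℝ × ℝ → Fin 4 → ℝ) (l : (Fin 4 → ℝ) →L[ℝ] ℝ)
    (e : Fin 4 → ℝ) : Prop where
  fst : IsEmbeddedLift m f
  snd : IsEmbeddedLift n g
  map_e : l e = 1
  fst_one : f (1, 0) = e
  snd_one : g (1, 0) = e
  disjoint : ∀ z w, z ≠ 0 → w ≠ 0 → wedge (f z) (g w) = 0 → z.2 = 0 ∧ w.2 = 0
  transverse : ∀ a b c : ℝ,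
    a • e + b • fderiv ℝ f (1, 0) (0, 1) + c • fderiv ℝ g (1, 0) (0, 1) = 0 → b = 0 ∧ c = 0

section

variable {m n : ℕ} {f g : ℝ × ℝ → Fin 4 → ℝ} {l : (Fin 4 → ℝ) →L[ℝ] ℝ} {e : Fin 4 → ℝ}

lemma affineSum_comm (z w : ℝ × ℝ) : affineSum f g l e z w = affineSum g f l e w z := by
  simp only [affineSum]
  rw [mul_comm, add_comm]

lemma IsCrossing.symm (h : IsCrossing m n f g l e) : IsCrossing n m g f l e where
  fst := h.snd
  snd := h.fst
  map_e := h.map_e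
  fst_one := h.snd_one
  snd_one := h.fst_one
  disjoint z w hz hw h0 := (h.disjoint w z hw hz (wedge_comm_eq_zero.1 h0)).symm
  transverse a b c h0 := (h.transverse a c b (by rw [← h0]; abel)).symm

/-- The reflection of the parameter plane. -/
def reflect (z : ℝ × ℝ) : ℝ × ℝ := (z.1, -z.2)

lemma reflect_reflect (z : ℝ × ℝ) : reflect (reflect z) = z := by simp [reflect]

lemma reflect_ne_zero {z : ℝ × ℝ} (hz : z ≠ 0) : reflect z ≠ 0 := by
  intro h; apply hz; rw [← reflect_reflect z, h]; simp [reflect]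

lemma fderiv_comp_reflect {f : ℝ × ℝ → Fin 4 → ℝ} (hf : Differentiable ℝ f) (z h : ℝ × ℝ) :
    fderiv ℝ (fun w => f (reflect w)) z h = fderiv ℝ f (reflect z) (reflect h) := by
  let A : (ℝ × ℝ) →L[ℝ] (ℝ × ℝ) :=
    (ContinuousLinearMap.fst ℝ ℝ ℝ).prod (-ContinuousLinearMap.snd ℝ ℝ ℝ)
  have hA : ∀ w, A w = reflect w := fun w => rfl
  have h1 : HasFDerivAt (fun w => f (A w)) ((fderiv ℝ f (A z)).comp A) z :=
    (hf (A z)).hasFDerivAt.comp z A.hasFDerivAt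
  simp only [hA] at h1
  rw [h1.fderiv]; rfl

lemma IsEmbeddedLift.reflect {d : ℕ} (hf : IsEmbeddedLift d f) :
    IsEmbeddedLift d (fun z => f (reflect z)) where
  contDiff := hf.contDiff.comp (by unfold RatKnot.reflect; fun_prop)
  homog c z := by
    rw [← hf.homog]; congr 1; simp [RatKnot.reflect]
  ne_zero z hz := hf.ne_zero _ (reflect_ne_zero hz)
  injective z w hz hw h := by
    have := hf.injective _ _ (reflect_ne_zero hz) (reflect_ne_zero hw) h
    simp only [RatKnot.reflect] at this; linarith
  immersion z w hz h := by
    rw [fderiv_comp_reflect hf.differentiable] at h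
    have := hf.immersion _ _ (reflect_ne_zero hz) h
    simp only [RatKnot.reflect] at this; linarith

/-- This turns the construction for one sign of the resolution into that for the other. -/
lemma IsCrossing.reflect (h : IsCrossing m n f g l e) :
    IsCrossing m n f (fun z => g (reflect z)) l e where
  fst := h.fst
  snd := h.snd.reflect
  map_e := h.map_e
  fst_one := h.fst_one
  snd_one := by simpa [RatKnot.reflect] using h.snd_one
  disjoint z w hz hw h0 := by
    have := h.disjoint z _ hz (reflect_ne_zero hw) h0
    simpa [RatKnot.reflect] using this
  transverse a b c h0 := by
    rw [fderiv_comp_reflect h.snd.differentiable] at h0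
    have e1 : RatKnot.reflect (0, 1) = (-1 : ℝ) • ((0 : ℝ), (1 : ℝ)) := by simp [RatKnot.reflect]
    have e2 : RatKnot.reflect (1, 0) = (1, 0) := by simp [RatKnot.reflect]
    rw [e1, e2, map_smul, smul_smul] at h0
    have := h.transverse a b (c * -1) h0
    simpa using this

lemma affineSum_smul_smul {m n : ℕ} (hf : IsHomogeneousMap m f) (hg : IsHomogeneousMap n g)
    (c c' : ℝ) (z w : ℝ × ℝ) :
    affineSum f g l e (c • z) (c' • w) = (c ^ m * c' ^ n) • affineSum f g l e z w := by
  simp only [affineSum, hf.homog, hg.homog, map_smul, smul_eq_mul, smul_add, smul_sub, smul_smul]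
  ring_nf

lemma contDiff_affineSum {m n : ℕ} (hf : IsHomogeneousMap m f) (hg : IsHomogeneousMap n g) :
    ContDiff ℝ ∞ (fun p : (ℝ × ℝ) × (ℝ × ℝ) => affineSum f g l e p.1 p.2) := by
  have := hf.contDiff
  have := hg.contDiff
  unfold affineSum
  fun_prop

namespace IsCrossing

variable (h : IsCrossing m n f g l e)
include h

lemma affineSum_one (z : ℝ × ℝ) : affineSum f g l e z (1, 0) = f z := by
  simp [affineSum, h.snd_one, h.map_e]

lemma affineSum_axis (z : ℝ × ℝ) (c : ℝ) : affineSum f g l e z (c, 0) = c ^ n • f z := by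
  have e1 : ((c, 0) : ℝ × ℝ) = c • ((1 : ℝ), (0 : ℝ)) := by simp
  have := affineSum_smul_smul (l := l) (e := e) h.fst.toIsHomogeneousMap h.snd.toIsHomogeneousMap 1 c z (1, 0)
  rw [one_smul, one_pow, one_mul, h.affineSum_one] at this
  rw [e1, this]

end IsCrossing

/-- The points `(u, v)` of the sum surface with `u v = a`. -/
def outerCurve (f g : ℝ × ℝ → Fin 4 → ℝ) (l : (Fin 4 → ℝ) →L[ℝ] ℝ) (e : Fin 4 → ℝ)
    (a : ℝ) (z : ℝ × ℝ) : Fin 4 → ℝ :=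
  affineSum f g l e z (z.2, a * z.1)

/-- A chart of projective space near the crossing, in which the curves are two coordinate axes. -/
def localChart (f g : ℝ × ℝ → Fin 4 → ℝ) (l : (Fin 4 → ℝ) →L[ℝ] ℝ) (e E : Fin 4 → ℝ)
    (x : Fin 3 → ℝ) : Fin 4 → ℝ :=
  affineSum f g l e (1, x 0) (1, x 1) + x 2 • E

namespace IsCrossing

variable (h : IsCrossing m n f g l e)
include h

lemma isHomogeneousMap_outerCurve (a : ℝ) : IsHomogeneousMap (m + n) (outerCurve f g l e a) where
  contDiff := (contDiff_affineSum h.fst.toIsHomogeneousMap h.snd.toIsHomogeneousMap).comp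
    (by fun_prop : ContDiff ℝ ∞ fun z : ℝ × ℝ => (z, (z.2, a * z.1)))
  homog c z := by
    rw [outerCurve, outerCurve, pow_add, ← affineSum_smul_smul h.fst.toIsHomogeneousMap h.snd.toIsHomogeneousMap]
    congr 1; ext <;> simp; ring

lemma contDiff_outerCurve :
    ContDiff ℝ ∞ (fun p : ℝ × (ℝ × ℝ) => outerCurve f g l e p.1 p.2) :=
  (contDiff_affineSum h.fst.toIsHomogeneousMap h.snd.toIsHomogeneousMap).comp
    (by fun_prop : ContDiff ℝ ∞ fun p : ℝ × (ℝ × ℝ) => (p.2, (p.2.2, p.1 * p.2.1)))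

lemma contDiff_localChart (E : Fin 4 → ℝ) : ContDiff ℝ ∞ (localChart f g l e E) := by
  unfold localChart
  refine ContDiff.add ?_ (by fun_prop)
  exact (contDiff_affineSum h.fst.toIsHomogeneousMap h.snd.toIsHomogeneousMap).comp
    (by fun_prop : ContDiff ℝ ∞ fun x : Fin 3 → ℝ => (((1:ℝ), x 0), ((1:ℝ), x 1)))

/-- The degenerate curve is `f` up to a factor that is nonzero off the crossing parameter. Hence the
restriction to `r * |z.1| ≤ |z.2|` in the stability statements. -/
lemma outerCurve_zero (z : ℝ × ℝ) : outerCurve f g l e 0 z = z.2 ^ n • f z := by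
  rw [outerCurve, zero_mul, h.affineSum_axis]

lemma localChart_zero (E : Fin 4 → ℝ) : localChart f g l e E 0 = e := by
  simp [localChart, h.affineSum_one, h.fst_one]

lemma localChart_first_axis (E : Fin 4 → ℝ) {x : Fin 3 → ℝ} (h1 : x 1 = 0) (h2 : x 2 = 0) :
    localChart f g l e E x = f (1, x 0) := by
  simp [localChart, h1, h2, h.affineSum_one]

lemma localChart_second_axis (E : Fin 4 → ℝ) {x : Fin 3 → ℝ} (h1 : x 0 = 0) (h2 : x 2 = 0) :
    localChart f g l e E x = g (1, x 1) := by
  rw [localChart, affineSum_comm, h1, h.symm.affineSum_one]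
  simp [h2]

end IsCrossing

end

end RatKnot

/-! ### Embeddedness away from the crossing and the chart at the crossing -/

namespace RatKnot

open Filter Topology Set Real

lemma polar_ne_zero (α : ℝ) : ((cos α, sin α) : ℝ × ℝ) ≠ 0 := by
  intro h0
  have h1 : cos α = 0 := congrArg Prod.fst h0
  have h2 : sin α = 0 := congrArg Prod.snd h0
  have := sin_sq_add_cos_sq α
  simp [h1, h2] at this

lemma sin_ne_zero_of_le {r α : ℝ} (hr : 0 < r) (hα : r * |cos α| ≤ |sin α|) : sin α ≠ 0 := by
  intro h0
  have := sin_sq_add_cos_sq α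
  rw [h0, abs_zero] at hα
  have : |cos α| ≤ 0 := by
    by_contra hc
    push Not at hc
    nlinarith [mul_pos hr hc]
  have : cos α = 0 := abs_nonpos_iff.1 this
  simp_all

namespace IsCrossing

variable {m n : ℕ} {f g : ℝ × ℝ → Fin 4 → ℝ} {l : (Fin 4 → ℝ) →L[ℝ] ℝ} {e : Fin 4 → ℝ}
  (h : IsCrossing m n f g l e)
include h

lemma e_ne_zero : e ≠ 0 := by
  rintro rfl; have := h.map_e; simp at this

/-- At `a = 0` this is the embeddedness of `f`; the range of parameters is compact in the projective
line, so it persists for small `a`. -/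
lemma eventually_outerCurve_embedded {r : ℝ} (hr : 0 < r) :
    ∀ᶠ a in 𝓝 (0:ℝ),
      (∀ z w, z ≠ 0 → w ≠ 0 → r * |z.1| ≤ |z.2| → r * |w.1| ≤ |w.2| →
        wedge (outerCurve f g l e a z) (outerCurve f g l e a w) = 0 → z.1 * w.2 = z.2 * w.1) ∧
      ∀ z w, z ≠ 0 → r * |z.1| ≤ |z.2| →
        wedge (outerCurve f g l e a z) (fderiv ℝ (outerCurve f g l e a) z w) = 0 →
          z.1 * w.2 = z.2 * w.1 := by
  let c : ℝ → ℝ × ℝ := fun α => (cos α, sin α)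
  let F : ℝ × Unit → ℝ → Fin 4 → ℝ := fun a α => outerCurve f g l e a.1 (c α)
  let F' : ℝ × Unit → ℝ → Fin 4 → ℝ := fun a α =>
    fderiv ℝ (outerCurve f g l e a.1) (c α) (-sin α, cos α)
  have hcd : ∀ α, HasDerivAt c (-sin α, cos α) α := fun α =>
    (hasDerivAt_cos α).prodMk (hasDerivAt_sin α)
  have hcc : Continuous c := by fun_prop
  have hO := h.contDiff_outerCurve
  have hF : Continuous fun p : (ℝ × Unit) × ℝ => F p.1 p.2 :=
    hO.continuous.comp (by fun_prop : Continuous fun p : (ℝ × Unit) × ℝ => (p.1.1, c p.2))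
  have hF' : Continuous fun p : (ℝ × Unit) × ℝ => F' p.1 p.2 := by
    have h1 : ContDiff ℝ 0 (fun q : ℝ × (ℝ × ℝ) => fderiv ℝ (outerCurve f g l e q.1) q.2) :=
      ContDiff.fderiv (n := 0) (m := ∞) (f := fun q : ℝ × (ℝ × ℝ) => outerCurve f g l e q.1)
        (hO.comp (by fun_prop : ContDiff ℝ ∞ fun q : (ℝ × (ℝ × ℝ)) × (ℝ × ℝ) => (q.1.1, q.2)))
        contDiff_snd (by exact_mod_cast le_top)
    exact (h1.continuous.comp (by fun_prop : Continuous fun p : (ℝ × Unit) × ℝ =>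
      (p.1.1, c p.2))).clm_apply (by fun_prop)
  have hd : ∀ x α, HasDerivAt (F x) (F' x α) α := fun x α =>
    ((h.isHomogeneousMap_outerCurve x.1).differentiable (c α)).hasFDerivAt.comp_hasDerivAt α (hcd α)
  -- Angles that differ by `π` give the same projective point. The bound `π / 2` excludes such
  -- pairs, and `exists_polar_near` shows that the remaining ones suffice.
  let K : Set (ℝ × ℝ) := {p | p.1 ∈ Icc (-π) π ∧ p.2 ∈ Icc (-(2 * π)) (2 * π) ∧ |p.2 - p.1| ≤ π / 2 ∧
    r * |cos p.1| ≤ |sin p.1| ∧ r * |cos p.2| ≤ |sin p.2|}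
  have hK : IsCompact K := by
    refine (isCompact_Icc.prod isCompact_Icc).of_isClosed_subset
      (s := Icc (-π) π ×ˢ Icc (-(2 * π)) (2 * π)) ?_ fun p hp => ⟨hp.1, hp.2.1⟩
    simp only [K, mem_Icc, Set.ofPred_and]
    refine IsClosed.inter (IsClosed.inter ?_ ?_) (IsClosed.inter (IsClosed.inter ?_ ?_)
      (IsClosed.inter ?_ (IsClosed.inter ?_ ?_))) <;>
    exact isClosed_le (by fun_prop) (by fun_prop)
  have key := eventually_wedge_ne_zero hF hF' hd 0 (isCompact_univ (X := Unit)) hK ?_ ?_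
  · filter_upwards [key] with a ha
    obtain ⟨ha1, ha2⟩ := ha () (mem_univ _)
    have ho := h.isHomogeneousMap_outerCurve a
    have hmem : ∀ {c α : ℝ}, c ≠ 0 → r * |(c • (cos α, sin α)).1| ≤ |(c • (cos α, sin α)).2| →
        r * |cos α| ≤ |sin α| := by
      intro c α hc hle
      simp only [Prod.smul_fst, Prod.smul_snd, smul_eq_mul, abs_mul] at hle
      have : 0 < |c| := abs_pos.2 hc
      exact le_of_mul_le_mul_left (by linarith) this
    refine ⟨?_, ?_⟩
    · intro z w hz hw hzr hwr h0
      obtain ⟨c1, α, hc1, hα, rfl⟩ := exists_polar hz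
      obtain ⟨c2, α', hc2, hα', rfl⟩ := exists_polar_near hw α
      rw [ho.homog, ho.homog, wedge_smul_left, wedge_smul_right, smul_smul, smul_eq_zero] at h0
      have h1 : wedge (outerCurve f g l e a (cos α, sin α))
          (outerCurve f g l e a (cos α', sin α')) = 0 := by
        rcases h0 with h0 | h0
        · exact absurd h0 (by positivity)
        · exact h0
      have hαα : α = α' := by
        by_contra hne
        refine ha1 α α' ⟨hα, ?_, hα', hmem hc1.ne' hzr, hmem hc2 hwr⟩ hne h1
        have := abs_le.1 hα'
        have := pi_pos
        exact ⟨by linarith [hα.1], by linarith [hα.2]⟩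
      subst hαα
      simp; ring
    · intro z w hz hzr h0
      obtain ⟨c1, α, hc1, hα, rfl⟩ := exists_polar hz
      refine ho.cross_eq_zero_of_wedge hc1.ne' (ha2 α ?_) h0
      have := pi_pos
      refine ⟨hα, ⟨by linarith [hα.1], by linarith [hα.2]⟩, by simp; positivity,
        hmem hc1.ne' hzr, hmem hc1.ne' hzr⟩
  · intro _ _ α α' hk hne h0
    simp only [F, h.outerCurve_zero, wedge_smul_left, wedge_smul_right, smul_eq_zero] at h0
    have s1 := sin_ne_zero_of_le hr hk.2.2.2.1
    have s2 := sin_ne_zero_of_le hr hk.2.2.2.2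
    simp only [c, pow_eq_zero_iff', s1, s2, false_and, false_or] at h0
    have h2 := h.fst.injective _ _ (polar_ne_zero α) (polar_ne_zero α') h0
    have h3 : sin (α' - α) = 0 := by
      rw [sin_sub]; simp only at h2; linarith
    have h4 := abs_le.1 hk.2.2.1
    simp only at h4
    have := pi_pos
    have h5 := (sin_eq_zero_iff_of_lt_of_lt (by linarith) (by linarith)).1 h3
    exact hne (by linarith)
  · intro _ _ α hk h0
    have s1 := sin_ne_zero_of_le hr hk.2.2.2.1
    have hd1 := hd (0, ()) α
    have hd2 := (((hasDerivAt_sin α).pow n).smul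
      ((h.fst.differentiable (c α)).hasFDerivAt.comp_hasDerivAt α (hcd α))).congr_of_eventuallyEq
      (f₁ := F (0, ())) (Eventually.of_forall fun t => by simp [F, h.outerCurve_zero, c])
    rw [hd1.unique hd2] at h0
    simp only [F, h.outerCurve_zero, Pi.pow_apply, Function.comp_apply, c, wedge_add_right,
      wedge_smul_left, wedge_smul_right, wedge_self, smul_zero, add_zero, smul_eq_zero, pow_eq_zero_iff', s1,
      false_and, false_or] at h0
    have h2 := h.fst.immersion _ _ (polar_ne_zero α) h0
    have := sin_sq_add_cos_sq α
    simp only at h2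
    nlinarith

/-- At `a = 0` these are arcs of `f` and `g` that avoid the only common point. -/
lemma eventually_outerCurve_disjoint {r : ℝ} (hr : 0 < r) :
    ∀ᶠ a in 𝓝 (0:ℝ), ∀ z w, z ≠ 0 → w ≠ 0 → r * |z.1| ≤ |z.2| → r * |w.1| ≤ |w.2| →
      wedge (outerCurve f g l e a z) (outerCurve g f l e a w) ≠ 0 := by
  let K : Set (ℝ × ℝ) := {p | p.1 ∈ Icc (-π) π ∧ p.2 ∈ Icc (-π) π ∧
    r * |cos p.1| ≤ |sin p.1| ∧ r * |cos p.2| ≤ |sin p.2|}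
  have hK : IsCompact K := by
    refine (isCompact_Icc.prod isCompact_Icc).of_isClosed_subset
      (s := Icc (-π) π ×ˢ Icc (-π) π) ?_ fun p hp => ⟨hp.1, hp.2.1⟩
    simp only [K, mem_Icc, Set.ofPred_and]
    refine IsClosed.inter (IsClosed.inter ?_ ?_) (IsClosed.inter (IsClosed.inter ?_ ?_)
      (IsClosed.inter ?_ ?_)) <;>
    exact isClosed_le (by fun_prop) (by fun_prop)
  have hev : ∀ᶠ a in 𝓝 (0:ℝ), ∀ p ∈ K, wedge (outerCurve f g l e a (cos p.1, sin p.1))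
      (outerCurve g f l e a (cos p.2, sin p.2)) ≠ 0 := by
    refine hK.eventually_forall_of_forall_eventually fun p hp => ?_
    have hcont : Continuous fun q : ℝ × (ℝ × ℝ) =>
        wedge (outerCurve f g l e q.1 (cos q.2.1, sin q.2.1))
          (outerCurve g f l e q.1 (cos q.2.2, sin q.2.2)) :=
      (h.contDiff_outerCurve.continuous.comp (by fun_prop : Continuous fun q : ℝ × (ℝ × ℝ) =>
        (q.1, (cos q.2.1, sin q.2.1)))).wedge
      (h.symm.contDiff_outerCurve.continuous.comp (by fun_prop : Continuous fun q : ℝ × (ℝ × ℝ) =>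
        (q.1, (cos q.2.2, sin q.2.2))))
    refine hcont.continuousAt.eventually_ne ?_
    simp only [h.outerCurve_zero, h.symm.outerCurve_zero, wedge_smul_left, wedge_smul_right]
    have s1 := sin_ne_zero_of_le hr hp.2.2.1
    have s2 := sin_ne_zero_of_le hr hp.2.2.2
    intro h0
    simp only [smul_eq_zero, pow_eq_zero_iff', s1, s2, false_and, false_or] at h0
    exact s1 (h.disjoint _ _ (polar_ne_zero _) (polar_ne_zero _) h0).1
  filter_upwards [hev] with a ha z w hz hw hzr hwr h0
  obtain ⟨c1, α, hc1, hα, rfl⟩ := exists_polar hz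
  obtain ⟨c2, α', hc2, hα', rfl⟩ := exists_polar hw
  rw [(h.isHomogeneousMap_outerCurve a).homog, (h.symm.isHomogeneousMap_outerCurve a).homog,
    wedge_smul_left, wedge_smul_right, smul_smul, smul_eq_zero] at h0
  simp only [Prod.smul_fst, Prod.smul_snd, smul_eq_mul, abs_mul, abs_of_pos hc1, abs_of_pos hc2]
    at hzr hwr
  rcases h0 with h0 | h0
  · exact absurd h0 (by positivity)
  · exact ha (α, α') ⟨hα, hα', le_of_mul_le_mul_left (by linarith) hc1,
      le_of_mul_le_mul_left (by linarith) hc2⟩ h0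

/-- At `a = 0` and the origin of the chart this says that `f` passes through `e` at the crossing
parameter only. -/
lemma eventually_outerCurve_disjoint_localChart {r : ℝ} (hr : 0 < r) (E : Fin 4 → ℝ) :
    ∀ᶠ q in 𝓝 ((0:ℝ), (0 : Fin 3 → ℝ)), ∀ z, z ≠ 0 → r * |z.1| ≤ |z.2| →
      wedge (outerCurve f g l e q.1 z) (localChart f g l e E q.2) ≠ 0 := by
  let K : Set ℝ := {p | p ∈ Icc (-π) π ∧ r * |cos p| ≤ |sin p|}
  have hK : IsCompact K := by
    refine isCompact_Icc.of_isClosed_subset (s := Icc (-π) π) ?_ fun p hp => hp.1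
    simp only [K, mem_Icc, Set.ofPred_and]
    refine IsClosed.inter (IsClosed.inter ?_ ?_) ?_ <;>
    exact isClosed_le (by fun_prop) (by fun_prop)
  have hev : ∀ᶠ q in 𝓝 ((0:ℝ), (0 : Fin 3 → ℝ)), ∀ p ∈ K,
      wedge (outerCurve f g l e q.1 (cos p, sin p)) (localChart f g l e E q.2) ≠ 0 := by
    refine hK.eventually_forall_of_forall_eventually fun p hp => ?_
    have hcont : Continuous fun q : (ℝ × (Fin 3 → ℝ)) × ℝ =>
        wedge (outerCurve f g l e q.1.1 (cos q.2, sin q.2)) (localChart f g l e E q.1.2) :=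
      (h.contDiff_outerCurve.continuous.comp (by fun_prop : Continuous
        fun q : (ℝ × (Fin 3 → ℝ)) × ℝ => (q.1.1, (cos q.2, sin q.2)))).wedge
      ((h.contDiff_localChart E).continuous.comp (by fun_prop))
    refine hcont.continuousAt.eventually_ne ?_
    simp only [h.outerCurve_zero, wedge_smul_left, h.localChart_zero]
    have s1 := sin_ne_zero_of_le hr hp.2
    intro h0
    simp only [smul_eq_zero, pow_eq_zero_iff', s1, false_and, false_or] at h0
    rw [← h.snd_one] at h0
    exact s1 (h.disjoint _ _ (polar_ne_zero _) (by simp) h0).1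
  filter_upwards [hev] with a ha z hz hzr h0
  obtain ⟨c1, α, hc1, hα, rfl⟩ := exists_polar hz
  rw [(h.isHomogeneousMap_outerCurve a.1).homog, wedge_smul_left, smul_eq_zero] at h0
  simp only [Prod.smul_fst, Prod.smul_snd, smul_eq_mul, abs_mul, abs_of_pos hc1] at hzr
  rcases h0 with h0 | h0
  · exact absurd h0 (by positivity)
  · exact ha α ⟨hα, le_of_mul_le_mul_left (by linarith) hc1⟩ h0

lemma exists_complement : ∃ E : Fin 4 → ℝ, ∀ a b c d : ℝ,
    a • e + b • fderiv ℝ f (1, 0) (0, 1) + c • fderiv ℝ g (1, 0) (0, 1) + d • E = 0 →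
      a = 0 ∧ b = 0 ∧ c = 0 ∧ d = 0 := by
  set v := fderiv ℝ f (1, 0) (0, 1)
  set w := fderiv ℝ g (1, 0) (0, 1)
  have hlt : Submodule.span ℝ (Set.range ![e, v, w]) < ⊤ := by
    refine Submodule.lt_top_of_finrank_lt_finrank ?_
    have := finrank_range_le_card (R := ℝ) ![e, v, w]
    simp only [Set.finrank, Fintype.card_fin] at this
    simp only [Module.finrank_fin_fun]
    omega
  obtain ⟨E, -, hE⟩ := SetLike.exists_of_lt hlt
  refine ⟨E, fun a b c d h0 => ?_⟩
  have hd : d = 0 := by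
    by_contra hd
    apply hE
    have : E = (-d⁻¹ * a) • e + (-d⁻¹ * b) • v + (-d⁻¹ * c) • w := by
      have h1 : d • E = -(a • e + b • v + c • w) := by rw [← sub_eq_zero, ← h0]; abel
      have h2 : E = d⁻¹ • (d • E) := by rw [smul_smul, inv_mul_cancel₀ hd, one_smul]
      rw [h2, h1]; module
    rw [this]
    have hm : ∀ i, (![e, v, w]) i ∈ Submodule.span ℝ (Set.range ![e, v, w]) := fun i =>
      Submodule.subset_span ⟨i, rfl⟩
    exact add_mem (add_mem (Submodule.smul_mem _ _ (hm 0)) (Submodule.smul_mem _ _ (hm 1)))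
      (Submodule.smul_mem _ _ (hm 2))
  rw [hd, zero_smul, add_zero] at h0
  obtain ⟨hb, hc⟩ := h.transverse a b c h0
  rw [hb, hc, zero_smul, zero_smul, add_zero, add_zero] at h0
  exact ⟨(smul_eq_zero.1 h0).resolve_right h.e_ne_zero, hb, hc, hd⟩

/-- Near the crossing, the local chart is indeed a chart. -/
lemma exists_localChart_embedded : ∃ (E : Fin 4 → ℝ) (r : ℝ), 0 < r ∧
    (∀ x, ‖x‖ < r → localChart f g l e E x ≠ 0) ∧
    (∀ x y, ‖x‖ < r → ‖y‖ < r →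
      wedge (localChart f g l e E x) (localChart f g l e E y) = 0 → x = y) ∧
    ∀ x v, ‖x‖ < r →
      wedge (localChart f g l e E x) (fderiv ℝ (localChart f g l e E) x v) = 0 → v = 0 := by
  obtain ⟨E, hE⟩ := h.exists_complement
  set Φ := localChart f g l e E with hΦ
  have hΦs : ContDiff ℝ ∞ Φ := h.contDiff_localChart E
  have hΦd : Differentiable ℝ Φ := hΦs.differentiable (by simp)
  -- Projective injectivity of `Φ` is injectivity of the cone over it. The differential of the cone
  -- at `(1, 0)` sends the standard basis to `e`, the two tangent vectors and `E`, so the inverse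
  -- function theorem applies.
  let Θ : ℝ × (Fin 3 → ℝ) → Fin 4 → ℝ := fun p => p.1 • Φ p.2
  have hΘs : ContDiff ℝ ∞ Θ := contDiff_fst.smul (hΦs.comp contDiff_snd)
  have hΘd : ∀ (c : ℝ) x (a : ℝ) v, fderiv ℝ Θ (c, x) (a, v) = a • Φ x + c • fderiv ℝ Φ x v := by
    intro c x a v
    have h1 : HasFDerivAt (fun p : ℝ × (Fin 3 → ℝ) => Φ p.2)
        ((fderiv ℝ Φ x).comp (ContinuousLinearMap.snd ℝ ℝ (Fin 3 → ℝ))) (c, x) :=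
      HasFDerivAt.comp (x := (c, x)) (g := Φ) (f := Prod.snd) (hΦd _).hasFDerivAt hasFDerivAt_snd
    have h2 : HasFDerivAt Θ _ (c, x) := (hasFDerivAt_fst (𝕜 := ℝ) (p := (c, x))).smul h1
    rw [h2.fderiv]
    simp [add_comm]
  have hΦ0 : Φ 0 = e := h.localChart_zero E
  have hΦ' : ∀ v, fderiv ℝ Φ 0 v = v 0 • fderiv ℝ f (1, 0) (0, 1) +
      v 1 • fderiv ℝ g (1, 0) (0, 1) + v 2 • E := by
    have line : ∀ v : Fin 3 → ℝ, HasDerivAt (fun t : ℝ => Φ (t • v)) (fderiv ℝ Φ 0 v) 0 := by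
      intro v
      have h2 : HasFDerivAt Φ (fderiv ℝ Φ 0) ((0:ℝ) • v) := by
        rw [zero_smul]; exact (hΦd 0).hasFDerivAt
      have h3 : HasDerivAt (fun t : ℝ => t • v) v 0 := by
        simpa using (hasDerivAt_id (0:ℝ)).smul_const v
      exact h2.comp_hasDerivAt (0:ℝ) h3
    have axis : ∀ {F : ℝ × ℝ → Fin 4 → ℝ}, Differentiable ℝ F →
        HasDerivAt (fun t : ℝ => F (1, t)) (fderiv ℝ F (1, 0) (0, 1)) 0 := by
      intro F hF
      exact (hF (1, 0)).hasFDerivAt.comp_hasDerivAt (0:ℝ)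
        ((hasDerivAt_const (0:ℝ) (1:ℝ)).prodMk (hasDerivAt_id (0:ℝ)))
    have e0 : fderiv ℝ Φ 0 (Pi.single 0 1) = fderiv ℝ f (1, 0) (0, 1) := by
      refine (line _).unique ?_
      have := axis h.fst.differentiable
      refine this.congr_of_eventuallyEq (Eventually.of_forall fun t => ?_)
      simp only [hΦ]
      rw [h.localChart_first_axis E (by simp) (by simp)]; simp
    have e1 : fderiv ℝ Φ 0 (Pi.single 1 1) = fderiv ℝ g (1, 0) (0, 1) := by
      refine (line _).unique ?_
      have := axis h.snd.differentiable
      refine this.congr_of_eventuallyEq (Eventually.of_forall fun t => ?_)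
      simp only [hΦ]
      rw [h.localChart_second_axis E (by simp) (by simp)]; simp
    have e2 : fderiv ℝ Φ 0 (Pi.single 2 1) = E := by
      refine (line _).unique ?_
      have : HasDerivAt (fun t : ℝ => e + t • E) E 0 := by
        simpa using ((hasDerivAt_id (0:ℝ)).smul_const E).const_add e
      refine this.congr_of_eventuallyEq (Eventually.of_forall fun t => ?_)
      simp [hΦ, localChart, h.affineSum_one, h.fst_one]
    intro v
    have : v = v 0 • Pi.single 0 1 + v 1 • Pi.single 1 1 + v 2 • Pi.single 2 1 := by
      funext i; fin_cases i <;> simp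
    conv_lhs => rw [this]
    rw [map_add, map_add, map_smul, map_smul, map_smul, e0, e1, e2]
  set A := fderiv ℝ Θ (1, 0) with hA
  have hAinj : Function.Injective A := by
    refine (injective_iff_map_eq_zero A).2 ?_
    rintro ⟨a, v⟩ h0
    rw [hA, hΘd, hΦ0, one_smul, hΦ'] at h0
    obtain ⟨h1, h2, h3, h4⟩ := hE a (v 0) (v 1) (v 2) (by rw [← h0]; abel)
    ext i
    · exact h1
    · fin_cases i
      · exact h2
      · exact h3
      · exact h4
  let A' : (ℝ × (Fin 3 → ℝ)) ≃L[ℝ] (Fin 4 → ℝ) :=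
    (LinearEquiv.ofInjectiveOfFinrankEq A.toLinearMap hAinj (by simp; )).toContinuousLinearEquiv
  have hA' : (A' : (ℝ × (Fin 3 → ℝ)) →L[ℝ] (Fin 4 → ℝ)) = A := by
    exact ContinuousLinearMap.ext fun p => rfl
  have hstrict : HasStrictFDerivAt Θ (A' : (ℝ × (Fin 3 → ℝ)) →L[ℝ] (Fin 4 → ℝ)) (1, 0) := by
    rw [hA']; exact hΘs.contDiffAt.hasStrictFDerivAt (by simp)
  have hinj : ∃ N ∈ 𝓝 ((1:ℝ), (0 : Fin 3 → ℝ)), InjOn Θ N := by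
    refine ⟨(hstrict.toOpenPartialHomeomorph Θ).source, ?_, ?_⟩
    · exact (hstrict.toOpenPartialHomeomorph Θ).open_source.mem_nhds
        hstrict.mem_toOpenPartialHomeomorph_source
    · exact (hstrict.toOpenPartialHomeomorph Θ).injOn
  obtain ⟨N, hN, hNinj⟩ := hinj
  have ev1 : ∀ᶠ x in 𝓝 (0 : Fin 3 → ℝ), ((1:ℝ), x) ∈ N :=
    (by fun_prop : Continuous fun x : Fin 3 → ℝ => ((1:ℝ), x)).continuousAt.eventually hN
  have hlc : Continuous fun x => l (Φ x) := l.continuous.comp hΦs.continuous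
  have hl0 : l (Φ 0) = 1 := by rw [hΦ0, h.map_e]
  have ev2 : ∀ᶠ x in 𝓝 (0 : Fin 3 → ℝ), l (Φ x) ≠ 0 :=
    hlc.continuousAt.eventually_ne (by rw [hl0]; exact one_ne_zero)
  -- If `Φ x = c • Φ y`, then `c = l (Φ x) / l (Φ y)` is close to one, so `(c, y)` lies in the
  -- domain of injectivity of the cone.
  have ev3 : ∀ᶠ p in 𝓝 ((0 : Fin 3 → ℝ), (0 : Fin 3 → ℝ)), (l (Φ p.1) / l (Φ p.2), p.2) ∈ N := by
    have : ContinuousAt (fun p : (Fin 3 → ℝ) × (Fin 3 → ℝ) => (l (Φ p.1) / l (Φ p.2), p.2)) (0, 0) := by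
      refine ContinuousAt.prodMk (ContinuousAt.div (hlc.comp continuous_fst).continuousAt
        (hlc.comp continuous_snd).continuousAt ?_) continuous_snd.continuousAt
      simp [hl0]
    refine this.eventually ?_
    simpa [hl0] using hN
  have ev4 : ∀ᶠ x in 𝓝 (0 : Fin 3 → ℝ), Function.Injective (fderiv ℝ Θ (1, x)) := by
    have hc : Continuous fun x : Fin 3 → ℝ => fderiv ℝ Θ (1, x) :=
      (hΘs.continuous_fderiv (by simp)).comp (by fun_prop)
    have := (hc.continuousAt (x := 0)).eventually (hA' ▸ ContinuousLinearEquiv.nhds A')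
    filter_upwards [this] with x hx
    obtain ⟨B, hB⟩ := hx
    rw [← hB]; exact B.injective
  rw [nhds_prod_eq] at ev3
  obtain ⟨pa, hpa, pb, hpb, hpab⟩ := eventually_prod_iff.1 ev3
  obtain ⟨r, hr, hball⟩ := Metric.eventually_nhds_iff.1 (ev1.and (ev2.and (ev4.and (hpa.and hpb))))
  simp only [dist_zero_right] at hball
  suffices main : (∀ x, ‖x‖ < r → Φ x ≠ 0) ∧
      (∀ x y, ‖x‖ < r → ‖y‖ < r → wedge (Φ x) (Φ y) = 0 → x = y) ∧
      ∀ x v, ‖x‖ < r → wedge (Φ x) (fderiv ℝ Φ x v) = 0 → v = 0 from ⟨E, r, hr, main⟩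
  refine ⟨?_, ?_, ?_⟩
  · intro x hx h0
    exact (hball hx).2.1 (by rw [h0, map_zero])
  · intro x y hx hy h0
    have ly := (hball hy).2.1
    obtain ⟨c, hc⟩ := exists_smul_of_wedge_eq_zero (fun h1 => ly (by rw [h1, map_zero])) h0
    have hc' : l (Φ x) / l (Φ y) = c := by
      rw [hc, map_smul, smul_eq_mul, mul_div_assoc, div_self ly, mul_one]
    have hm := hpab (hball hx).2.2.2.1 (hball hy).2.2.2.2
    simp only [hc'] at hm
    have := hNinj (hball hx).1 hm (by simp only [Θ, one_smul]; exact hc)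
    exact congrArg Prod.snd this
  · intro x v hx h0
    have lx := (hball hx).2.1
    obtain ⟨c, hc⟩ := exists_smul_of_wedge_eq_zero (fun h1 => lx (by rw [h1, map_zero]))
      (wedge_comm_eq_zero.1 h0)
    have h1 : fderiv ℝ Θ (1, x) (-c, v) = 0 := by
      rw [hΘd, hc, one_smul, ← add_smul]; simp
    have := (injective_iff_map_eq_zero _).1 (hball hx).2.2.1 _ h1
    exact congrArg Prod.snd this

end IsCrossing

end RatKnot

/-! ### The deformation consists of embedded curves -/

namespace RatKnot

open Filter Topology Set Real

/-- The union of two curves with resolved crossing, at time `s` of a deformation. -/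
noncomputable def resolutionCurve (f g : ℝ × ℝ → Fin 4 → ℝ) (l : (Fin 4 → ℝ) →L[ℝ] ℝ)
    (e : Fin 4 → ℝ) (κ s θ : ℝ) : Fin 4 → ℝ :=
  affineSum f g l e (sin (θ / 2), κ * (cos (θ / 2) * factorA s θ))
    (cos (θ / 2), κ * (sin (θ / 2) * factorB s θ))

/-- The points of parameter `θ` lie on the first axis, away from the crossing. -/
def IsOuter (κ r s θ : ℝ) : Prop :=
  0 < cos θ ∧ sin θ ^ 2 < 4 * cos θ ^ 2 ∧ r * |sin (θ / 2)| ≤ |κ * (cos (θ / 2) * factorA s θ)|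

/-- The points of parameter `θ` lie near the crossing. -/
def IsInner (κ r s θ : ℝ) : Prop :=
  sin θ ≠ 0 ∧ |κ * coordA s θ| < r ∧ |κ * coordB s θ| < r

lemma IsOuter.mono {κ r r' s θ : ℝ} (h : IsOuter κ r s θ) (hr : r' ≤ r) : IsOuter κ r' s θ :=
  ⟨h.1, h.2.1, (mul_le_mul_of_nonneg_right hr (abs_nonneg _)).trans h.2.2⟩

lemma cos_pi_sub_half (θ : ℝ) : cos ((π - θ) / 2) = sin (θ / 2) := by
  rw [sub_div, cos_pi_div_two_sub]

lemma sin_pi_sub_half (θ : ℝ) : sin ((π - θ) / 2) = cos (θ / 2) := by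
  rw [sub_div, sin_pi_div_two_sub]

lemma coordA_pi_sub (s θ : ℝ) : coordA s (π - θ) = coordB s θ := by
  rw [coordA, coordB, halfSum, excess, bump_pi_sub, sin_pi_sub, cos_pi_sub, ← sub_eq_add_neg,
    halfSum, excess]

/-- The numerators of both coordinates are nonnegative and the product of the coordinates is at most
one. So the second one has absolute value at most `1 / 2`, and `2 cos θ / |sin θ| ≥ 3 / 2`, beyond
the support of the bump. -/
lemma outer_of_two_le_abs_coordA {s θ : ℝ} (hs : s ∈ Icc (0:ℝ) 1) (h : sin θ ≠ 0)
    (hA : 2 ≤ |coordA s θ|) : 0 < cos θ ∧ sin θ ^ 2 < 4 * cos θ ^ 2 := by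
  have hM := halfSum_pos (θ := θ) hs
  have hM2 := halfSum_sq (θ := θ) hs
  have hx := excess_mem (θ := θ) hs
  have hsc := sin_sq_add_cos_sq θ
  have hT : 0 < |sin θ| := abs_pos.2 h
  have hT2 : |sin θ| ^ 2 = sin θ ^ 2 := sq_abs _
  rw [coordA, abs_div, le_div_iff₀ hT] at hA
  set T := |sin θ|
  have e1 : (halfSum s θ + cos θ) * (halfSum s θ - cos θ) = (1 - excess s θ) * T ^ 2 := by
    rw [hT2]; linear_combination hM2 - hsc
  have hle : |cos θ| ≤ halfSum s θ := by
    refine abs_le_of_sq_le_sq ?_ hM.le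
    nlinarith [mul_nonneg (sub_nonneg.2 hx.2) (sq_nonneg T)]
  have hc := abs_le.1 hle
  rw [abs_of_nonneg (by linarith)] at hA
  have h2 : (halfSum s θ + cos θ) * (halfSum s θ - cos θ) ≤ T ^ 2 := by
    rw [e1]; nlinarith [mul_nonneg hx.1 (sq_nonneg T)]
  have h3 : halfSum s θ - cos θ ≤ T / 2 := by
    by_contra h4
    push Not at h4
    nlinarith
  have h4 : 3 * T ≤ 4 * cos θ := by linarith
  refine ⟨by linarith, ?_⟩
  rw [← hT2]
  nlinarith

/-- Where a coordinate scaled by `κ` reaches `r ≥ 2 * κ`, the unscaled one is at least 2, as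
`outer_of_two_le_abs_coordA` needs. -/
lemma isInner_or_isOuter {κ r s θ : ℝ} (hs : s ∈ Icc (0:ℝ) 1) (hκ : 0 < κ) (hr : 2 * κ ≤ r) :
    IsInner κ r s θ ∨ IsOuter κ r s θ ∨ IsOuter κ r s (π - θ) := by
  have aux : ∀ θ, sin θ ≠ 0 → r ≤ |κ * coordA s θ| → IsOuter κ r s θ := by
    intro θ h hA
    have h1 : 2 ≤ |coordA s θ| := by
      rw [abs_mul, abs_of_pos hκ] at hA
      by_contra h2
      push Not at h2
      nlinarith
    obtain ⟨h2, h3⟩ := outer_of_two_le_abs_coordA hs h h1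
    refine ⟨h2, h3, ?_⟩
    rw [cos_half_mul_factorA hs h, mul_left_comm, abs_mul, mul_comm]
    exact mul_le_mul_of_nonneg_left hA (abs_nonneg _)
  have aux0 : ∀ θ, cos θ = 1 → IsOuter κ r s θ := by
    intro θ h
    have h1 := one_sub_cos_eq θ
    have h2 : sin (θ / 2) = 0 := by
      have : sin (θ / 2) ^ 2 = 0 := by linarith
      exact pow_eq_zero_iff two_ne_zero |>.1 this
    have h3 := sin_sq_add_cos_sq θ
    refine ⟨by linarith, by rw [h] at h3 ⊢; linarith, ?_⟩
    rw [h2, abs_zero, mul_zero]; exact abs_nonneg _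
  by_cases h : sin θ = 0
  · have h3 := sin_sq_add_cos_sq θ
    rw [h] at h3
    have : (cos θ - 1) * (cos θ + 1) = 0 := by linear_combination h3
    rcases mul_eq_zero.1 this with h4 | h4
    · exact Or.inr (Or.inl (aux0 θ (by linarith)))
    · exact Or.inr (Or.inr (aux0 _ (by rw [cos_pi_sub]; linarith)))
  · by_cases hA : r ≤ |κ * coordA s θ|
    · exact Or.inr (Or.inl (aux θ h hA))
    · by_cases hB : r ≤ |κ * coordB s θ|
      · exact Or.inr (Or.inr (aux _ (by rwa [sin_pi_sub]) (by rwa [coordA_pi_sub])))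
      · exact Or.inl ⟨h, not_le.1 hA, not_le.1 hB⟩

lemma half_factor_ne_zero (m n : ℕ) {θ : ℝ} (hsin : sin θ ≠ 0) :
    sin (θ / 2) ^ m * cos (θ / 2) ^ n ≠ 0 := by
  rw [sin_eq_two_mul] at hsin
  exact mul_ne_zero (pow_ne_zero _ fun h0 => hsin (by rw [h0]; simp))
    (pow_ne_zero _ fun h0 => hsin (by rw [h0]; simp))

lemma IsInner.norm_lt {κ r s θ : ℝ} (hi : IsInner κ r s θ) :
    ‖![κ * coordA s θ, κ * coordB s θ, 0]‖ < r := by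
  have hr : 0 < r := (abs_nonneg _).trans_lt hi.2.1
  rw [pi_norm_lt_iff hr]
  intro i
  fin_cases i
  · simpa using hi.2.1
  · simpa using hi.2.2
  · simpa using hr

/-- Being a projective immersion does not depend on a nonvanishing scalar factor of the homogeneous
coordinates. -/
lemma wedge_deriv_ne_zero {F G : ℝ → Fin 4 → ℝ} {φ : ℝ → ℝ} {d G' : Fin 4 → ℝ} {θ : ℝ}
    (hFG : F =ᶠ[𝓝 θ] fun t => φ t • G t) (hφ : DifferentiableAt ℝ φ θ) (hφ0 : φ θ ≠ 0)
    (hG : HasDerivAt G G' θ) (hG' : wedge (G θ) G' ≠ 0) (hF : HasDerivAt F d θ) :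
    wedge (F θ) d ≠ 0 := by
  have h1 := (hφ.hasDerivAt.smul hG).congr_of_eventuallyEq (f₁ := F) hFG
  rw [hF.unique h1, hFG.eq_of_nhds, wedge_add_right, wedge_smul_left, wedge_smul_left,
    wedge_smul_right, wedge_smul_right, wedge_self, smul_zero, smul_zero, add_zero, smul_smul]
  exact smul_ne_zero (mul_ne_zero hφ0 hφ0) hG'

/-- The constant `a` of the outer arcs is `κ ^ 2 * (1 - s)`; compactness of the time interval makes
the bound on `κ` uniform in `s`. -/
lemma eventually_mul_one_sub {p : ℝ → Prop} (hp : ∀ᶠ a in 𝓝 (0:ℝ), p a) :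
    ∀ᶠ κ in 𝓝[>] (0:ℝ), ∀ s ∈ Icc (0:ℝ) 1, p (κ ^ 2 * (1 - s)) := by
  refine Filter.Eventually.filter_mono nhdsWithin_le_nhds ?_
  refine isCompact_Icc.eventually_forall_of_forall_eventually fun s _ => ?_
  have : ContinuousAt (fun q : ℝ × ℝ => q.1 ^ 2 * (1 - q.2)) (0, s) := by fun_prop
  exact this.eventually (by simpa using hp)

namespace IsCrossing

variable {m n : ℕ} {f g : ℝ × ℝ → Fin 4 → ℝ} {l : (Fin 4 → ℝ) →L[ℝ] ℝ} {e : Fin 4 → ℝ}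

lemma resolutionCurve_pi_sub (f g : ℝ × ℝ → Fin 4 → ℝ) (κ s θ : ℝ) :
    resolutionCurve g f l e κ s (π - θ) = resolutionCurve f g l e κ s θ := by
  rw [resolutionCurve, resolutionCurve, affineSum_comm, cos_pi_sub_half, sin_pi_sub_half,
    factorA_pi_sub, factorB_pi_sub]

variable (h : IsCrossing m n f g l e)
include h

/-- Off the support of the bump, `factorA * factorB = 1 - s` is constant in `θ`, so the affine
parameters satisfy `u v = κ² (1 - s)`. -/
lemma resolutionCurve_outer {κ s θ : ℝ} (hκ : 0 < κ) (hs : s ∈ Icc (0:ℝ) 1) (hc : 0 < cos θ)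
    (hb : sin θ ^ 2 < 4 * cos θ ^ 2) :
    resolutionCurve f g l e κ s θ = (κ * factorA s θ)⁻¹ ^ n •
      outerCurve f g l e (κ ^ 2 * (1 - s)) (sin (θ / 2), κ * (cos (θ / 2) * factorA s θ)) := by
  have hA := factorA_pos hs hc
  have hAB := factorA_mul_factorB (θ := θ) hs
  have hx : excess s θ = s := by simp [excess, bump_eq_zero hb.le]
  rw [hx] at hAB
  have := affineSum_smul_smul (l := l) (e := e) h.fst.toIsHomogeneousMap h.snd.toIsHomogeneousMap
    1 (κ * factorA s θ)⁻¹ (sin (θ / 2), κ * (cos (θ / 2) * factorA s θ))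
    (κ * (cos (θ / 2) * factorA s θ), κ ^ 2 * (1 - s) * sin (θ / 2))
  rw [one_pow, one_mul] at this
  rw [outerCurve, ← this, resolutionCurve]
  congr 1
  · simp
  · ext
    · simp; field_simp
    · simp only [Prod.smul_mk, smul_eq_mul]
      rw [← hAB]; field_simp

lemma resolutionCurve_inner (E : Fin 4 → ℝ) {κ s θ : ℝ} (hs : s ∈ Icc (0:ℝ) 1) (hsin : sin θ ≠ 0) :
    resolutionCurve f g l e κ s θ = (sin (θ / 2) ^ m * cos (θ / 2) ^ n) •
      localChart f g l e E ![κ * coordA s θ, κ * coordB s θ, 0] := by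
  rw [localChart]
  simp only [Matrix.cons_val_zero, Matrix.cons_val_one, Matrix.cons_val, zero_smul, add_zero]
  rw [← affineSum_smul_smul h.fst.toIsHomogeneousMap h.snd.toIsHomogeneousMap, resolutionCurve,
    cos_half_mul_factorA hs hsin, sin_half_mul_factorB hs hsin]
  congr 1
  · ext <;> simp; ring
  · ext <;> simp; ring

lemma eventually_outer {r₀ : ℝ} (hr₀ : 0 < r₀) :
    ∀ᶠ κ in 𝓝[>] (0:ℝ), ∀ s ∈ Icc (0:ℝ) 1, ∀ θ', IsOuter κ r₀ s θ' →
      (∀ θ, wedge (resolutionCurve f g l e κ s θ) (resolutionCurve f g l e κ s θ') = 0 →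
        cos θ = cos θ' ∧ sin θ = sin θ') ∧
      ∀ d, HasDerivAt (resolutionCurve f g l e κ s) d θ' →
        wedge (resolutionCurve f g l e κ s θ') d ≠ 0 := by
  -- Inner points have third coordinate zero, so the third chart direction is irrelevant and may be
  -- taken to be zero.
  have hd := h.eventually_outerCurve_disjoint_localChart hr₀ 0
  rw [nhds_prod_eq] at hd
  obtain ⟨pa, hpa, pb, hpb, hpab⟩ := eventually_prod_iff.1 hd
  obtain ⟨δ, hδ, hball⟩ := Metric.eventually_nhds_iff.1 hpb
  simp only [dist_zero_right] at hball
  -- The arbitrary second point is classified with this smaller radius. If it is inner, it lies in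
  -- the ball of radius `δ`, which outer arcs of radius `r₀` avoid; otherwise both points are outer
  -- with radius `r`.
  set r := min r₀ δ with hr
  have hrpos : 0 < r := lt_min hr₀ hδ
  have hκr : ∀ᶠ κ in 𝓝[>] (0:ℝ), 2 * κ < r := by
    refine Filter.Eventually.filter_mono nhdsWithin_le_nhds ?_
    exact (by fun_prop : Continuous fun κ : ℝ => 2 * κ).continuousAt.eventually_lt
      continuousAt_const (by simpa using hrpos)
  filter_upwards [eventually_mul_one_sub hpa,
    eventually_mul_one_sub (h.eventually_outerCurve_embedded hrpos),
    eventually_mul_one_sub (h.eventually_outerCurve_disjoint hrpos), hκr,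
    self_mem_nhdsWithin] with κ k1 k2 k3 k4 hκ s hs θ' ho
  have hκ' : 0 < κ := hκ
  have hzne : ∀ {θ}, 0 < cos θ → ((sin (θ / 2), κ * (cos (θ / 2) * factorA s θ)) : ℝ × ℝ) ≠ 0 := by
    intro θ hc h0
    have h1 : sin (θ / 2) = 0 := congrArg Prod.fst h0
    have h2 : κ * (cos (θ / 2) * factorA s θ) = 0 := congrArg Prod.snd h0
    have h3 := factorA_pos hs hc
    have h4 : cos (θ / 2) = 0 := by
      rcases mul_eq_zero.1 h2 with h2 | h2
      · linarith
      · exact (mul_eq_zero.1 h2).resolve_right h3.ne'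
    have := sin_sq_add_cos_sq (θ / 2)
    simp [h1, h4] at this
  have hsc : ∀ {θ}, 0 < cos θ → (κ * factorA s θ)⁻¹ ^ n ≠ 0 := fun {θ} hc =>
    pow_ne_zero _ (inv_ne_zero (mul_pos hκ' (factorA_pos hs hc)).ne')
  have h' := h.symm
  have ho' := ho.mono (min_le_left r₀ δ)
  rw [← hr] at ho'
  refine ⟨fun θ h0 => ?_, fun d hd' => ?_⟩
  · rw [h.resolutionCurve_outer hκ' hs ho.1 ho.2.1, wedge_smul_right, smul_eq_zero] at h0
    have h1 := h0.resolve_left (hsc ho.1)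
    rcases isInner_or_isOuter (θ := θ) hs hκ' k4.le with hi | hi | hi
    · exfalso
      rw [h.resolutionCurve_inner 0 hs hi.1, wedge_smul_left, smul_eq_zero] at h1
      exact hpab (k1 s hs) (hball (hi.norm_lt.trans_le (min_le_right r₀ δ))) _ (hzne ho.1) ho.2.2
        (wedge_comm_eq_zero.1 (h1.resolve_left (half_factor_ne_zero m n hi.1)))
    · rw [h.resolutionCurve_outer hκ' hs hi.1 hi.2.1, wedge_smul_left, smul_eq_zero] at h1
      have h2 := (k2 s hs).1 _ _ (hzne hi.1) (hzne ho.1) hi.2.2 ho'.2.2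
        (h1.resolve_left (hsc hi.1))
      refine outer_injective hs hi.1 ho.1 (bump_eq_zero hi.2.1.le) (bump_eq_zero ho.2.1.le) ?_
      simp only at h2
      have h3 : κ * (sin (θ / 2) * (cos (θ' / 2) * factorA s θ')) =
          κ * (sin (θ' / 2) * (cos (θ / 2) * factorA s θ)) := by linarith
      exact mul_left_cancel₀ hκ'.ne' h3
    · exfalso
      rw [← resolutionCurve_pi_sub, h'.resolutionCurve_outer hκ' hs hi.1 hi.2.1, wedge_smul_left,
        smul_eq_zero] at h1
      refine k3 s hs _ _ (hzne ho.1) (hzne hi.1) ho'.2.2 hi.2.2 (wedge_comm_eq_zero.1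
        (h1.resolve_left ?_))
      exact pow_ne_zero _ (inv_ne_zero (mul_pos hκ' (factorA_pos hs hi.1)).ne')
  · obtain ⟨d1, d2, hd1, hd2, hne⟩ := outer_immersion hs ho.1 ho.2.1
    have hA := factorA_pos hs ho.1
    have hAd : DifferentiableAt ℝ (factorA s) θ' :=
      ((contDiffAt_factorA (θ := θ') hs).comp θ'
        (contDiffAt_const.prodMk contDiffAt_id)).differentiableAt (by simp)
    have hG : HasDerivAt (fun t => outerCurve f g l e (κ ^ 2 * (1 - s))
        (sin (t / 2), κ * (cos (t / 2) * factorA s t)))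
        (fderiv ℝ (outerCurve f g l e (κ ^ 2 * (1 - s)))
          (sin (θ' / 2), κ * (cos (θ' / 2) * factorA s θ')) (d1, κ * d2)) θ' :=
      ((h.isHomogeneousMap_outerCurve _).differentiable _).hasFDerivAt.comp_hasDerivAt θ'
        (hd1.prodMk (hd2.const_mul κ))
    refine wedge_deriv_ne_zero (φ := fun t => (κ * factorA s t)⁻¹ ^ n) ?_ ?_ (hsc ho.1) hG ?_ hd'
    · have ev1 : ∀ᶠ t in 𝓝 θ', sin t ^ 2 < 4 * cos t ^ 2 :=
        (by fun_prop : Continuous fun t => sin t ^ 2).continuousAt.eventually_lt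
          (by fun_prop : Continuous fun t => 4 * cos t ^ 2).continuousAt ho.2.1
      have ev2 : ∀ᶠ t in 𝓝 θ', 0 < cos t :=
        continuousAt_const.eventually_lt continuous_cos.continuousAt ho.1
      filter_upwards [ev1, ev2] with t t1 t2
      exact h.resolutionCurve_outer hκ' hs t2 t1
    · exact ((hAd.const_mul κ).inv (mul_pos hκ' hA).ne').pow n
    · intro h0
      have h2 := (k2 s hs).2 _ _ (hzne ho.1) ho'.2.2 h0
      simp only at h2
      have : κ * (sin (θ' / 2) * d2 - d1 * (cos (θ' / 2) * factorA s θ')) = 0 := by linarith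
      exact hne ((mul_eq_zero.1 this).resolve_left hκ'.ne')

/-- The deformation consists of embedded curves, if its scale is small. -/
theorem eventually_resolutionCurve_embedded :
    ∀ᶠ κ in 𝓝[>] (0:ℝ), ∀ s ∈ Icc (0:ℝ) 1,
      (∀ θ θ', wedge (resolutionCurve f g l e κ s θ) (resolutionCurve f g l e κ s θ') = 0 →
        cos θ = cos θ' ∧ sin θ = sin θ') ∧
      ∀ θ d, HasDerivAt (resolutionCurve f g l e κ s) d θ →
        wedge (resolutionCurve f g l e κ s θ) d ≠ 0 := by
  obtain ⟨E, r, hr, hne, hinj, himm⟩ := h.exists_localChart_embedded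
  have hκr : ∀ᶠ κ in 𝓝[>] (0:ℝ), 2 * κ < r := by
    refine Filter.Eventually.filter_mono nhdsWithin_le_nhds ?_
    exact (by fun_prop : Continuous fun κ : ℝ => 2 * κ).continuousAt.eventually_lt
      continuousAt_const (by simpa using hr)
  filter_upwards [h.eventually_outer hr, h.symm.eventually_outer hr, hκr, self_mem_nhdsWithin]
    with κ k1 k2 k3 hκ s hs
  have hκ' : 0 < κ := hκ
  have houter : ∀ θ θ', (IsOuter κ r s θ' ∨ IsOuter κ r s (π - θ')) →
      wedge (resolutionCurve f g l e κ s θ) (resolutionCurve f g l e κ s θ') = 0 →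
        cos θ = cos θ' ∧ sin θ = sin θ' := by
    rintro θ θ' (ho | ho) h0
    · exact (k1 s hs θ' ho).1 θ h0
    · have := (k2 s hs _ ho).1 (π - θ)
        (by rw [resolutionCurve_pi_sub, resolutionCurve_pi_sub]; exact h0)
      simpa [cos_pi_sub, sin_pi_sub] using this
  refine ⟨fun θ θ' h0 => ?_, fun θ d hd => ?_⟩
  · rcases isInner_or_isOuter (θ := θ') hs hκ' k3.le with hi' | ho'
    · rcases isInner_or_isOuter (θ := θ) hs hκ' k3.le with hi | ho
      -- Both points lie in the chart, so injectivity is that of the explicit plane curve.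
      · rw [h.resolutionCurve_inner E hs hi.1, h.resolutionCurve_inner E hs hi'.1, wedge_smul_left,
          wedge_smul_right, smul_smul, smul_eq_zero] at h0
        have h1 := hinj _ _ hi.norm_lt hi'.norm_lt (h0.resolve_left
          (mul_ne_zero (half_factor_ne_zero m n hi.1) (half_factor_ne_zero m n hi'.1)))
        have hA : κ * coordA s θ = κ * coordA s θ' := by simpa using congrFun h1 0
        have hB : κ * coordB s θ = κ * coordB s θ' := by simpa using congrFun h1 1
        exact coord_injective hs hi.1 hi'.1 (mul_left_cancel₀ hκ'.ne' hA)
          (mul_left_cancel₀ hκ'.ne' hB)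
      · have := houter θ' θ ho (wedge_comm_eq_zero.1 h0)
        exact ⟨this.1.symm, this.2.symm⟩
    · exact houter θ θ' ho' h0
  · rcases isInner_or_isOuter (θ := θ) hs hκ' k3.le with hi | ho | ho
    · obtain ⟨dA, dB, hA, hB, hAB⟩ := hasDerivAt_coordA hs hi.1
      have hγ : HasDerivAt (fun t => ![κ * coordA s t, κ * coordB s t, 0])
          ![κ * dA, κ * dB, 0] θ := by
        rw [hasDerivAt_pi]
        intro i
        fin_cases i
        · exact hA.const_mul κ
        · exact hB.const_mul κ
        · exact hasDerivAt_const _ _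
      have hG := ((h.contDiff_localChart E).differentiable (by simp)
        ![κ * coordA s θ, κ * coordB s θ, 0]).hasFDerivAt.comp_hasDerivAt θ hγ
      refine wedge_deriv_ne_zero (φ := fun t => sin (t / 2) ^ m * cos (t / 2) ^ n) ?_ (by fun_prop)
        (half_factor_ne_zero m n hi.1) hG ?_ hd
      · filter_upwards [continuous_sin.continuousAt.eventually_ne hi.1] with t ht
        exact h.resolutionCurve_inner E hs ht
      · intro h0
        have h1 := himm _ _ hi.norm_lt h0
        have h2 : κ * dA = 0 := by simpa using congrFun h1 0
        have h3 : κ * dB = 0 := by simpa using congrFun h1 1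
        exact hAB (mul_left_cancel₀ hκ'.ne' (h2.trans h3.symm))
    · exact (k1 s hs θ ho).2 d hd
    · have hd' : HasDerivAt (resolutionCurve g f l e κ s) (-d) (π - θ) := by
        have h1 : HasDerivAt (fun t : ℝ => π - t) (-1) (π - θ) := by
          simpa using (hasDerivAt_id (π - θ)).const_sub π
        have h2 : HasDerivAt (resolutionCurve f g l e κ s) d (π - (π - θ)) := by
          rwa [sub_sub_cancel]
        have h3 := h2.scomp (π - θ) h1
        rw [neg_smul, one_smul] at h3
        refine h3.congr_of_eventuallyEq (Eventually.of_forall fun t => ?_)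
        simp only [Function.comp_apply]
        rw [resolutionCurve_pi_sub]
      have := (k2 s hs _ ho).2 (-d) hd'
      rw [resolutionCurve_pi_sub] at this
      intro h0
      apply this
      rw [← neg_one_smul ℝ d, wedge_smul_right, h0, smul_zero]

end IsCrossing

end RatKnot

/-! ### Isotopies from families of curves and small perturbations -/

namespace RatKnot

open Filter Topology Set Real

/-- The image in projective space of a curve in homogeneous coordinates. -/
def curveImage (c : ℝ → Fin 4 → ℝ) : Set RP3 := {q | ∃ θ, Represents (c θ) q}

/-- A smooth family of embedded curves, in homogeneous coordinates that are periodic up to a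
factor, is a smooth isotopy. -/
lemma smoothlyIsotopic_of_family {H : ℝ × ℝ → Fin 4 → ℝ} (hH : ContDiff ℝ ∞ H) {c : ℝ}
    (hc : c ≠ 0) (hper : ∀ t θ, H (t, θ + 2 * π) = c • H (t, θ))
    (hinj : ∀ t ∈ Icc (0:ℝ) 1, ∀ α ∈ Icc (-π) π, ∀ α', |α' - α| ≤ π → α ≠ α' →
      wedge (H (t, α)) (H (t, α')) ≠ 0)
    (himm : ∀ t ∈ Icc (0:ℝ) 1, ∀ α ∈ Icc (-π) π,
      wedge (H (t, α)) (fderiv ℝ H (t, α) (0, 1)) ≠ 0) :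
    SmoothlyIsotopic (curveImage fun θ => H (0, θ)) (curveImage fun θ => H (1, θ)) := by
  classical
  have hperZ : ∀ t θ (k : ℤ), H (t, θ + k * (2 * π)) = c ^ k • H (t, θ) := by
    intro t θ k
    induction k with
    | zero => simp
    | succ k ih =>
      have : θ + ((k + 1 : ℤ) : ℝ) * (2 * π) = θ + (k : ℤ) * (2 * π) + 2 * π := by push_cast; ring
      rw [this, hper, ih, smul_smul, zpow_add_one₀ hc, mul_comm]
    | pred k ih =>
      have h1 : θ + ((-k : ℤ) : ℝ) * (2 * π) = θ + ((-k - 1 : ℤ) : ℝ) * (2 * π) + 2 * π := by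
        push_cast; ring
      rw [h1, hper] at ih
      have h2 : H (t, θ + ((-k - 1 : ℤ) : ℝ) * (2 * π)) = c⁻¹ • (c • H (t, θ + ((-k - 1 : ℤ) : ℝ) * (2 * π))) := by
        rw [smul_smul, inv_mul_cancel₀ hc, one_smul]
      rw [h2, ih, smul_smul, zpow_sub_one₀ hc, mul_comm]
  have hderZ : ∀ t θ (k : ℤ), fderiv ℝ H (t, θ + k * (2 * π)) (0, 1) =
      c ^ k • fderiv ℝ H (t, θ) (0, 1) := by
    intro t θ k
    have hline : ∀ θ, HasDerivAt (fun θ => H (t, θ)) (fderiv ℝ H (t, θ) (0, 1)) θ := fun θ =>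
      ((hH.differentiable (by simp)) (t, θ)).hasFDerivAt.comp_hasDerivAt θ
        ((hasDerivAt_const θ t).prodMk (hasDerivAt_id θ))
    have h1 := (hline (θ + k * (2 * π))).comp_add_const θ (k * (2 * π))
    have h2 := (hline θ).const_smul (c ^ k)
    refine h1.unique (h2.congr_of_eventuallyEq (Eventually.of_forall fun x => ?_))
    exact hperZ t x k
  have hmod : ∀ θ : ℝ, ∃ k : ℤ, (Circle.exp θ : ℂ).arg + k * (2 * π) = θ := by
    intro θ
    have h1 : Circle.exp ((Circle.exp θ : ℂ).arg) = Circle.exp θ := Circle.exp_arg _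
    obtain ⟨k, hk⟩ := Circle.exp_eq_exp.1 h1
    refine ⟨-k, ?_⟩
    rw [hk]; push_cast; ring
  have harg : ∀ x : Circle, (x : ℂ).arg ∈ Icc (-π) π := fun x =>
    ⟨(Complex.neg_pi_lt_arg _).le, Complex.arg_le_pi _⟩
  have hne : ∀ t ∈ Icc (0:ℝ) 1, ∀ α ∈ Icc (-π) π, H (t, α) ≠ 0 := by
    intro t ht α hα h0
    apply himm t ht α hα
    rw [h0]; funext i j; simp [wedge]
  have hne' : ∀ t ∈ Icc (0:ℝ) 1, ∀ θ, H (t, θ) ≠ 0 := by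
    intro t ht θ
    obtain ⟨k, hk⟩ := hmod θ
    rw [← hk, hperZ]
    exact smul_ne_zero (zpow_ne_zero _ hc) (hne t ht _ (harg _))
  -- The second branch is a default value for times outside `[0, 1]`, where `H` may vanish.
  let h : ℝ → Circle → RP3 := fun t x =>
    if hv : H (t, (x : ℂ).arg) ≠ 0 then Projectivization.mk ℝ _ hv
    else Projectivization.mk ℝ _ (hne 0 (by simp) 0 ⟨by linarith [pi_pos], pi_pos.le⟩)
  have hrep : ∀ t ∈ Icc (0:ℝ) 1, ∀ x : Circle, Represents (H (t, (x : ℂ).arg)) (h t x) := by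
    intro t ht x
    have := hne t ht _ (harg x)
    simp only [h, dif_pos this]
    exact represents_mk this
  have hrep' : ∀ t ∈ Icc (0:ℝ) 1, ∀ θ, Represents (H (t, θ)) (h t (Circle.exp θ)) := by
    intro t ht θ
    refine (hrep t ht (Circle.exp θ)).of_wedge (hne' t ht θ) ?_
    obtain ⟨k, hk⟩ := hmod θ
    have e : H (t, θ) = c ^ k • H (t, (Circle.exp θ : ℂ).arg) := by rw [← hperZ, hk]
    rw [e, wedge_smul_right, wedge_self, smul_zero]
  have hrange : ∀ t ∈ Icc (0:ℝ) 1, Set.range (h t) = curveImage fun θ => H (t, θ) := by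
    intro t ht
    ext q
    constructor
    · rintro ⟨x, rfl⟩
      exact ⟨_, hrep t ht x⟩
    · rintro ⟨θ, hθ⟩
      exact ⟨Circle.exp θ, (hrep' t ht θ).unique hθ⟩
  refine ⟨h, H, hH, fun t ht => ⟨?_, fun θ => ⟨hrep' t ht θ, ?_⟩⟩, hrange 0 (by simp), hrange 1 (by simp)⟩
  · intro x y hxy
    have h1 := hrep t ht x
    have h2 := hrep t ht y
    rw [← hxy] at h2
    have h3 := h1.wedge_eq_zero h2
    set α := (x : ℂ).arg with hα
    set β := (y : ℂ).arg with hβ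
    -- Shifting `β` by this many turns brings it as close to `α` as possible, within `π`.
    set k : ℤ := -round ((β - α) / (2 * π)) with hk
    have hle : |β + k * (2 * π) - α| ≤ π := by
      have h4 := abs_sub_round ((β - α) / (2 * π))
      have e : β + k * (2 * π) - α = ((β - α) / (2 * π) - round ((β - α) / (2 * π))) * (2 * π) := by
        rw [hk]; push_cast; field_simp; ring
      rw [e, abs_mul, abs_of_pos (by positivity : 0 < 2 * π)]
      nlinarith [pi_pos]
    have h5 : wedge (H (t, α)) (H (t, β + k * (2 * π))) = 0 := by
      rw [hperZ, wedge_smul_right, h3, smul_zero]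
    have h6 : α = β + k * (2 * π) := by
      by_contra hne
      exact hinj t ht α (harg x) _ hle hne h5
    rw [← Circle.exp_arg x, ← Circle.exp_arg y]
    exact Circle.exp_eq_exp.2 ⟨k, h6⟩
  · intro a ha
    obtain ⟨k, hk⟩ := hmod θ
    rw [← hk, hderZ, hperZ, smul_smul, mul_comm, ← smul_smul] at ha
    have h1 := smul_right_injective _ (zpow_ne_zero k hc) ha
    refine himm t ht _ (harg (Circle.exp θ)) ?_
    rw [h1, wedge_smul_right, wedge_self, smul_zero]

/-- `smoothTransition` sends every time into `[0, 1]`, where `factorA` is known to be smooth, so the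
family is smooth on the whole plane, as `SmoothlyIsotopic` asks. -/
lemma contDiff_factorA_smoothTransition :
    ContDiff ℝ ∞ (fun p : ℝ × ℝ => factorA (smoothTransition p.1) p.2) := by
  rw [contDiff_iff_contDiffAt]
  rintro ⟨t, θ⟩
  have h1 : ContDiffAt ℝ ∞ (fun p : ℝ × ℝ => (smoothTransition p.1, p.2)) (t, θ) :=
    (smoothTransition.contDiff.comp contDiff_fst).contDiffAt.prodMk contDiffAt_snd
  exact ContDiffAt.comp (g := fun p : ℝ × ℝ => factorA p.1 p.2) (t, θ)
    (contDiffAt_factorA ⟨smoothTransition.nonneg t, smoothTransition.le_one t⟩) h1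

lemma contDiff_factorB_smoothTransition :
    ContDiff ℝ ∞ (fun p : ℝ × ℝ => factorB (smoothTransition p.1) p.2) := by
  rw [contDiff_iff_contDiffAt]
  rintro ⟨t, θ⟩
  have h1 : ContDiffAt ℝ ∞ (fun p : ℝ × ℝ => (smoothTransition p.1, p.2)) (t, θ) :=
    (smoothTransition.contDiff.comp contDiff_fst).contDiffAt.prodMk contDiffAt_snd
  exact ContDiffAt.comp (g := fun p : ℝ × ℝ => factorB p.1 p.2) (t, θ)
    (contDiffAt_factorB ⟨smoothTransition.nonneg t, smoothTransition.le_one t⟩) h1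

namespace IsCrossing

variable {m n : ℕ} {f g : ℝ × ℝ → Fin 4 → ℝ} {l : (Fin 4 → ℝ) →L[ℝ] ℝ} {e : Fin 4 → ℝ}
variable (h : IsCrossing m n f g l e)
include h

lemma contDiff_resolutionCurve (κ : ℝ) :
    ContDiff ℝ ∞ (fun p : ℝ × ℝ => resolutionCurve f g l e κ (smoothTransition p.1) p.2) := by
  have h1 := contDiff_factorA_smoothTransition
  have h2 := contDiff_factorB_smoothTransition
  exact (contDiff_affineSum h.fst.toIsHomogeneousMap h.snd.toIsHomogeneousMap).comp
    (by fun_prop : ContDiff ℝ ∞ fun p : ℝ × ℝ =>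
      ((sin (p.2 / 2), κ * (cos (p.2 / 2) * factorA (smoothTransition p.1) p.2)),
        (cos (p.2 / 2), κ * (sin (p.2 / 2) * factorB (smoothTransition p.1) p.2))))

/-- A full turn of `θ` changes the sign of both half-angle arguments. -/
lemma resolutionCurve_add_two_pi (κ s θ : ℝ) :
    resolutionCurve f g l e κ s (θ + 2 * π) = (-1 : ℝ) ^ (m + n) • resolutionCurve f g l e κ s θ := by
  have e1 : (θ + 2 * π) / 2 = θ / 2 + π := by ring
  rw [resolutionCurve, resolutionCurve, factorA_periodic, factorB_periodic, e1, sin_add_pi,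
    cos_add_pi, pow_add, ← affineSum_smul_smul h.fst.toIsHomogeneousMap h.snd.toIsHomogeneousMap]
  congr 1 <;> ext <;> simp

/-- A small perturbation of the start of the deformation is isotopic to its end. -/
theorem eventually_smoothlyIsotopic {κ : ℝ}
    (hκ : ∀ s ∈ Icc (0:ℝ) 1,
      (∀ θ θ', wedge (resolutionCurve f g l e κ s θ) (resolutionCurve f g l e κ s θ') = 0 →
        cos θ = cos θ' ∧ sin θ = sin θ') ∧
      ∀ θ d, HasDerivAt (resolutionCurve f g l e κ s) d θ →
        wedge (resolutionCurve f g l e κ s θ) d ≠ 0)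
    {G : ℝ × ℝ → Fin 4 → ℝ} (hG : IsHomogeneousMap (m + n) G) :
    ∀ᶠ μ in 𝓝 (0:ℝ), SmoothlyIsotopic
      (curveImage fun θ => resolutionCurve f g l e κ 0 θ + μ • G (cos (θ / 2), sin (θ / 2)))
      (curveImage (resolutionCurve f g l e κ 1)) := by
  -- The perturbation is switched off while the deformation runs. At `μ = 0` this is the embedded
  -- family of `hκ`, and stability gives embedded families for small `μ`.
  let J : (ℝ × ℝ) × ℝ → Fin 4 → ℝ := fun p =>
    resolutionCurve f g l e κ (smoothTransition p.1.2) p.2 +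
      (p.1.1 * (1 - smoothTransition p.1.2)) • G (cos (p.2 / 2), sin (p.2 / 2))
  have hJ : ContDiff ℝ ∞ J := by
    have h1 := (h.contDiff_resolutionCurve κ).comp
      (by fun_prop : ContDiff ℝ ∞ fun p : (ℝ × ℝ) × ℝ => (p.1.2, p.2))
    have h2 := hG.contDiff
    have h3 : ContDiff ℝ ∞ smoothTransition := smoothTransition.contDiff
    refine ContDiff.add h1 ?_
    fun_prop
  have hd : ∀ x α, HasDerivAt (fun α => J (x, α)) (fderiv ℝ J (x, α) (0, 1)) α := fun x α =>
    ((hJ.differentiable (by simp)) (x, α)).hasFDerivAt.comp_hasDerivAt α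
      ((hasDerivAt_const α x).prodMk (hasDerivAt_id α))
  let K : Set (ℝ × ℝ) := {p | p.1 ∈ Icc (-π) π ∧ p.2 ∈ Icc (-(2 * π)) (2 * π) ∧ |p.2 - p.1| ≤ π}
  have hK : IsCompact K := by
    refine (isCompact_Icc.prod isCompact_Icc).of_isClosed_subset
      (s := Icc (-π) π ×ˢ Icc (-(2 * π)) (2 * π)) ?_ fun p hp => ⟨hp.1, hp.2.1⟩
    simp only [K, mem_Icc, Set.ofPred_and]
    refine IsClosed.inter (IsClosed.inter ?_ ?_) (IsClosed.inter (IsClosed.inter ?_ ?_) ?_) <;>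
    exact isClosed_le (by fun_prop) (by fun_prop)
  have hst : ∀ t, smoothTransition t ∈ Icc (0:ℝ) 1 := fun t =>
    ⟨smoothTransition.nonneg t, smoothTransition.le_one t⟩
  have hJ0 : ∀ t, (fun α => J ((0, t), α)) = resolutionCurve f g l e κ (smoothTransition t) := by
    intro t; funext α; simp [J]
  have key := eventually_wedge_ne_zero (F := fun x α => J (x, α))
    (F' := fun x α => fderiv ℝ J (x, α) (0, 1)) hJ.continuous
    ((hJ.continuous_fderiv (by simp)).clm_apply continuous_const) hd 0
    (isCompact_Icc (a := (0:ℝ)) (b := 1)) hK ?_ ?_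
  · filter_upwards [key] with μ hμ
    have hH : ContDiff ℝ ∞ (fun p : ℝ × ℝ => J ((μ, p.1), p.2)) :=
      hJ.comp (by fun_prop : ContDiff ℝ ∞ fun p : ℝ × ℝ => ((μ, p.1), p.2))
    have := smoothlyIsotopic_of_family hH (c := (-1) ^ (m + n)) (by simp) ?_ ?_ ?_
    · simpa [J, smoothTransition.zero, smoothTransition.one] using this
    · intro t θ
      have e1 : (θ + 2 * π) / 2 = θ / 2 + π := by ring
      have e2 : ((-cos (θ / 2), -sin (θ / 2)) : ℝ × ℝ) = (-1 : ℝ) • (cos (θ / 2), sin (θ / 2)) := by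
        simp
      simp only [J]
      rw [h.resolutionCurve_add_two_pi, e1, sin_add_pi, cos_add_pi, e2, hG.homog, smul_add,
        smul_comm]
    · intro t ht α hα α' hle hne
      have h1 := abs_le.1 hle
      exact (hμ t ht).1 α α' ⟨hα, ⟨by linarith [hα.1], by linarith [hα.2]⟩, hle⟩ hne
    · intro t ht α hα
      have h1 : HasDerivAt (fun θ => J ((μ, t), θ))
          (fderiv ℝ (fun p : ℝ × ℝ => J ((μ, p.1), p.2)) (t, α) (0, 1)) α :=
        ((hH.differentiable (by simp)) (t, α)).hasFDerivAt.comp_hasDerivAt α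
          ((hasDerivAt_const α t).prodMk (hasDerivAt_id α))
      rw [h1.unique (hd (μ, t) α)]
      have := pi_pos
      exact (hμ t ht).2 α ⟨hα, ⟨by linarith [hα.1], by linarith [hα.2]⟩, by simpa using this.le⟩
  · intro t _ α α' hk hne h0
    have e1 := congrFun (hJ0 t) α
    have e2 := congrFun (hJ0 t) α'
    rw [e1, e2] at h0
    obtain ⟨hc, hs⟩ := (hκ _ (hst t)).1 α α' h0
    have h1 : cos (α' - α) = 1 := by
      rw [cos_sub, hc, hs]; have := sin_sq_add_cos_sq α'; linarith
    have h4 := abs_le.1 hk.2.2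
    have := pi_pos
    simp only at h4
    have := (cos_eq_one_iff_of_lt_of_lt (by linarith) (by linarith)).1 h1
    exact hne (by linarith)
  · intro t _ α hk
    have h1 := hd (0, t) α
    rw [hJ0] at h1
    have := (hκ _ (hst t)).2 α _ h1
    rwa [← congrFun (hJ0 t) α] at this

end IsCrossing

end RatKnot

namespace RatKnot

open Filter Topology Set Real

/-! ### A bounded odd diffeomorphism that is the identity near the origin -/

/-- The derivative of `squash`. -/
noncomputable def squashDeriv (t : ℝ) : ℝ :=
  1 - smoothTransition (t ^ 2 - 4) + smoothTransition (t ^ 2 - 4) / (1 + t ^ 2)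

/-- A bounded odd smooth embedding of the line, equal to the identity on `[-2, 2]`. -/
noncomputable def squash (x : ℝ) : ℝ := ∫ t in (0:ℝ)..x, squashDeriv t

lemma contDiff_squashDeriv : ContDiff ℝ ∞ squashDeriv := by
  have h3 : ContDiff ℝ ∞ smoothTransition := smoothTransition.contDiff
  have h4 : ∀ t : ℝ, 1 + t ^ 2 ≠ 0 := fun t => by positivity
  unfold squashDeriv
  refine ContDiff.add (by fun_prop) (ContDiff.div (by fun_prop) (by fun_prop) h4)

lemma squashDeriv_pos (t : ℝ) : 0 < squashDeriv t := by
  have h1 := smoothTransition.nonneg (t ^ 2 - 4)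
  have h2 := smoothTransition.le_one (t ^ 2 - 4)
  unfold squashDeriv
  rcases h2.lt_or_eq with h | h
  · have : 0 ≤ smoothTransition (t ^ 2 - 4) / (1 + t ^ 2) := by positivity
    linarith
  · rw [h]; simp only [sub_self, zero_add]; positivity

/-- Up to `t² = 5` the right side is at least one; beyond it the derivative equals `1 / (1 + t²)`.
-/
lemma squashDeriv_le (t : ℝ) : squashDeriv t ≤ 6 * (1 / (1 + t ^ 2)) := by
  have h1 := smoothTransition.nonneg (t ^ 2 - 4)
  have h2 := smoothTransition.le_one (t ^ 2 - 4)
  have hp : 0 < 1 + t ^ 2 := by positivity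
  unfold squashDeriv
  rw [mul_one_div, ← sub_nonneg]
  have e : 6 / (1 + t ^ 2) - (1 - smoothTransition (t ^ 2 - 4) +
      smoothTransition (t ^ 2 - 4) / (1 + t ^ 2)) =
      (6 - (1 - smoothTransition (t ^ 2 - 4)) * (1 + t ^ 2) - smoothTransition (t ^ 2 - 4))
        / (1 + t ^ 2) := by field_simp; ring
  rw [e]
  refine div_nonneg ?_ hp.le
  rcases le_total 5 (t ^ 2) with h | h
  · rw [smoothTransition.one_of_one_le (by linarith)]; norm_num
  · nlinarith [mul_nonneg h1 (sq_nonneg t)]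

lemma squashDeriv_eq_one {t : ℝ} (ht : t ^ 2 ≤ 4) : squashDeriv t = 1 := by
  unfold squashDeriv
  rw [smoothTransition.zero_of_nonpos (by linarith)]; simp

lemma hasDerivAt_squash (x : ℝ) : HasDerivAt squash (squashDeriv x) x :=
  intervalIntegral.integral_hasDerivAt_right
    (contDiff_squashDeriv.continuous.intervalIntegrable _ _)
    contDiff_squashDeriv.continuous.stronglyMeasurable.stronglyMeasurableAtFilter
    contDiff_squashDeriv.continuous.continuousAt

lemma contDiff_squash : ContDiff ℝ ∞ squash := by
  rw [contDiff_infty_iff_deriv]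
  refine ⟨fun x => (hasDerivAt_squash x).differentiableAt, ?_⟩
  rw [show deriv squash = squashDeriv from funext fun x => (hasDerivAt_squash x).deriv]
  exact contDiff_squashDeriv

lemma strictMono_squash : StrictMono squash :=
  strictMono_of_deriv_pos fun x => by rw [(hasDerivAt_squash x).deriv]; exact squashDeriv_pos x

lemma squash_zero : squash 0 = 0 := by simp [squash]

lemma squash_neg (x : ℝ) : squash (-x) = - squash x := by
  have h := intervalIntegral.integral_comp_neg (f := squashDeriv) (a := 0) (b := -x)
  have e : (fun t => squashDeriv (-t)) = squashDeriv := by funext t; simp [squashDeriv]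
  rw [e, neg_neg, neg_zero] at h
  rw [squash, h, intervalIntegral.integral_symm, squash]

lemma squash_of_sq_le {x : ℝ} (hx : x ^ 2 ≤ 4) : squash x = x := by
  have h1 : ∫ t in (0:ℝ)..x, squashDeriv t = ∫ t in (0:ℝ)..x, (1:ℝ) := by
    refine intervalIntegral.integral_congr fun t ht => squashDeriv_eq_one ?_
    have hx' := abs_le_of_sq_le_sq (b := (2:ℝ)) (by linarith) (by norm_num)
    rcases abs_le.1 hx' with ⟨h2, h3⟩
    rcases le_total 0 x with h | h
    · rw [uIcc_of_le h] at ht; nlinarith [ht.1, ht.2]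
    · rw [uIcc_of_ge h] at ht; nlinarith [ht.1, ht.2]
  rw [squash, h1]; simp

/-- Comparison with `6 * arctan`, which stays below `3 π < 10`. -/
lemma abs_squash_le (x : ℝ) : |squash x| ≤ 10 := by
  have hmono : Monotone fun x => 6 * arctan x - squash x := by
    have hd : ∀ x, HasDerivAt (fun x => 6 * arctan x - squash x)
        (6 * (1 / (1 + x ^ 2)) - squashDeriv x) x := fun x =>
      ((hasDerivAt_arctan x).const_mul 6).sub (hasDerivAt_squash x)
    refine monotone_of_deriv_nonneg (fun x => (hd x).differentiableAt) fun x => ?_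
    rw [(hd x).deriv]
    linarith [squashDeriv_le x]
  have hpos : ∀ x, 0 ≤ x → |squash x| ≤ 10 := by
    intro x hx
    have h1 := hmono hx
    have h2 := strictMono_squash.monotone hx
    simp only [arctan_zero, squash_zero, mul_zero, sub_zero] at h1 h2
    have := arctan_lt_pi_div_two x
    have := pi_lt_d2
    rw [abs_of_nonneg h2]
    linarith
  rcases le_total 0 x with h | h
  · exact hpos x h
  · have := hpos (-x) (by linarith)
    rwa [squash_neg, abs_neg] at this

/-! ### The chart at the crossing -/

/-- The image in projective space of a homogeneous map. -/
def projImage (f : ℝ × ℝ → Fin 4 → ℝ) : Set RP3 := {q | ∃ z, z ≠ 0 ∧ Represents (f z) q}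

lemma projImage_reflect (g : ℝ × ℝ → Fin 4 → ℝ) :
    projImage (fun z => g (reflect z)) = projImage g := by
  ext q
  constructor
  · rintro ⟨z, hz, hq⟩
    exact ⟨_, reflect_ne_zero hz, hq⟩
  · rintro ⟨z, hz, hq⟩
    refine ⟨_, reflect_ne_zero hz, ?_⟩
    simpa only [reflect_reflect] using hq

lemma exists_smul_of_cross_eq_zero {z w : ℝ × ℝ} (hz : z ≠ 0) (h : z.1 * w.2 = z.2 * w.1) :
    ∃ c : ℝ, w = c • z := by
  by_cases h1 : z.1 = 0
  · have h2 : z.2 ≠ 0 := fun h2 => hz (Prod.ext h1 h2)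
    refine ⟨w.2 / z.2, ?_⟩
    ext
    · rw [h1, zero_mul] at h
      simp [h1, (mul_eq_zero.1 h.symm).resolve_left h2]
    · simp [h2]
  · refine ⟨w.1 / z.1, ?_⟩
    ext
    · simp [h1]
    · simp only [Prod.smul_snd, smul_eq_mul]; field_simp; linarith

lemma IsHomogeneousMap.wedge_eq_zero {d : ℕ} {F : ℝ × ℝ → Fin 4 → ℝ} (hF : IsHomogeneousMap d F)
    {z w : ℝ × ℝ} (hz : z ≠ 0) (h : z.1 * w.2 = z.2 * w.1) : wedge (F w) (F z) = 0 := by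
  obtain ⟨c, rfl⟩ := exists_smul_of_cross_eq_zero hz h
  rw [hF.homog, wedge_smul_self]

/-- Exchange of the first two coordinates. -/
def swapCoord (x : Fin 3 → ℝ) : Fin 3 → ℝ := ![x 1, x 0, x 2]

/-- Reflection of the second coordinate. -/
def reflectCoord (x : Fin 3 → ℝ) : Fin 3 → ℝ := ![x 0, -x 1, x 2]

lemma swapCoord_swapCoord (x : Fin 3 → ℝ) : swapCoord (swapCoord x) = x := by
  funext i; fin_cases i <;> rfl

lemma reflectCoord_reflectCoord (x : Fin 3 → ℝ) : reflectCoord (reflectCoord x) = x := by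
  funext i; fin_cases i <;> simp [reflectCoord]

lemma localChart_swapCoord (f g : ℝ × ℝ → Fin 4 → ℝ) (l : (Fin 4 → ℝ) →L[ℝ] ℝ) (e E : Fin 4 → ℝ)
    (x : Fin 3 → ℝ) : localChart g f l e E (swapCoord x) = localChart f g l e E x := by
  rw [localChart, affineSum_comm]; rfl

lemma localChart_reflectCoord (f g : ℝ × ℝ → Fin 4 → ℝ) (l : (Fin 4 → ℝ) →L[ℝ] ℝ)
    (e E : Fin 4 → ℝ) (x : Fin 3 → ℝ) :
    localChart f (fun z => g (reflect z)) l e E (reflectCoord x) = localChart f g l e E x := by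
  simp [localChart, reflectCoord, affineSum, reflect]

/-- The scaled bounded coordinates. -/
noncomputable def squashCoord (κ : ℝ) (x : Fin 3 → ℝ) : Fin 3 → ℝ := fun i => κ * squash (x i)

lemma squashCoord_swapCoord (κ : ℝ) (x : Fin 3 → ℝ) :
    squashCoord κ (swapCoord x) = swapCoord (squashCoord κ x) := by
  funext i; fin_cases i <;> rfl

lemma squashCoord_reflectCoord (κ : ℝ) (x : Fin 3 → ℝ) :
    squashCoord κ (reflectCoord x) = reflectCoord (squashCoord κ x) := by
  funext i; fin_cases i <;> simp [squashCoord, reflectCoord, squash_neg]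

lemma squashCoord_apply_eq_zero {κ : ℝ} (hκ : κ ≠ 0) {x : Fin 3 → ℝ} {i : Fin 3} :
    squashCoord κ x i = 0 ↔ x i = 0 := by
  rw [squashCoord, mul_eq_zero, or_iff_right hκ]
  exact ⟨fun h => strictMono_squash.injective (h.trans squash_zero.symm),
    fun h => by rw [h, squash_zero]⟩

lemma squashCoord_injective {κ : ℝ} (hκ : κ ≠ 0) : Function.Injective (squashCoord κ) := by
  intro x y hxy
  funext i
  exact strictMono_squash.injective (mul_left_cancel₀ hκ (congrFun hxy i))

lemma norm_squashCoord_lt {κ r : ℝ} (hκ : 0 < κ) (hr : 10 * κ < r) (x : Fin 3 → ℝ) :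
    ‖squashCoord κ x‖ < r := by
  rw [pi_norm_lt_iff (by linarith)]
  intro i
  have := abs_squash_le (x i)
  rw [squashCoord, norm_mul, norm_eq_abs, norm_eq_abs, abs_of_pos hκ]
  nlinarith

lemma contDiff_squashCoord (κ : ℝ) : ContDiff ℝ ∞ (squashCoord κ) := by
  unfold squashCoord
  have := contDiff_squash
  fun_prop

lemma fderiv_squashCoord (κ : ℝ) (x v : Fin 3 → ℝ) (i : Fin 3) :
    fderiv ℝ (squashCoord κ) x v i = κ * squashDeriv (x i) * v i := by
  have h1 : ∀ i, HasFDerivAt (fun x : Fin 3 → ℝ => κ * squash (x i))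
      (κ • squashDeriv (x i) • ContinuousLinearMap.proj (R := ℝ) (φ := fun _ : Fin 3 => ℝ) i) x := by
    intro i
    have h2 : HasFDerivAt (fun x : Fin 3 → ℝ => x i)
      (ContinuousLinearMap.proj (R := ℝ) (φ := fun _ : Fin 3 => ℝ) i) x := hasFDerivAt_apply i x
    exact ((hasDerivAt_squash (x i)).comp_hasFDerivAt x h2).const_mul κ
  have h2 : HasFDerivAt (squashCoord κ) (ContinuousLinearMap.pi fun i => _) x :=
    hasFDerivAt_pi.2 h1
  rw [h2.fderiv]
  simp [mul_assoc]

namespace IsCrossing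

variable {m n : ℕ} {f g : ℝ × ℝ → Fin 4 → ℝ} {l : (Fin 4 → ℝ) →L[ℝ] ℝ} {e : Fin 4 → ℝ}
variable (h : IsCrossing m n f g l e)
include h

/-- A point of `f` with affine parameter at least `r` in absolute value stays away from the
crossing; any other is a chart point of the first axis, and the chart is injective. -/
lemma eventually_first_axis {E : Fin 4 → ℝ} {r : ℝ} (hr : 0 < r)
    (hinj : ∀ x y, ‖x‖ < r → ‖y‖ < r →
      wedge (localChart f g l e E x) (localChart f g l e E y) = 0 → x = y) :
    ∀ᶠ x in 𝓝 (0 : Fin 3 → ℝ), ∀ z, z ≠ 0 → wedge (localChart f g l e E x) (f z) = 0 →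
      x 1 = 0 ∧ x 2 = 0 := by
  have h1 := h.eventually_outerCurve_disjoint_localChart hr E
  have h2 : ∀ᶠ x in 𝓝 (0 : Fin 3 → ℝ), ∀ z, z ≠ 0 → r * |z.1| ≤ |z.2| →
      wedge (outerCurve f g l e 0 z) (localChart f g l e E x) ≠ 0 :=
    (by fun_prop : Continuous fun x : Fin 3 → ℝ => ((0:ℝ), x)).continuousAt.eventually h1
  have h3 : ∀ᶠ x in 𝓝 (0 : Fin 3 → ℝ), ‖x‖ < r :=
    continuous_norm.continuousAt.eventually_lt continuousAt_const (by simpa using hr)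
  filter_upwards [h2, h3] with x hx hxr z hz h0
  by_cases hle : r * |z.1| ≤ |z.2|
  · exfalso
    apply hx z hz hle
    rw [h.outerCurve_zero, wedge_smul_left, wedge_comm_eq_zero.1 h0, smul_zero]
  · push Not at hle
    have hz1 : 0 < |z.1| := by
      by_contra hc
      have := abs_nonneg z.2
      nlinarith [abs_nonneg z.1]
    have hz1' : z.1 ≠ 0 := abs_pos.1 hz1
    have e1 : z = z.1 • ((1:ℝ), z.2 / z.1) := by
      ext <;> simp [hz1', mul_div_cancel₀]
    have e2 : f z = z.1 ^ m • localChart f g l e E ![z.2 / z.1, 0, 0] := by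
      rw [h.localChart_first_axis E rfl rfl]
      conv_lhs => rw [e1, h.fst.homog]
      rfl
    rw [e2, wedge_smul_right, smul_eq_zero] at h0
    have := hinj x ![z.2 / z.1, 0, 0] hxr ?_ (h0.resolve_left (pow_ne_zero _ hz1'))
    · rw [this]; exact ⟨rfl, rfl⟩
    · rw [pi_norm_lt_iff hr]
      intro i
      fin_cases i
      · simpa [abs_div, div_lt_iff₀ hz1] using hle
      · simpa using hr
      · simpa using hr

/-- There are arbitrarily small standard charts at the crossing. -/
theorem exists_crossingChart {p : RP3} (hp : Represents e p) {U : Set RP3} (hU : IsOpen U)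
    (hpU : p ∈ U) : ∃ E : Fin 4 → ℝ, ∀ᶠ κ in 𝓝[>] (0:ℝ), ∃ ψ : (Fin 3 → ℝ) → RP3,
      (∀ x, Represents (localChart f g l e E (squashCoord κ x)) (ψ x)) ∧
      IsCrossingChart (projImage f) (projImage g) p ψ ∧ Set.range ψ ⊆ U := by
  obtain ⟨E, r, hr, hne, hinj, himm⟩ := h.exists_localChart_embedded
  have ax1 := h.eventually_first_axis hr hinj
  have ax2 : ∀ᶠ x in 𝓝 (0 : Fin 3 → ℝ), ∀ z, z ≠ 0 → wedge (localChart f g l e E x) (g z) = 0 →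
      x 0 = 0 ∧ x 2 = 0 := by
    have hns : ∀ x : Fin 3 → ℝ, ‖x‖ < r → ‖swapCoord x‖ < r := by
      intro x hx
      rw [pi_norm_lt_iff hr] at hx ⊢
      intro i
      fin_cases i
      · exact hx 1
      · exact hx 0
      · exact hx 2
    have h1 := h.symm.eventually_first_axis (E := E) hr (fun x y hx hy h0 => by
      rw [← localChart_swapCoord, ← localChart_swapCoord g f l e E y] at h0
      have := hinj _ _ (hns x hx) (hns y hy) h0
      rw [← swapCoord_swapCoord x, this, swapCoord_swapCoord])
    have hc : Continuous swapCoord := by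
      refine continuous_pi fun i => ?_
      fin_cases i
      · exact continuous_apply 1
      · exact continuous_apply 0
      · exact continuous_apply 2
    have h2 := (hc.continuousAt (x := 0)).eventually (p := fun x => ∀ z, z ≠ 0 →
      wedge (localChart g f l e E x) (g z) = 0 → x 1 = 0 ∧ x 2 = 0)
      (by rwa [show swapCoord 0 = 0 by funext i; fin_cases i <;> rfl])
    filter_upwards [h2] with x hx z hz h0
    rw [← localChart_swapCoord] at h0
    exact hx z hz h0
  have hUev : ∀ᶠ x in 𝓝 (0 : Fin 3 → ℝ), ∀ q, Represents (localChart f g l e E x) q → q ∈ U := by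
    have hq : IsOpen ((Projectivization.mk' ℝ : {v : Fin 4 → ℝ // v ≠ 0} → RP3) ⁻¹' U) :=
      isOpen_coinduced.1 hU
    obtain ⟨W, hW, hWU⟩ := isOpen_induced_iff.1 hq
    have heW : e ∈ W := by
      obtain ⟨h0, h1⟩ := hp
      have : (⟨e, h0⟩ : {v : Fin 4 → ℝ // v ≠ 0}) ∈ Subtype.val ⁻¹' W := by
        rw [hWU, mem_preimage, Projectivization.mk'_eq_mk, h1]; exact hpU
      exact this
    have hcont := (h.contDiff_localChart E).continuous
    have := hcont.continuousAt.eventually_mem (x := 0) (hW.mem_nhds (by rwa [h.localChart_zero]))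
    filter_upwards [this] with x hx q hxq
    obtain ⟨h0, rfl⟩ := hxq
    have : (⟨_, h0⟩ : {v : Fin 4 → ℝ // v ≠ 0}) ∈ Subtype.val ⁻¹' W := hx
    rw [hWU] at this
    exact this
  obtain ⟨δ, hδ, hball⟩ := Metric.eventually_nhds_iff.1 (ax1.and (ax2.and hUev))
  simp only [dist_zero_right] at hball
  refine ⟨E, ?_⟩
  -- Since `squash` is bounded by 10, the scaled coordinates of all points stay in both balls.
  have hκr : ∀ᶠ κ in 𝓝[>] (0:ℝ), 10 * κ < min r δ := by
    refine Filter.Eventually.filter_mono nhdsWithin_le_nhds ?_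
    exact (by fun_prop : Continuous fun κ : ℝ => 10 * κ).continuousAt.eventually_lt
      continuousAt_const (by simpa using ⟨hr, hδ⟩)
  filter_upwards [hκr, self_mem_nhdsWithin] with κ k1 hκ
  have hκ' : 0 < κ := hκ
  have n1 : ∀ x, ‖squashCoord κ x‖ < r := norm_squashCoord_lt hκ' (k1.trans_le (min_le_left _ _))
  have n2 : ∀ x, ‖squashCoord κ x‖ < δ := norm_squashCoord_lt hκ' (k1.trans_le (min_le_right _ _))
  let ψ : (Fin 3 → ℝ) → RP3 := fun x => Projectivization.mk ℝ _ (hne _ (n1 x))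
  have hψ : ∀ x, Represents (localChart f g l e E (squashCoord κ x)) (ψ x) := fun x =>
    represents_mk _
  refine ⟨ψ, hψ, ⟨⟨?_, ?_⟩, ?_, ?_, ?_⟩, ?_⟩
  · intro x y hxy
    have h1 := hψ y
    rw [← hxy] at h1
    exact squashCoord_injective hκ'.ne' (hinj _ _ (n1 x) (n1 y) ((hψ x).wedge_eq_zero h1))
  · refine ⟨_, (h.contDiff_localChart E).comp (contDiff_squashCoord κ), hψ, ?_⟩
    intro x v c hv
    have h1 := fderiv_comp x ((h.contDiff_localChart E).differentiable (by simp) (squashCoord κ x))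
      ((contDiff_squashCoord κ).differentiable (by simp) x)
    rw [h1] at hv
    have h2 := himm _ (fderiv ℝ (squashCoord κ) x v) (n1 x) (by
      have hv' : fderiv ℝ (localChart f g l e E) (squashCoord κ x) (fderiv ℝ (squashCoord κ) x v) =
        c • localChart f g l e E (squashCoord κ x) := hv
      rw [hv', wedge_smul_right, wedge_self, smul_zero])
    funext i
    have h3 := congrFun h2 i
    rw [fderiv_squashCoord] at h3
    exact (mul_eq_zero.1 h3).resolve_left (mul_pos hκ' (squashDeriv_pos _)).ne'
  · refine (hψ 0).unique ?_ |>.symm ▸ rfl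
    have : squashCoord κ 0 = 0 := by funext i; simp [squashCoord, squash_zero]
    rw [this, h.localChart_zero]
    exact hp
  · intro x
    constructor
    · rintro ⟨z, hz, hq⟩
      have := (hball (n2 x)).1 z hz ((hψ x).wedge_eq_zero hq)
      exact ⟨(squashCoord_apply_eq_zero hκ'.ne').1 this.1, (squashCoord_apply_eq_zero hκ'.ne').1 this.2⟩
    · rintro ⟨h1, h2⟩
      refine ⟨(1, squashCoord κ x 0), by simp, ?_⟩
      rw [← h.localChart_first_axis E ((squashCoord_apply_eq_zero hκ'.ne').2 h1)
        ((squashCoord_apply_eq_zero hκ'.ne').2 h2)]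
      exact hψ x
  · intro x
    constructor
    · rintro ⟨z, hz, hq⟩
      have := (hball (n2 x)).2.1 z hz ((hψ x).wedge_eq_zero hq)
      exact ⟨(squashCoord_apply_eq_zero hκ'.ne').1 this.1, (squashCoord_apply_eq_zero hκ'.ne').1 this.2⟩
    · rintro ⟨h1, h2⟩
      refine ⟨(1, squashCoord κ x 1), by simp, ?_⟩
      rw [← h.localChart_second_axis E ((squashCoord_apply_eq_zero hκ'.ne').2 h1)
        ((squashCoord_apply_eq_zero hκ'.ne').2 h2)]
      exact hψ x
  · rintro _ ⟨x, rfl⟩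
    exact (hball (n2 x)).2.2 _ (hψ x)

end IsCrossing

end RatKnot

/-! ### The deformation ends at the standard resolution -/

namespace RatKnot

open Filter Topology Set Real

lemma exists_angle (w : ℝ) : ∃ θ, 0 < sin θ ∧ 2 * cos θ / sin θ = w := by
  refine ⟨π / 2 - arctan (w / 2), ?_, ?_⟩
  · rw [sin_pi_div_two_sub]; exact cos_arctan_pos _
  · rw [sin_pi_div_two_sub, cos_pi_div_two_sub, mul_div_assoc, ← tan_eq_sin_div_cos, tan_arctan]
    ring

lemma half_pow_ne_zero_of_cos_pos {θ : ℝ} (hc : 0 < cos θ) : cos (θ / 2) ≠ 0 := by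
  intro h0
  have := one_add_cos_eq θ
  rw [h0] at this
  linarith

/-- Here `halfSum` equals the cosine, so the second coordinate vanishes and the first equals the
difference `2 cot θ`. -/
lemma coord_one_outer {θ : ℝ} (hc : 0 < cos θ) (hb : sin θ ^ 2 ≤ 4 * cos θ ^ 2) :
    coordA 1 θ = 2 * cos θ / sin θ := by
  have h1 : (1:ℝ) ∈ Icc (0:ℝ) 1 := ⟨zero_le_one, le_rfl⟩
  have hM := halfSum_pos (θ := θ) h1
  have hM2 := halfSum_sq (θ := θ) h1
  rw [excess, bump_eq_zero hb, sub_zero, one_mul, one_mul] at hM2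
  have := sin_sq_add_cos_sq θ
  have : halfSum 1 θ = cos θ := (pow_left_inj₀ hM.le hc.le two_ne_zero).1 (by linarith)
  rw [coordA, this, two_mul]

lemma mem_standardResolution_of_axis {x : Fin 3 → ℝ} (h1 : x 1 = 0) (h2 : x 2 = 0)
    (h0 : 1 ≤ x 0 ^ 2) : x ∈ standardResolution 1 := by
  refine ⟨h2, ?_⟩
  rw [h1, smoothTransition.zero_of_nonpos (by simpa using h0)]; simp

namespace IsCrossing

variable {m n : ℕ} {f g : ℝ × ℝ → Fin 4 → ℝ} {l : (Fin 4 → ℝ) →L[ℝ] ℝ} {e : Fin 4 → ℝ}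
variable (h : IsCrossing m n f g l e)
include h

lemma resolutionCurve_one_outer {κ θ : ℝ} (hc : 0 < cos θ) (hb : sin θ ^ 2 ≤ 4 * cos θ ^ 2) :
    resolutionCurve f g l e κ 1 θ =
      cos (θ / 2) ^ n • f (sin (θ / 2), κ * (cos (θ / 2) * factorA 1 θ)) := by
  have h1 : (1:ℝ) ∈ Icc (0:ℝ) 1 := ⟨zero_le_one, le_rfl⟩
  have hA := factorA_pos h1 hc
  have hAB := factorA_mul_factorB (θ := θ) h1
  rw [excess, bump_eq_zero hb, sub_zero, one_mul, sub_self] at hAB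
  rw [resolutionCurve, (mul_eq_zero.1 hAB).resolve_left hA.ne', mul_zero, mul_zero,
    h.affineSum_axis]

/-- If the point lies in the chart, then `squash (x 0) = 2 cot θ`, of absolute value at least one;
were `|x 0| < 1`, then `squash` would fix `x 0`. -/
lemma outer_point_mem {κ θ : ℝ} (hκ : 0 < κ) {E : Fin 4 → ℝ} {ψ : (Fin 3 → ℝ) → RP3}
    (hψ : ∀ x, Represents (localChart f g l e E (squashCoord κ x)) (ψ x))
    (haxis : ∀ x, ψ x ∈ projImage f ↔ x 1 = 0 ∧ x 2 = 0)
    (hc : 0 < cos θ) (hb : sin θ ^ 2 ≤ 4 * cos θ ^ 2) {q : RP3}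
    (hq : Represents (resolutionCurve f g l e κ 1 θ) q) :
    q ∈ projImage f ∧ ∀ x, ψ x = q → x 1 = 0 ∧ x 2 = 0 ∧ 1 ≤ x 0 ^ 2 := by
  have h1 : (1:ℝ) ∈ Icc (0:ℝ) 1 := ⟨zero_le_one, le_rfl⟩
  have hA := factorA_pos h1 hc
  have ha := half_pow_ne_zero_of_cos_pos hc
  rw [h.resolutionCurve_one_outer hc hb] at hq
  set z : ℝ × ℝ := (sin (θ / 2), κ * (cos (θ / 2) * factorA 1 θ)) with hz
  have hz2 : z.2 ≠ 0 := mul_ne_zero hκ.ne' (mul_ne_zero ha hA.ne')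
  have hz0 : z ≠ 0 := fun h0 => hz2 (by rw [h0]; rfl)
  have hf0 := h.fst.ne_zero z hz0
  have hqz : Represents (f z) q := hq.of_wedge hf0 (wedge_smul_self _ _)
  have hqK : q ∈ projImage f := ⟨z, hz0, hqz⟩
  refine ⟨hqK, fun x hx => ?_⟩
  have hx12 := (haxis x).1 (hx ▸ hqK)
  refine ⟨hx12.1, hx12.2, ?_⟩
  have h2 := hψ x
  rw [h.localChart_first_axis E ((squashCoord_apply_eq_zero hκ.ne').2 hx12.1)
    ((squashCoord_apply_eq_zero hκ.ne').2 hx12.2), hx] at h2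
  have h3 := h.fst.injective _ _ hz0 (by simp) (hqz.wedge_eq_zero h2)
  simp only [hz, squashCoord, mul_one] at h3
  have h4 : sin (θ / 2) * squash (x 0) = cos (θ / 2) * factorA 1 θ := by
    have : κ * (sin (θ / 2) * squash (x 0)) = κ * (cos (θ / 2) * factorA 1 θ) := by linarith
    exact mul_left_cancel₀ hκ.ne' this
  have hsin : sin θ ≠ 0 := by
    rw [sin_eq_two_mul]
    refine mul_ne_zero (mul_ne_zero two_ne_zero fun h0 => ?_) ha
    rw [h0, zero_mul] at h4
    exact mul_ne_zero ha hA.ne' h4.symm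
  have hb0 : sin (θ / 2) ≠ 0 := fun h0 => hsin (by rw [sin_eq_two_mul, h0]; simp)
  rw [cos_half_mul_factorA h1 hsin, coord_one_outer hc hb] at h4
  have h5 := mul_left_cancel₀ hb0 h4
  by_contra hlt
  push Not at hlt
  rw [squash_of_sq_le (by linarith)] at h5
  have : 1 ≤ x 0 ^ 2 := by
    rw [h5, div_pow, le_div_iff₀ (by positivity)]; linarith
  linarith

/-- Write the affine parameter of the point as `κ u`. If `|u| < 1`, the point is `ψ ![u, 0, 0]`,
against the hypothesis. Otherwise `2 cot θ = u` is solved off the support of the bump by `arctan (2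
/ u)`, and infinite `u` corresponds to `θ = 0`. -/
lemma exists_outer_angle {κ : ℝ} (hκ : 0 < κ) {E : Fin 4 → ℝ} {ψ : (Fin 3 → ℝ) → RP3}
    (hψ : ∀ x, Represents (localChart f g l e E (squashCoord κ x)) (ψ x)) {q : RP3}
    (hq : q ∈ projImage f) (hx : ∀ x, ψ x = q → 1 ≤ x 0 ^ 2) :
    ∃ θ, Represents (resolutionCurve f g l e κ 1 θ) q := by
  have h1 : (1:ℝ) ∈ Icc (0:ℝ) 1 := ⟨zero_le_one, le_rfl⟩
  obtain ⟨z, hz, hqz⟩ := hq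
  suffices hθ : ∃ θ, 0 < cos θ ∧ sin θ ^ 2 ≤ 4 * cos θ ^ 2 ∧
      z.1 * (κ * (cos (θ / 2) * factorA 1 θ)) = z.2 * sin (θ / 2) by
    obtain ⟨θ, hc, hb, hcross⟩ := hθ
    refine ⟨θ, ?_⟩
    have ha := half_pow_ne_zero_of_cos_pos hc
    have hA := factorA_pos h1 hc
    rw [h.resolutionCurve_one_outer hc hb]
    refine hqz.of_wedge (smul_ne_zero (pow_ne_zero _ ha) (h.fst.ne_zero _ fun h0 => ?_)) ?_
    · have : κ * (cos (θ / 2) * factorA 1 θ) = 0 := congrArg Prod.snd h0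
      exact mul_ne_zero hκ.ne' (mul_ne_zero ha hA.ne') this
    · rw [wedge_smul_right, wedge_comm_eq_zero.1 (h.fst.wedge_eq_zero hz hcross), smul_zero]
  by_cases hz1 : z.1 = 0
  · exact ⟨0, by simp, by simp, by simp [hz1]⟩
  · set u := z.2 / (κ * z.1) with hu
    have hz2 : z.2 = κ * u * z.1 := by rw [hu]; field_simp
    have hu1 : 1 ≤ u ^ 2 := by
      by_contra hlt
      push Not at hlt
      have h2 := hψ ![u, 0, 0]
      have h3 : squashCoord κ ![u, 0, 0] = ![κ * u, 0, 0] := by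
        funext i
        fin_cases i
        · simp [squashCoord, squash_of_sq_le (x := u) (by linarith)]
        · simp [squashCoord, squash_zero]
        · simp [squashCoord, squash_zero]
      rw [h3, h.localChart_first_axis E rfl rfl] at h2
      have h4 := h2.eq_of_wedge hqz (h.fst.wedge_eq_zero hz (by
        change z.1 * (κ * u) = z.2 * 1
        rw [hz2]; ring))
      have : 1 ≤ u ^ 2 := hx _ h4
      linarith
    have hu0 : u ≠ 0 := by rintro h0; rw [h0] at hu1; norm_num at hu1
    refine ⟨arctan (2 / u), cos_arctan_pos _, ?_, ?_⟩
    · have ht := tan_arctan (2 / u)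
      have hc := cos_arctan_pos (2 / u)
      rw [tan_eq_sin_div_cos, div_eq_iff hc.ne'] at ht
      rw [ht, mul_pow, div_pow]
      have : 2 ^ 2 / u ^ 2 ≤ 4 := by
        rw [div_le_iff₀ (by positivity)]; linarith
      exact mul_le_mul_of_nonneg_right this (sq_nonneg _)
    · have ht := tan_arctan (2 / u)
      have hc := cos_arctan_pos (2 / u)
      rw [tan_eq_sin_div_cos, div_eq_iff hc.ne'] at ht
      set θ := arctan (2 / u)
      have hb : sin θ ^ 2 ≤ 4 * cos θ ^ 2 := by
        rw [ht, mul_pow, div_pow]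
        have : 2 ^ 2 / u ^ 2 ≤ 4 := by
          rw [div_le_iff₀ (by positivity)]; linarith
        exact mul_le_mul_of_nonneg_right this (sq_nonneg _)
      have hsin : sin θ ≠ 0 := by rw [ht]; positivity
      rw [cos_half_mul_factorA h1 hsin, coord_one_outer hc hb, hz2]
      have : 2 * cos θ / sin θ = u := by rw [ht]; field_simp
      rw [this]; ring

/-- The difference of the coordinates fixes `θ` modulo `π` and the sign of their sum selects the
branch. Since `x₀² + x₁² < 3` here, `squash` fixes both coordinates. -/
lemma exists_inner_angle {κ : ℝ} {E : Fin 4 → ℝ} {ψ : (Fin 3 → ℝ) → RP3}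
    (hκ : ∀ θ, resolutionCurve f g l e κ 1 θ ≠ 0)
    (hψ : ∀ x, Represents (localChart f g l e E (squashCoord κ x)) (ψ x)) {x : Fin 3 → ℝ}
    (hx2 : x 2 = 0) (hx : x 0 * x 1 = smoothTransition (1 - (x 0 - x 1) ^ 2))
    (hlt : (x 0 - x 1) ^ 2 < 1) :
    ∃ θ, Represents (resolutionCurve f g l e κ 1 θ) (ψ x) := by
  have h1 : (1:ℝ) ∈ Icc (0:ℝ) 1 := ⟨zero_le_one, le_rfl⟩
  have hpos : 0 < x 0 * x 1 := by rw [hx]; exact smoothTransition.pos_of_pos (by linarith)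
  have hle : x 0 * x 1 ≤ 1 := by rw [hx]; exact smoothTransition.le_one _
  suffices hθ : ∃ θ, sin θ ≠ 0 ∧ coordA 1 θ = x 0 ∧ coordB 1 θ = x 1 by
    obtain ⟨θ, hs, hA, hB⟩ := hθ
    refine ⟨θ, (hψ x).of_wedge (hκ θ) ?_⟩
    have e1 : squashCoord κ x = ![κ * coordA 1 θ, κ * coordB 1 θ, 0] := by
      funext i
      fin_cases i
      · simp [squashCoord, hA, squash_of_sq_le (x := x 0) (by nlinarith)]
      · simp [squashCoord, hB, squash_of_sq_le (x := x 1) (by nlinarith)]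
      · simp [squashCoord, hx2, squash_zero]
    rw [e1, h.resolutionCurve_inner E h1 hs, wedge_smul_right, wedge_self, smul_zero]
  have aux : ∀ θ, sin θ ≠ 0 → 2 * cos θ / sin θ = x 0 - x 1 → 0 < sin θ * (x 0 + x 1) →
      coordA 1 θ = x 0 ∧ coordB 1 θ = x 1 := by
    intro θ hs hw hsgn
    have hM := halfSum_pos (θ := θ) h1
    have e1 : coordA 1 θ - coordB 1 θ = x 0 - x 1 := by
      rw [← hw, coordA, coordB]; field_simp; ring
    have e2 : coordA 1 θ * coordB 1 θ = x 0 * x 1 := by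
      rw [coordA_mul_coordB h1 hs, excess, bump_of_sin_ne_zero hs, hw, hx]; ring
    have e3 : (coordA 1 θ + coordB 1 θ) ^ 2 = (x 0 + x 1) ^ 2 := by
      linear_combination (coordA 1 θ - coordB 1 θ + (x 0 - x 1)) * e1 + 4 * e2
    have e4 : 0 < sin θ * (coordA 1 θ + coordB 1 θ) := by
      have : sin θ * (coordA 1 θ + coordB 1 θ) = 2 * halfSum 1 θ := by
        rw [coordA, coordB]; field_simp; ring
      rw [this]; linarith
    have e5 : coordA 1 θ + coordB 1 θ = x 0 + x 1 := by
      rcases sq_eq_sq_iff_eq_or_eq_neg.1 e3 with e5 | e5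
      · exact e5
      · rw [e5] at e4; linarith
    constructor <;> linarith
  obtain ⟨θ, hs, hw⟩ := exists_angle (x 0 - x 1)
  rcases lt_trichotomy (x 0 + x 1) 0 with h0 | h0 | h0
  · refine ⟨θ + π, by simpa using hs.ne', aux _ (by simpa using hs.ne') ?_ ?_⟩
    · simp only [cos_add_pi, sin_add_pi]
      rw [← hw, mul_neg, neg_div_neg_eq]
    · rw [sin_add_pi]; nlinarith
  · exfalso
    have : x 1 = - x 0 := by linarith
    rw [this] at hpos
    nlinarith [sq_nonneg (x 0)]
  · exact ⟨θ, hs.ne', aux θ hs.ne' hw (mul_pos hs h0)⟩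

/-- The deformation ends at the union of the curves with the standard resolution of the
crossing. -/
theorem curveImage_resolutionCurve_one {κ : ℝ} (hκ : 0 < κ) {E : Fin 4 → ℝ}
    {ψ : (Fin 3 → ℝ) → RP3} (hinj : Function.Injective ψ) (hne : ∀ θ, resolutionCurve f g l e κ 1 θ ≠ 0)
    (hψ : ∀ x, Represents (localChart f g l e E (squashCoord κ x)) (ψ x))
    (haxis : ∀ x, ψ x ∈ projImage f ↔ x 1 = 0 ∧ x 2 = 0)
    (haxis' : ∀ x, ψ x ∈ projImage g ↔ x 0 = 0 ∧ x 2 = 0) :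
    curveImage (resolutionCurve f g l e κ 1) = resolvedUnion (projImage f) (projImage g) ψ 1 := by
  have h1 : (1:ℝ) ∈ Icc (0:ℝ) 1 := ⟨zero_le_one, le_rfl⟩
  have hψ' : ∀ x, Represents (localChart g f l e E (squashCoord κ x)) (ψ (swapCoord x)) := by
    intro x
    have := hψ (swapCoord x)
    rwa [squashCoord_swapCoord, localChart_swapCoord] at this
  have haxis'' : ∀ x, ψ (swapCoord x) ∈ projImage g ↔ x 1 = 0 ∧ x 2 = 0 := fun x =>
    haxis' (swapCoord x)
  ext q
  constructor
  · rintro ⟨θ, hq⟩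
    by_cases hb : sin θ ^ 2 ≤ 4 * cos θ ^ 2
    · have hc : cos θ ≠ 0 := by
        intro h0
        have := sin_sq_add_cos_sq θ
        rw [h0] at this hb
        nlinarith
      rcases hc.lt_or_gt with hc | hc
      · have hc' : 0 < cos (π - θ) := by rw [cos_pi_sub]; linarith
        have hb' : sin (π - θ) ^ 2 ≤ 4 * cos (π - θ) ^ 2 := by
          rw [sin_pi_sub, cos_pi_sub, neg_sq]; exact hb
        rw [← resolutionCurve_pi_sub] at hq
        obtain ⟨hqK, hqx⟩ := h.symm.outer_point_mem hκ hψ' haxis'' hc' hb' hq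
        by_cases hr : q ∈ Set.range ψ
        · right
          obtain ⟨x, rfl⟩ := hr
          refine ⟨x, ?_, rfl⟩
          obtain ⟨k0, k2, k1⟩ := hqx (swapCoord x) (by rw [swapCoord_swapCoord])
          change x 0 = 0 at k0
          change x 2 = 0 at k2
          change 1 ≤ x 1 ^ 2 at k1
          refine ⟨k2, ?_⟩
          rw [k0, smoothTransition.zero_of_nonpos (by simpa using k1)]; simp
        · exact Or.inl ⟨Or.inr hqK, hr⟩
      · obtain ⟨hqK, hqx⟩ := h.outer_point_mem hκ hψ haxis hc hb hq
        by_cases hr : q ∈ Set.range ψ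
        · right
          obtain ⟨x, rfl⟩ := hr
          obtain ⟨k1, k2, k0⟩ := hqx x rfl
          exact ⟨x, mem_standardResolution_of_axis k1 k2 k0, rfl⟩
        · exact Or.inl ⟨Or.inl hqK, hr⟩
    · right
      have hsin : sin θ ≠ 0 := by
        intro h0; apply hb; rw [h0]; nlinarith [sq_nonneg (cos θ)]
      -- On the support of the bump both coordinates stay in the interval where `squash` is the
      -- identity.
      have hA : |coordA 1 θ| < 2 := by
        by_contra hA
        push Not at hA
        exact hb (outer_of_two_le_abs_coordA h1 hsin hA).2.le
      have hB : |coordB 1 θ| < 2 := by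
        by_contra hB
        push Not at hB
        rw [← coordA_pi_sub] at hB
        have := (outer_of_two_le_abs_coordA h1 (by rwa [sin_pi_sub]) hB).2.le
        rw [sin_pi_sub, cos_pi_sub, neg_sq] at this
        exact hb this
      have hA2 : coordA 1 θ ^ 2 ≤ 4 := by
        have := abs_lt.1 hA; nlinarith
      have hB2 : coordB 1 θ ^ 2 ≤ 4 := by
        have := abs_lt.1 hB; nlinarith
      refine ⟨![coordA 1 θ, coordB 1 θ, 0], ⟨rfl, ?_⟩, ?_⟩
      · change 1 * (coordA 1 θ * coordB 1 θ) =
          smoothTransition (1 - (coordA 1 θ - 1 * coordB 1 θ) ^ 2)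
        have e1 : coordA 1 θ - 1 * coordB 1 θ = 2 * cos θ / sin θ := by
          rw [coordA, coordB]; field_simp; ring
        rw [e1, coordA_mul_coordB h1 hsin, excess, ← bump_of_sin_ne_zero hsin]; ring
      · refine (hψ _).eq_of_wedge hq ?_
        have e1 : squashCoord κ ![coordA 1 θ, coordB 1 θ, 0] =
            ![κ * coordA 1 θ, κ * coordB 1 θ, 0] := by
          funext i
          fin_cases i
          · simp [squashCoord, squash_of_sq_le hA2]
          · simp [squashCoord, squash_of_sq_le hB2]
          · simp [squashCoord, squash_zero]
        rw [e1, h.resolutionCurve_inner E h1 hsin, wedge_smul_right, wedge_self, smul_zero]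
  · have left : ∀ q, q ∈ projImage f → (∀ x, ψ x = q → 1 ≤ x 0 ^ 2) →
        q ∈ curveImage (resolutionCurve f g l e κ 1) := fun q hq hx =>
      h.exists_outer_angle hκ hψ hq hx
    have right : ∀ q, q ∈ projImage g → (∀ x, ψ x = q → 1 ≤ x 1 ^ 2) →
        q ∈ curveImage (resolutionCurve f g l e κ 1) := by
      intro q hq hx
      obtain ⟨θ, hθ⟩ := h.symm.exists_outer_angle hκ hψ' hq fun x hxq => hx _ hxq
      refine ⟨π - θ, ?_⟩
      rw [← resolutionCurve_pi_sub, sub_sub_cancel]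
      exact hθ
    rintro (⟨hq | hq, hr⟩ | ⟨x, ⟨hx2, hx⟩, rfl⟩)
    · exact left q hq fun x hx => absurd ⟨x, hx⟩ hr
    · exact right q hq fun x hx => absurd ⟨x, hx⟩ hr
    · rw [one_mul, one_mul] at hx
      by_cases hlt : (x 0 - x 1) ^ 2 < 1
      · exact h.exists_inner_angle hne hψ hx2 hx hlt
      · push Not at hlt
        rw [smoothTransition.zero_of_nonpos (by linarith)] at hx
        rcases mul_eq_zero.1 hx with h0 | h0
        · refine right _ ((haxis' x).2 ⟨h0, hx2⟩) fun y hy => ?_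
          rw [hinj hy]
          simpa [h0] using hlt
        · refine left _ ((haxis x).2 ⟨h0, hx2⟩) fun y hy => ?_
          rw [hinj hy]
          simpa [h0] using hlt

/-- The resolution of sign -1 is that of sign 1 for the reversed second curve, seen in the chart
with reflected second coordinate. -/
lemma curveImage_resolutionCurve_one_reflect {κ : ℝ} (hκ : 0 < κ) {E : Fin 4 → ℝ}
    {ψ : (Fin 3 → ℝ) → RP3} (hinj : Function.Injective ψ)
    (hne : ∀ θ, resolutionCurve f (fun z => g (RatKnot.reflect z)) l e κ 1 θ ≠ 0)
    (hψ : ∀ x, Represents (localChart f g l e E (squashCoord κ x)) (ψ x))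
    (haxis : ∀ x, ψ x ∈ projImage f ↔ x 1 = 0 ∧ x 2 = 0)
    (haxis' : ∀ x, ψ x ∈ projImage g ↔ x 0 = 0 ∧ x 2 = 0) :
    curveImage (resolutionCurve f (fun z => g (RatKnot.reflect z)) l e κ 1) =
      resolvedUnion (projImage f) (projImage g) ψ (-1) := by
  have hr : Function.Surjective reflectCoord := fun x => ⟨_, reflectCoord_reflectCoord x⟩
  have := h.reflect.curveImage_resolutionCurve_one hκ (E := E) (ψ := fun x => ψ (reflectCoord x))
    (fun x y hxy => by
      rw [← reflectCoord_reflectCoord x, hinj hxy, reflectCoord_reflectCoord]) hne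
    (fun x => by
      have h1 := hψ (reflectCoord x)
      rw [← localChart_reflectCoord, ← squashCoord_reflectCoord, reflectCoord_reflectCoord] at h1
      exact h1)
    (fun x => by rw [haxis]; simp [reflectCoord])
    (fun x => by rw [projImage_reflect, haxis']; simp [reflectCoord])
  rw [this, projImage_reflect, resolvedUnion, resolvedUnion]
  congr 1
  · congr 1
    ext q
    constructor
    · rintro ⟨x, rfl⟩; exact ⟨_, rfl⟩
    · rintro ⟨x, rfl⟩; obtain ⟨y, rfl⟩ := hr x; exact ⟨y, rfl⟩
  · ext q
    constructor
    · rintro ⟨x, ⟨h2, h3⟩, rfl⟩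
      refine ⟨reflectCoord x, ⟨h2, ?_⟩, rfl⟩
      have e1 : reflectCoord x 0 = x 0 := rfl
      have e2 : reflectCoord x 1 = -x 1 := rfl
      rw [e1, e2, show -1 * (x 0 * -x 1) = 1 * (x 0 * x 1) by ring,
        show x 0 - -1 * -x 1 = x 0 - 1 * x 1 by ring]
      exact h3
    · rintro ⟨x, ⟨h2, h3⟩, rfl⟩
      refine ⟨reflectCoord x, ⟨h2, ?_⟩, by simp only [reflectCoord_reflectCoord]⟩
      have e1 : reflectCoord x 0 = x 0 := rfl
      have e2 : reflectCoord x 1 = -x 1 := rfl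
      rw [e1, e2, show 1 * (x 0 * -x 1) = -1 * (x 0 * x 1) by ring,
        show x 0 - 1 * -x 1 = x 0 - -1 * x 1 by ring]
      exact h3

end IsCrossing

end RatKnot

/-! ### Generic perturbations are complex embeddings, by reduction in a valuation ring -/

namespace RatKnot

open Set Real

/-- The four extremal monomials of degree `d` in two variables. -/
noncomputable def frame (A : Type*) [CommRing A] (d : ℕ) : Fin 4 → MvPolynomial (Fin 2) A :=
  ![.X 0 ^ d, .X 0 ^ (d - 1) * .X 1, .X 0 * .X 1 ^ (d - 1), .X 1 ^ d]

lemma frame_isHomogeneous (A : Type*) [CommRing A] {d : ℕ} (hd : 1 ≤ d) (i : Fin 4) :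
    (frame A d i).IsHomogeneous d := by
  have hX := fun j : Fin 2 => MvPolynomial.isHomogeneous_X A j
  have h1 : (d - 1) + 1 = d := by omega
  have h2 : 1 + (d - 1) = d := by omega
  fin_cases i
  · simpa [frame] using (hX 0).pow d
  · simpa [frame, h1] using ((hX 0).pow (d - 1)).mul (hX 1)
  · simpa [frame, h2] using (hX 0).mul ((hX 1).pow (d - 1))
  · simpa [frame] using (hX 1).pow d

lemma map_frame {A B : Type*} [CommRing A] [CommRing B] (φ : A →+* B) (d : ℕ) (i : Fin 4) :
    MvPolynomial.map φ (frame A d i) = frame B d i := by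
  fin_cases i <;> simp [frame]

lemma aeval_smul_of_isHomogeneous {R A σ : Type*} [CommRing R] [CommRing A] [Algebra R A]
    [Fintype σ] {φ : MvPolynomial σ R} {d : ℕ} (hφ : φ.IsHomogeneous d) (c : A) (z : σ → A) :
    MvPolynomial.aeval (c • z) φ = c ^ d * MvPolynomial.aeval z φ := by
  rw [MvPolynomial.aeval_def, MvPolynomial.aeval_def, MvPolynomial.eval₂_eq',
    MvPolynomial.eval₂_eq', Finset.mul_sum]
  refine Finset.sum_congr rfl fun k hk => ?_
  have hk' : ∑ i, k i = d := by
    have := hφ (MvPolynomial.mem_support_iff.1 hk)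
    rw [← this, Finsupp.weight_apply, Finsupp.sum_fintype _ _ (by simp)]
    simp
  simp only [Pi.smul_apply, smul_eq_mul, mul_pow, Finset.prod_mul_distrib, Finset.prod_pow_eq_pow_sum,
    hk']
  ring

lemma exists_smul_eq_of_cross_eq_zero {z w : Fin 2 → ℂ} (hz : z ≠ 0)
    (h : z 0 * w 1 = z 1 * w 0) : ∃ b : ℂ, w = b • z := by
  by_cases h0 : z 0 = 0
  · have h1 : z 1 ≠ 0 := fun h1 => hz (by ext i; fin_cases i <;> simp [h0, h1])
    refine ⟨w 1 / z 1, ?_⟩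
    have : w 0 = 0 := by simpa [h0, h1] using h
    ext i; fin_cases i
    · simp [h0, this]
    · simp [h1]
  · refine ⟨w 0 / z 0, ?_⟩
    ext i; fin_cases i
    · simp [h0]
    · simp; field_simp; linear_combination h

/-- Normalized homogeneous coordinates of a point of the projective line over a valuation ring. -/
lemma exists_normalized (O : ValuationSubring ℂ) {z : Fin 2 → ℂ} (hz : z ≠ 0) :
    ∃ (s : ℂ) (v : Fin 2 → O), s ≠ 0 ∧ z = s • (fun i => (v i : ℂ)) ∧
      (v 0 = 1 ∨ v 1 = 1 ∧ v 0 ∈ IsLocalRing.maximalIdeal O) := by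
  by_cases h0 : z 0 = 0
  · have h1 : z 1 ≠ 0 := fun h1 => hz (by ext i; fin_cases i <;> simp [h0, h1])
    refine ⟨z 1, ![0, 1], h1, ?_, Or.inr ⟨by simp, by simp⟩⟩
    ext i; fin_cases i <;> simp [h0]
  by_cases hO : z 1 / z 0 ∈ O
  · refine ⟨z 0, ![1, ⟨_, hO⟩], h0, ?_, Or.inl (by simp)⟩
    ext i; fin_cases i
    · simp
    · simp; field_simp
  · have h1 : z 1 ≠ 0 := fun h1 => hO (by simp [h1, O.zero_mem])
    have hO' : z 0 / z 1 ∈ O := by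
      have := (O.mem_or_inv_mem (z 1 / z 0)).resolve_left hO
      rwa [inv_div] at this
    refine ⟨z 1, ![⟨_, hO'⟩, 1], h1, ?_, Or.inr ⟨by simp, ?_⟩⟩
    · ext i; fin_cases i
      · simp; field_simp
      · simp
    · simp only [Matrix.cons_val_zero, IsLocalRing.mem_maximalIdeal, mem_nonunits_iff]
      rintro ⟨u, hu⟩
      apply hO
      have h2 : ((u : O) : ℂ) * ((↑u⁻¹ : O) : ℂ) = 1 := by
        rw [← MulMemClass.coe_mul, Units.mul_inv, OneMemClass.coe_one]
      rw [hu] at h2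
      have h3 : z 1 / z 0 = ((↑u⁻¹ : O) : ℂ) := by
        simp only at h2
        field_simp at h2 ⊢
        linear_combination -h2
      rw [h3]; exact (↑u⁻¹ : O).2

section LocalRing

variable {O : Type*} [CommRing O] [IsLocalRing O]

lemma isUnit_one_add {x : O} (hx : x ∈ IsLocalRing.maximalIdeal O) : IsUnit (1 + x) := by
  by_contra h
  have h1 : (1 + x) ∈ IsLocalRing.maximalIdeal O := h
  exact (Ideal.ne_top_iff_one _).1 (IsLocalRing.maximalIdeal.isMaximal O).ne_top
    ((Ideal.add_mem_iff_left _ hx).1 h1)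

/-- A perturbation of `a ↦ (1 : a)` by an element of the maximal ideal is injective. -/
lemma eq_of_perturbed_chart [IsDomain O] {ε : O} (hε : ε ∈ IsLocalRing.maximalIdeal O)
    (r s : Polynomial O) {a b : O}
    (h : (1 + ε * r.eval a) * (b + ε * s.eval b) = (1 + ε * r.eval b) * (a + ε * s.eval a)) :
    a = b := by
  -- Differences of polynomial values are divisible by `a - b`, so the equation becomes `a - b`
  -- times a unit equals zero.
  obtain ⟨u, hu⟩ := Polynomial.sub_dvd_eval_sub a b r
  obtain ⟨v, hv⟩ := Polynomial.sub_dvd_eval_sub a b s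
  have h1 : (a - b) * (1 + ε * (v - u * b + r.eval b - ε * (u * s.eval b - r.eval b * v))) = 0 := by
    linear_combination h * (-1) - ε * hv + ε * b * hu + ε ^ 2 * s.eval b * hu
      - ε ^ 2 * r.eval b * hv
  have h2 := isUnit_one_add (Ideal.mul_mem_right
    (v - u * b + r.eval b - ε * (u * s.eval b - r.eval b * v)) _ hε)
  exact sub_eq_zero.1 ((h2.mul_left_eq_zero).1 h1)

/-- The left side lies in the maximal ideal and the right side is a unit; they are the two terms of
the Wronskian of a perturbation of `(1, a)`. -/
lemma perturbed_chart_immersion {ε : O} (hε : ε ∈ IsLocalRing.maximalIdeal O) (r s p q a : O) :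
    (ε * p) * (a + ε * s) ≠ (1 + ε * q) * (1 + ε * r) := by
  intro h
  have h1 : IsUnit ((1 + ε * q) * (1 + ε * r)) :=
    (isUnit_one_add (Ideal.mul_mem_right _ _ hε)).mul (isUnit_one_add (Ideal.mul_mem_right _ _ hε))
  rw [← h] at h1
  exact (IsLocalRing.mem_maximalIdeal _).1 (Ideal.mul_mem_right _ _ (Ideal.mul_mem_right _ _ hε)) h1

end LocalRing

lemma eval_dehomogenize {O : Type*} [CommRing O] {v : Fin 2 → O} (hv : v 0 = 1)
    (φ : MvPolynomial (Fin 2) O) : MvPolynomial.eval v φ =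
      (MvPolynomial.aeval ![1, Polynomial.X] φ : Polynomial O).eval (v 1) := by
  have h := MvPolynomial.comp_aeval_apply (f := ![1, Polynomial.X])
    (Polynomial.aeval (R := O) (v 1)) φ
  rw [Polynomial.coe_aeval_eq_eval] at h
  rw [h, ← MvPolynomial.coe_aeval_eq_eval, RingHom.coe_coe]
  congr 2
  funext i; fin_cases i <;> simp [hv]

lemma eval_dehomogenize' {O : Type*} [CommRing O] {v : Fin 2 → O} (hv : v 1 = 1)
    (φ : MvPolynomial (Fin 2) O) : MvPolynomial.eval v φ =
      (MvPolynomial.aeval ![Polynomial.X, 1] φ : Polynomial O).eval (v 0) := by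
  have h := MvPolynomial.comp_aeval_apply (f := ![Polynomial.X, 1])
    (Polynomial.aeval (R := O) (v 0)) φ
  rw [Polynomial.coe_aeval_eq_eval] at h
  rw [h, ← MvPolynomial.coe_aeval_eq_eval, RingHom.coe_coe]
  congr 2
  funext i; fin_cases i <;> simp [hv]

lemma eval_map_subtype (O : ValuationSubring ℂ) (v : Fin 2 → O) (φ : MvPolynomial (Fin 2) O) :
    MvPolynomial.eval (fun i => (v i : ℂ)) (MvPolynomial.map O.subtype φ)
      = (MvPolynomial.eval v φ : O) := by
  have := MvPolynomial.eval₂_comp_left O.subtype (RingHom.id O) v φ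
  rw [MvPolynomial.eval_map, ← MvPolynomial.eval₂_id]
  exact this.symm

lemma aeval_eq_of_map_eq {P : MvPolynomial (Fin 2) ℝ} {O : ValuationSubring ℂ}
    {N : MvPolynomial (Fin 2) O} {μ : ℂ}
    (h : MvPolynomial.map (algebraMap ℝ ℂ) P = .C μ * MvPolynomial.map O.subtype N)
    (v : Fin 2 → O) :
    MvPolynomial.aeval (fun i => (v i : ℂ)) P = μ * (MvPolynomial.eval v N : O) := by
  rw [MvPolynomial.aeval_def, MvPolynomial.eval₂_eq_eval_map, h, map_mul, MvPolynomial.eval_C,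
    eval_map_subtype]

lemma map_pderiv_eq_of_map_eq {P : MvPolynomial (Fin 2) ℝ} {O : ValuationSubring ℂ}
    {N : MvPolynomial (Fin 2) O} {μ : ℂ}
    (h : MvPolynomial.map (algebraMap ℝ ℂ) P = .C μ * MvPolynomial.map O.subtype N)
    (j : Fin 2) : MvPolynomial.map (algebraMap ℝ ℂ) (MvPolynomial.pderiv j P)
      = .C μ * MvPolynomial.map O.subtype (MvPolynomial.pderiv j N) := by
  rw [← MvPolynomial.pderiv_map, h, ← MvPolynomial.pderiv_map, MvPolynomial.pderiv_C_mul]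

/-- Euler's identity: if the differential of a homogeneous polynomial map is degenerate at `z`,
then each partial derivative is proportional to the map itself. -/
lemma pderiv_proportional {P : Fin 4 → MvPolynomial (Fin 2) ℝ} {d : ℕ}
    (hP : ∀ i, (P i).IsHomogeneous d) {z w : Fin 2 → ℂ} {c : ℂ}
    (h : differential ℂ P z w = c • evalAt ℂ P z) (hzw : z 0 * w 1 ≠ z 1 * w 0) (j : Fin 2) :
    ∃ c' : ℂ, ∀ i, MvPolynomial.aeval z (MvPolynomial.pderiv j (P i))
      = c' * MvPolynomial.aeval z (P i) := by
  have hne : z 0 * w 1 - z 1 * w 0 ≠ 0 := sub_ne_zero.2 hzw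
  have euler : ∀ i, z 0 * MvPolynomial.aeval z (MvPolynomial.pderiv 0 (P i))
      + z 1 * MvPolynomial.aeval z (MvPolynomial.pderiv 1 (P i))
      = d * MvPolynomial.aeval z (P i) := fun i => by
    have := congrArg (MvPolynomial.aeval z) (hP i).sum_X_mul_pderiv
    simpa [Fin.sum_univ_two] using this
  have hd : ∀ i, MvPolynomial.aeval z (MvPolynomial.pderiv 0 (P i)) * w 0
      + MvPolynomial.aeval z (MvPolynomial.pderiv 1 (P i)) * w 1
      = c * MvPolynomial.aeval z (P i) := fun i => by
    have := congrFun h i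
    simpa [differential, evalAt, Matrix.mulVec, dotProduct, Fin.sum_univ_two] using this
  fin_cases j
  · refine ⟨(d * w 1 - c * z 1) / (z 0 * w 1 - z 1 * w 0), fun i => ?_⟩
    rw [div_mul_eq_mul_div, eq_div_iff hne]
    simp only [Fin.zero_eta]
    linear_combination w 1 * euler i - z 1 * hd i
  · refine ⟨(c * z 0 - d * w 0) / (z 0 * w 1 - z 1 * w 0), fun i => ?_⟩
    rw [div_mul_eq_mul_div, eq_div_iff hne]
    simp only [Fin.mk_one]
    linear_combination - w 0 * euler i + z 0 * hd i

section Reduction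

variable {O : ValuationSubring ℂ} {d : ℕ} {q : Fin 4 → MvPolynomial (Fin 2) O} {ε : O}

lemma perturbed_isUnit (hε : ε ∈ IsLocalRing.maximalIdeal O) {v : Fin 2 → O}
    (hv : v 0 = 1 ∨ v 1 = 1) :
    ∃ i, IsUnit (MvPolynomial.eval v (frame O d i + .C ε * q i)) := by
  rcases hv with hv | hv
  · exact ⟨0, by simpa [frame, hv] using isUnit_one_add (Ideal.mul_mem_right _ _ hε)⟩
  · exact ⟨3, by simpa [frame, hv] using isUnit_one_add (Ideal.mul_mem_right _ _ hε)⟩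

/-- In each standard chart of the line two frame monomials restrict to `1` and the coordinate, so
`eq_of_perturbed_chart` applies. For points in different charts, the coordinates 0 and 3 give a unit
on one side and an element of the maximal ideal on the other. -/
lemma perturbed_injective (hd : 1 ≤ d) (hε : ε ∈ IsLocalRing.maximalIdeal O) {v w : Fin 2 → O}
    (hv : v 0 = 1 ∨ v 1 = 1 ∧ v 0 ∈ IsLocalRing.maximalIdeal O)
    (hw : w 0 = 1 ∨ w 1 = 1 ∧ w 0 ∈ IsLocalRing.maximalIdeal O)
    (h : ∀ i j, MvPolynomial.eval v (frame O d i + .C ε * q i)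
        * MvPolynomial.eval w (frame O d j + .C ε * q j)
      = MvPolynomial.eval v (frame O d j + .C ε * q j)
        * MvPolynomial.eval w (frame O d i + .C ε * q i)) : v = w := by
  have mixed : ∀ v w : Fin 2 → O, v 0 = 1 → w 1 = 1 → w 0 ∈ IsLocalRing.maximalIdeal O →
      MvPolynomial.eval v (frame O d 0 + .C ε * q 0)
        * MvPolynomial.eval w (frame O d 3 + .C ε * q 3)
      ≠ MvPolynomial.eval v (frame O d 3 + .C ε * q 3)
        * MvPolynomial.eval w (frame O d 0 + .C ε * q 0) := by
    intro v w hv hw hw' h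
    have h1 : IsUnit (MvPolynomial.eval v (frame O d 0 + .C ε * q 0)
        * MvPolynomial.eval w (frame O d 3 + .C ε * q 3)) := by
      simpa [frame, hv, hw, -IsUnit.mul_iff] using
        (isUnit_one_add (Ideal.mul_mem_right _ _ hε)).mul
          (isUnit_one_add (Ideal.mul_mem_right _ _ hε))
    rw [h] at h1
    refine (IsLocalRing.mem_maximalIdeal _).1 (Ideal.mul_mem_left _ _ ?_) h1
    simpa [frame] using add_mem (Ideal.pow_mem_of_mem _ hw' d (by omega))
      (Ideal.mul_mem_right (MvPolynomial.eval w (q 0)) _ hε)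
  rcases hv with hv | ⟨hv, hv'⟩ <;> rcases hw with hw | ⟨hw, hw'⟩
  · have h01 := h 0 1
    simp only [map_add, map_mul, MvPolynomial.eval_C, eval_dehomogenize hv (q _),
      eval_dehomogenize hw (q _)] at h01
    have := eq_of_perturbed_chart hε (a := v 1) (b := w 1)
      (r := MvPolynomial.aeval ![1, Polynomial.X] (q 0))
      (s := MvPolynomial.aeval ![1, Polynomial.X] (q 1)) (by
        simp [frame, hv, hw] at h01
        linear_combination h01)
    ext i; fin_cases i <;> simp [hv, hw, this]
  · exact absurd (h 0 3) (mixed v w hv hw hw')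
  · exact absurd (by linear_combination -h 0 3) (mixed w v hw hv hv')
  · have h01 := h 3 2
    simp only [map_add, map_mul, MvPolynomial.eval_C, eval_dehomogenize' hv (q _),
      eval_dehomogenize' hw (q _)] at h01
    have := eq_of_perturbed_chart hε (a := v 0) (b := w 0)
      (r := MvPolynomial.aeval ![Polynomial.X, 1] (q 3))
      (s := MvPolynomial.aeval ![Polynomial.X, 1] (q 2)) (by
        simp [frame, hv, hw] at h01
        linear_combination h01)
    ext i; fin_cases i <;> simp [hv, hw, this]

lemma perturbed_immersion (hε : ε ∈ IsLocalRing.maximalIdeal O) {v : Fin 2 → O}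
    (hv : v 0 = 1 ∨ v 1 = 1) : ∃ i j k,
    MvPolynomial.eval v (MvPolynomial.pderiv k (frame O d i + .C ε * q i))
        * MvPolynomial.eval v (frame O d j + .C ε * q j)
      ≠ MvPolynomial.eval v (MvPolynomial.pderiv k (frame O d j + .C ε * q j))
        * MvPolynomial.eval v (frame O d i + .C ε * q i) := by
  rcases hv with hv | hv
  · refine ⟨0, 1, 1, ?_⟩
    simpa [frame, hv, MvPolynomial.pderiv_X, Derivation.leibniz] using
      perturbed_chart_immersion hε (MvPolynomial.eval v (q 0)) (MvPolynomial.eval v (q 1))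
      (MvPolynomial.eval v (MvPolynomial.pderiv 1 (q 0)))
      (MvPolynomial.eval v (MvPolynomial.pderiv 1 (q 1))) (v 1)
  · refine ⟨3, 2, 0, ?_⟩
    simpa [frame, hv, MvPolynomial.pderiv_X, Derivation.leibniz] using
      perturbed_chart_immersion hε (MvPolynomial.eval v (q 3)) (MvPolynomial.eval v (q 2))
      (MvPolynomial.eval v (MvPolynomial.pderiv 0 (q 3)))
      (MvPolynomial.eval v (MvPolynomial.pderiv 0 (q 2))) (v 0)

/-- A real polynomial map whose normalized reduction modulo the maximal ideal of a valuation ring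
is the frame is an embedding. -/
lemma isRationalParametrization_of_reduction (hd : 1 ≤ d)
    (hε : ε ∈ IsLocalRing.maximalIdeal O) {P : Fin 4 → MvPolynomial (Fin 2) ℝ}
    (hP : ∀ i, (P i).IsHomogeneous d) {μ : ℂ} (hμ : μ ≠ 0)
    (hN : ∀ i, MvPolynomial.map (algebraMap ℝ ℂ) (P i)
      = .C μ * MvPolynomial.map O.subtype (frame O d i + .C ε * q i)) :
    IsRationalParametrization d P where
  homogeneous := hP
  ne_zero z hz h := by
    obtain ⟨s, v, hs, rfl, hv⟩ := exists_normalized O hz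
    obtain ⟨i, hi⟩ := perturbed_isUnit (d := d) (q := q) hε (hv.imp_right And.left)
    have h1 := congrFun h i
    simp only [evalAt, aeval_smul_of_isHomogeneous (hP i), aeval_eq_of_map_eq (hN i),
      Pi.zero_apply, mul_eq_zero, pow_eq_zero_iff', hs, hμ, false_and, false_or] at h1
    exact hi.ne_zero (by exact_mod_cast h1)
  injective z w hz hw := by
    rintro ⟨c, h⟩
    obtain ⟨s, v, hs, rfl, hv⟩ := exists_normalized O hz
    obtain ⟨t, u, ht, rfl, hu⟩ := exists_normalized O hw
    have key : ∀ i, s ^ d * (MvPolynomial.eval v (frame O d i + .C ε * q i) : O)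
        = c * t ^ d * (MvPolynomial.eval u (frame O d i + .C ε * q i) : O) := fun i => by
      have h1 := congrFun h i
      simp only [evalAt, aeval_smul_of_isHomogeneous (hP i), aeval_eq_of_map_eq (hN i),
        Pi.smul_apply, smul_eq_mul] at h1
      refine mul_left_cancel₀ hμ ?_
      linear_combination h1
    have : v = u := by
      refine perturbed_injective (q := q) hd hε hv hu fun i j => ?_
      refine Subtype.ext (mul_left_cancel₀ (pow_ne_zero d hs) ?_)
      push_cast
      linear_combination ((MvPolynomial.eval u (frame O d j + .C ε * q j) : O) : ℂ) * key i
        - ((MvPolynomial.eval u (frame O d i + .C ε * q i) : O) : ℂ) * key j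
    refine ⟨s / t, ?_⟩
    rw [this, smul_smul, div_mul_cancel₀ _ ht]
  immersion z w hz := by
    rintro ⟨c, h⟩
    by_contra hcon
    have hzw : z 0 * w 1 ≠ z 1 * w 0 := fun h => hcon (exists_smul_eq_of_cross_eq_zero hz h)
    have hprop := pderiv_proportional hP h hzw
    obtain ⟨s, v, hs, rfl, hv⟩ := exists_normalized O hz
    obtain ⟨i, j, k, hne⟩ := perturbed_immersion (d := d) (q := q) hε (hv.imp_right And.left)
    obtain ⟨c', hc'⟩ := hprop k
    have key : ∀ i, s ^ (d - 1) *
          (MvPolynomial.eval v (MvPolynomial.pderiv k (frame O d i + .C ε * q i)) : O)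
        = c' * s ^ d * (MvPolynomial.eval v (frame O d i + .C ε * q i) : O) := fun i => by
      have h1 := hc' i
      rw [aeval_smul_of_isHomogeneous (hP i), aeval_eq_of_map_eq (hN i),
        aeval_smul_of_isHomogeneous (hP i).pderiv,
        aeval_eq_of_map_eq (map_pderiv_eq_of_map_eq (hN i) k)] at h1
      refine mul_left_cancel₀ hμ ?_
      linear_combination h1
    apply hne
    refine Subtype.ext (mul_left_cancel₀ (pow_ne_zero (d - 1) hs) ?_)
    push_cast
    linear_combination ((MvPolynomial.eval v (frame O d j + .C ε * q j) : O) : ℂ) * key i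
      - ((MvPolynomial.eval v (frame O d i + .C ε * q i) : O) : ℂ) * key j

end Reduction

/-- A transcendental number over a subring lies in the maximal ideal of some valuation ring
containing the subring. -/
lemma exists_valuationSubring (k : Subring ℂ) {ν : ℂ} (hν : Transcendental k ν) :
    ∃ O : ValuationSubring ℂ, k ≤ O.toSubring ∧
      ∃ ε : O, (ε : ℂ) = ν ∧ ε ∈ IsLocalRing.maximalIdeal O := by
  let A : Subring ℂ := (Algebra.adjoin k {ν}).toSubring
  let a : A := ⟨ν, Algebra.self_mem_adjoin_singleton k ν⟩
  -- An inverse of `ν` in `k[ν]` would make `ν` a root of some `X * p - 1`. So `ν` generates a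
  -- proper ideal, and a valuation ring has it among its nonunits.
  have hI : Ideal.span {a} ≠ ⊤ := by
    rw [Ne, Ideal.span_singleton_eq_top]
    intro hu
    obtain ⟨b, hb⟩ := isUnit_iff_exists_inv.1 hu
    have hb2 : (b : ℂ) ∈ Algebra.adjoin k {ν} := b.2
    rw [Algebra.adjoin_singleton_eq_range_aeval] at hb2
    obtain ⟨p, hp⟩ := hb2
    have h1 : ν * Polynomial.aeval ν p = 1 := by
      have := congrArg (Subtype.val : A → ℂ) hb
      simp only [AlgHom.toRingHom_eq_coe, RingHom.coe_coe] at hp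
      rw [hp]
      exact this
    have h2 := (transcendental_iff.1 hν) (Polynomial.X * p - 1) (by simp [h1])
    have h3 := congrArg (Polynomial.eval 0) h2
    simp at h3
  obtain ⟨O, hAO, hsub⟩ := Ideal.image_subset_nonunits_valuationSubring _ hI
  refine ⟨O, fun x hx => hAO ((Algebra.adjoin k {ν}).algebraMap_mem ⟨x, hx⟩), ?_⟩
  have h1 : ν ∈ (O.nonunits : Set ℂ) := hsub ⟨a, Ideal.mem_span_singleton_self a, rfl⟩
  rw [← O.image_maximalIdeal] at h1
  obtain ⟨ε, h2, h3⟩ := h1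
  exact ⟨ε, h3, h2⟩

lemma exists_countable_subring (S : Set ℂ) (hS : S.Countable) :
    ∃ k : Subring ℂ, S ⊆ k ∧ Countable k := by
  have := hS.to_subtype
  let φ := (MvPolynomial.aeval (R := ℤ) (Subtype.val : S → ℂ))
  have hc : Countable (MvPolynomial S ℤ) := by
    rw [← Cardinal.mk_le_aleph0_iff]
    refine MvPolynomial.cardinalMk_le_max_lift.trans ?_
    simp
  refine ⟨φ.range.toSubring, fun s hs => ⟨.X ⟨s, hs⟩, by simp [φ]⟩, ?_⟩
  exact (Set.countable_range φ).to_subtype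

/-- Arbitrarily small generic perturbations of a homogeneous polynomial map in the direction of the
frame are embeddings. -/
lemma exists_isRationalParametrization_perturbation {d : ℕ} (hd : 1 ≤ d)
    {R : Fin 4 → MvPolynomial (Fin 2) ℝ} (hR : ∀ i, (R i).IsHomogeneous d) {δ : ℝ} (hδ : 0 < δ) :
    ∃ μ : ℝ, 0 < μ ∧ μ < δ ∧
      IsRationalParametrization d fun i => R i + .C μ * frame ℝ d i := by
  obtain ⟨k, hSk, hk⟩ := exists_countable_subring
    (⋃ i, ((MvPolynomial.map (algebraMap ℝ ℂ) (R i)).coeffs : Set ℂ))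
    (Set.countable_iUnion fun i => Finset.countable_toSet _)
  -- Only countably many `μ` are bad, so arbitrarily small good ones exist. The inverse enters
  -- because `R + μ frame = μ (frame + μ⁻¹ R)`.
  have hcount : {x : ℝ | IsAlgebraic k ((x : ℂ)⁻¹)}.Countable :=
    (Algebraic.countable k ℂ).preimage (f := fun x : ℝ => (x : ℂ)⁻¹)
      (fun a b h => by simpa using h)
  obtain ⟨μ, ⟨hμ0, hμδ⟩, hμ⟩ :=
    (hcount.dense_compl ℝ).exists_mem_open isOpen_Ioo (Set.nonempty_Ioo.2 hδ) |>.imp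
      fun _ h => And.symm h
  have hμC : (μ : ℂ) ≠ 0 := by exact_mod_cast hμ0.ne'
  obtain ⟨O, hkO, ε, hε, hεm⟩ := exists_valuationSubring k hμ
  have hq : ∀ i, ∃ q : MvPolynomial (Fin 2) O,
      MvPolynomial.map O.subtype q = MvPolynomial.map (algebraMap ℝ ℂ) (R i) := fun i => by
    rw [← RingHom.mem_range, ← SetLike.mem_coe, RingHom.coe_range]
    refine (MvPolynomial.mem_range_map_iff_coeffs_subset).2 fun c hc => ?_
    exact ⟨⟨c, hkO (hSk (Set.mem_iUnion.2 ⟨i, hc⟩))⟩, rfl⟩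
  choose q hq using hq
  have hhom : ∀ i, (R i + .C μ * frame ℝ d i).IsHomogeneous d := fun i =>
    (hR i).add ((frame_isHomogeneous ℝ hd i).C_mul μ)
  refine ⟨μ, hμ0, hμδ, isRationalParametrization_of_reduction (q := q) hd hεm hhom hμC
    fun i => ?_⟩
  simp only [map_add, map_mul, map_frame, MvPolynomial.map_C, hq]
  rw [show O.subtype ε = (μ : ℂ)⁻¹ from hε, mul_add, ← mul_assoc, ← MvPolynomial.C_mul,
    mul_inv_cancel₀ hμC]
  simp [add_comm]
end RatKnot

namespace RatKnot

open Filter Topology Set Real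

/-! ### Polynomial maps as smooth maps -/

lemma contDiff_aeval (φ : MvPolynomial (Fin 2) ℝ) :
    ContDiff ℝ ∞ fun z : Fin 2 → ℝ => MvPolynomial.aeval z φ := by
  induction φ using MvPolynomial.induction_on with
  | C a => simpa using contDiff_const
  | add p q hp hq => simpa using hp.add hq
  | mul_X p i hp => simpa using hp.mul (contDiff_apply ℝ ℝ i)

lemma hasFDerivAt_aeval (φ : MvPolynomial (Fin 2) ℝ) (z : Fin 2 → ℝ) :
    HasFDerivAt (fun z : Fin 2 → ℝ => MvPolynomial.aeval z φ)
      (∑ j, MvPolynomial.aeval z (MvPolynomial.pderiv j φ) •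
        (ContinuousLinearMap.proj j : (Fin 2 → ℝ) →L[ℝ] ℝ)) z := by
  induction φ using MvPolynomial.induction_on with
  | C a => simpa using hasFDerivAt_const a z
  | add p q hp hq =>
    simp only [map_add, add_smul, Finset.sum_add_distrib]
    exact hp.add hq
  | mul_X p i hp =>
    have h := hp.mul (ContinuousLinearMap.proj (R := ℝ) (φ := fun _ : Fin 2 => ℝ) i).hasFDerivAt
    simp only [map_mul, MvPolynomial.aeval_X]
    refine h.congr_fderiv ?_
    ext v
    fin_cases i <;> simp [MvPolynomial.pderiv_X] <;> ring

lemma contDiff_evalAt (P : Fin 4 → MvPolynomial (Fin 2) ℝ) : ContDiff ℝ ∞ (evalAt ℝ P) :=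
  contDiff_pi.2 fun i => contDiff_aeval (P i)

lemma hasFDerivAt_evalAt (P : Fin 4 → MvPolynomial (Fin 2) ℝ) (z : Fin 2 → ℝ) :
    HasFDerivAt (evalAt ℝ P) (differential ℝ P z).toContinuousLinearMap z := by
  refine hasFDerivAt_pi'.2 fun i => (hasFDerivAt_aeval (P i) z).congr_fderiv ?_
  ext j
  simp [differential, Matrix.mulVec, dotProduct]

lemma evalAt_smul {d : ℕ} {P : Fin 4 → MvPolynomial (Fin 2) ℝ} {A : Type} [CommRing A]
    [Algebra ℝ A] (hP : ∀ i, (P i).IsHomogeneous d) (c : A) (z : Fin 2 → A) :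
    evalAt A P (c • z) = c ^ d • evalAt A P z :=
  funext fun i => aeval_smul_of_isHomogeneous (hP i) c z

lemma evalAt_ofReal (P : Fin 4 → MvPolynomial (Fin 2) ℝ) (z : Fin 2 → ℝ) :
    evalAt ℂ P (fun i => (z i : ℂ)) = fun i => ((evalAt ℝ P z i : ℝ) : ℂ) :=
  funext fun i => (MvPolynomial.comp_aeval_apply (f := z) Complex.ofRealAm (P i)).symm

lemma differential_ofReal (P : Fin 4 → MvPolynomial (Fin 2) ℝ) (z w : Fin 2 → ℝ) :
    differential ℂ P (fun i => (z i : ℂ)) (fun i => (w i : ℂ))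
      = fun i => ((differential ℝ P z w i : ℝ) : ℂ) := by
  have h := fun φ : MvPolynomial (Fin 2) ℝ =>
    MvPolynomial.comp_aeval_apply (f := z) Complex.ofRealAm φ
  simp only [Complex.ofRealAm_coe] at h
  funext i
  simp only [differential, Matrix.mulVecLin_apply, Matrix.mulVec, dotProduct, Matrix.of_apply,
    Complex.ofReal_sum, Complex.ofReal_mul, h]

namespace IsRationalParametrization

variable {d : ℕ} {P : Fin 4 → MvPolynomial (Fin 2) ℝ}

/-- In degree zero the map would be constant, hence not injective. -/
lemma one_le_degree (hP : IsRationalParametrization d P) : 1 ≤ d := by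
  by_contra h
  obtain rfl : d = 0 := by omega
  have hc : ∀ z, evalAt ℂ P z = evalAt ℂ P 0 := fun z => by
    have := evalAt_smul hP.homogeneous (0 : ℂ) z
    simpa using this.symm
  obtain ⟨b, hb⟩ := hP.injective ![1, 0] ![0, 1]
    (fun h => by simpa using congrFun h 0) (fun h => by simpa using congrFun h 1)
    ⟨1, by rw [one_smul, hc, hc ![0, 1]]⟩
  simpa using congrFun hb 0

lemma real_ne_zero (hP : IsRationalParametrization d P) {z : Fin 2 → ℝ} (hz : z ≠ 0) :
    evalAt ℝ P z ≠ 0 := by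
  intro h
  refine hP.ne_zero (fun i => (z i : ℂ)) (fun h0 => hz ?_) ?_
  · funext i; exact Complex.ofReal_eq_zero.1 (congrFun h0 i)
  · rw [evalAt_ofReal, h]; simp; rfl

lemma real_injective (hP : IsRationalParametrization d P) {z w : Fin 2 → ℝ} (hz : z ≠ 0)
    (hw : w ≠ 0) (h : wedge (evalAt ℝ P z) (evalAt ℝ P w) = 0) : z 0 * w 1 = z 1 * w 0 := by
  obtain ⟨c, hc⟩ := exists_smul_of_wedge_eq_zero (hP.real_ne_zero hw) h
  obtain ⟨b, hb⟩ := hP.injective (fun i => (z i : ℂ)) (fun i => (w i : ℂ))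
    (fun h0 => hz (funext fun i => Complex.ofReal_eq_zero.1 (congrFun h0 i)))
    (fun h0 => hw (funext fun i => Complex.ofReal_eq_zero.1 (congrFun h0 i)))
    ⟨c, by rw [evalAt_ofReal, evalAt_ofReal, hc]; funext i; simp⟩
  have h0 := congrFun hb 0
  have h1 := congrFun hb 1
  simp only [Pi.smul_apply, smul_eq_mul] at h0 h1
  have : (z 0 : ℂ) * w 1 = z 1 * w 0 := by rw [h0, h1]; ring
  exact_mod_cast this

lemma real_immersion (hP : IsRationalParametrization d P) {z w : Fin 2 → ℝ} (hz : z ≠ 0)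
    (h : wedge (evalAt ℝ P z) (differential ℝ P z w) = 0) : z 0 * w 1 = z 1 * w 0 := by
  obtain ⟨c, hc⟩ := exists_smul_of_wedge_eq_zero (hP.real_ne_zero hz) (wedge_comm_eq_zero.1 h)
  obtain ⟨b, hb⟩ := hP.immersion (fun i => (z i : ℂ)) (fun i => (w i : ℂ))
    (fun h0 => hz (funext fun i => Complex.ofReal_eq_zero.1 (congrFun h0 i)))
    ⟨c, by rw [evalAt_ofReal, differential_ofReal, hc]; funext i; simp⟩
  have h0 := congrFun hb 0
  have h1 := congrFun hb 1
  simp only [Pi.smul_apply, smul_eq_mul] at h0 h1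
  have : (z 0 : ℂ) * w 1 = z 1 * w 0 := by rw [h0, h1]; ring
  exact_mod_cast this

end IsRationalParametrization

/-- A multiple of a polynomial map, in the coordinates of the plane given by two vectors. -/
noncomputable def polyLift (P : Fin 4 → MvPolynomial (Fin 2) ℝ) (c : ℝ) (x x' : Fin 2 → ℝ)
    (z : ℝ × ℝ) : Fin 4 → ℝ := c • evalAt ℝ P (z.1 • x + z.2 • x')

lemma isHomogeneousMap_polyLift {d : ℕ} {P : Fin 4 → MvPolynomial (Fin 2) ℝ}
    (hP : ∀ i, (P i).IsHomogeneous d) (c : ℝ) (x x' : Fin 2 → ℝ) :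
    IsHomogeneousMap d (polyLift P c x x') where
  contDiff := ((contDiff_evalAt P).comp (by fun_prop :
    ContDiff ℝ ∞ fun z : ℝ × ℝ => z.1 • x + z.2 • x')).const_smul c
  homog a z := by
    have : (a • z).1 • x + (a • z).2 • x' = a • (z.1 • x + z.2 • x') := by
      simp [smul_add, smul_smul]
    rw [polyLift, this, evalAt_smul hP, smul_comm]; rfl

lemma fderiv_polyLift (P : Fin 4 → MvPolynomial (Fin 2) ℝ) (c : ℝ) (x x' : Fin 2 → ℝ)
    (z w : ℝ × ℝ) : fderiv ℝ (polyLift P c x x') z w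
      = c • differential ℝ P (z.1 • x + z.2 • x') (w.1 • x + w.2 • x') := by
  let L : ℝ × ℝ →L[ℝ] (Fin 2 → ℝ) := (ContinuousLinearMap.fst ℝ ℝ ℝ).smulRight x
    + (ContinuousLinearMap.snd ℝ ℝ ℝ).smulRight x'
  have h : HasFDerivAt (polyLift P c x x') (c • ((differential ℝ P (L z)).toContinuousLinearMap ∘L L)) z :=
    ((hasFDerivAt_evalAt P (L z)).comp z L.hasFDerivAt).const_smul c
  rw [h.fderiv]
  simp [L]

section Basis

variable {x x' : Fin 2 → ℝ} (hx : x 0 * x' 1 - x 1 * x' 0 ≠ 0)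
include hx

lemma cross_eq_of_combination {z w : ℝ × ℝ}
    (h : (z.1 • x + z.2 • x') 0 * (w.1 • x + w.2 • x') 1
      = (z.1 • x + z.2 • x') 1 * (w.1 • x + w.2 • x') 0) : z.1 * w.2 = z.2 * w.1 := by
  simp only [Pi.add_apply, Pi.smul_apply, smul_eq_mul] at h
  refine mul_left_cancel₀ hx ?_
  linear_combination h

lemma combination_ne_zero {z : ℝ × ℝ} (hz : z ≠ 0) : z.1 • x + z.2 • x' ≠ 0 := by
  intro h
  have h0 := congrFun h 0
  have h1 := congrFun h 1
  simp only [Pi.add_apply, Pi.smul_apply, smul_eq_mul, Pi.zero_apply] at h0 h1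
  refine hz (Prod.ext (mul_left_cancel₀ hx ?_) (mul_left_cancel₀ hx ?_))
  · simp only [Prod.fst_zero]; linear_combination x' 1 * h0 - x' 0 * h1
  · simp only [Prod.snd_zero]; linear_combination x 0 * h1 - x 1 * h0

lemma exists_combination (v : Fin 2 → ℝ) : ∃ z : ℝ × ℝ, v = z.1 • x + z.2 • x' := by
  refine ⟨((v 0 * x' 1 - v 1 * x' 0) / (x 0 * x' 1 - x 1 * x' 0),
    (x 0 * v 1 - x 1 * v 0) / (x 0 * x' 1 - x 1 * x' 0)), ?_⟩
  ext i
  simp only [Pi.add_apply, Pi.smul_apply, smul_eq_mul]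
  rw [div_mul_eq_mul_div, div_mul_eq_mul_div, ← add_div, eq_div_iff hx]
  fin_cases i <;> simp only [Fin.zero_eta, Fin.mk_one] <;> ring

lemma isEmbeddedLift_polyLift {d : ℕ} {P : Fin 4 → MvPolynomial (Fin 2) ℝ}
    (hP : IsRationalParametrization d P) {c : ℝ} (hc : c ≠ 0) :
    IsEmbeddedLift d (polyLift P c x x') where
  toIsHomogeneousMap := isHomogeneousMap_polyLift hP.homogeneous c x x'
  ne_zero z hz := smul_ne_zero hc (hP.real_ne_zero (combination_ne_zero hx hz))
  injective z w hz hw h := by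
    refine cross_eq_of_combination hx (hP.real_injective (combination_ne_zero hx hz)
      (combination_ne_zero hx hw) ?_)
    simpa [polyLift, wedge_smul_left, wedge_smul_right, hc] using h
  immersion z w hz h := by
    refine cross_eq_of_combination hx (hP.real_immersion (combination_ne_zero hx hz) ?_)
    rw [fderiv_polyLift] at h
    simpa only [polyLift, wedge_smul_left, wedge_smul_right, smul_eq_zero, hc, false_or] using h

lemma projImage_polyLift (P : Fin 4 → MvPolynomial (Fin 2) ℝ) {c : ℝ} (hc : c ≠ 0) :
    projImage (polyLift P c x x') = realImage P := by
  ext q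
  constructor
  · rintro ⟨z, hz, hq⟩
    refine ⟨_, combination_ne_zero hx hz, hq.of_wedge (fun h => hq.1 ?_) ?_⟩
    · rw [polyLift, h, smul_zero]
    · exact wedge_smul_self c _
  · rintro ⟨v, hv, hq⟩
    obtain ⟨z, rfl⟩ := exists_combination hx v
    refine ⟨z, ?_, hq.of_wedge (smul_ne_zero hc hq.1) (wedge_comm_eq_zero.1 (wedge_smul_self c _))⟩
    rintro rfl
    simp at hv

end Basis

lemma polyLift_reflect (P : Fin 4 → MvPolynomial (Fin 2) ℝ) (c : ℝ) (x x' : Fin 2 → ℝ) :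
    (fun z => polyLift P c x x' (reflect z)) = polyLift P c x (-x') := by
  funext z; simp [polyLift, reflect]

/-- Coordinate `i` is nonzero at `p`; scaling it to one makes the lifts agree there exactly. A
linear dependence would put a multiple of the second derivative into the intersection of the tangent
lines, the line of `e`, against immersion. -/
lemma isCrossing_polyLift {m n : ℕ} {P Q : Fin 4 → MvPolynomial (Fin 2) ℝ}
    (hP : IsRationalParametrization m P) (hQ : IsRationalParametrization n Q) {p : RP3}
    (hp : realImage P ∩ realImage Q = {p}) {x y x' y' : Fin 2 → ℝ}
    (hxp : Represents (evalAt ℝ P x) p) (hyp : Represents (evalAt ℝ Q y) p)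
    (htangent : tangentLine P x ⊓ tangentLine Q y = p.submodule)
    (hx : x 0 * x' 1 - x 1 * x' 0 ≠ 0) (hy : y 0 * y' 1 - y 1 * y' 0 ≠ 0) {i : Fin 4}
    (hi : evalAt ℝ P x i ≠ 0) (hi' : evalAt ℝ Q y i ≠ 0) :
    IsCrossing m n (polyLift P (evalAt ℝ P x i)⁻¹ x x') (polyLift Q (evalAt ℝ Q y i)⁻¹ y y')
      (ContinuousLinearMap.proj i) ((evalAt ℝ P x i)⁻¹ • evalAt ℝ P x) := by
  have hf := isEmbeddedLift_polyLift hx hP (inv_ne_zero hi)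
  have hg := isEmbeddedLift_polyLift hy hQ (inv_ne_zero hi')
  have hf1 : polyLift P (evalAt ℝ P x i)⁻¹ x x' (1, 0) = (evalAt ℝ P x i)⁻¹ • evalAt ℝ P x := by
    simp [polyLift]
  have hg1 : polyLift Q (evalAt ℝ Q y i)⁻¹ y y' (1, 0) = (evalAt ℝ P x i)⁻¹ • evalAt ℝ P x := by
    obtain ⟨t, ht⟩ := exists_smul_of_wedge_eq_zero hxp.1 (hyp.wedge_eq_zero hxp)
    have ht0 : t ≠ 0 := by rintro rfl; exact hyp.1 (by rw [ht, zero_smul])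
    simp only [polyLift, one_smul, zero_smul, add_zero, ht, Pi.smul_apply, smul_eq_mul, smul_smul]
    congr 1; field_simp
  set e := (evalAt ℝ P x i)⁻¹ • evalAt ℝ P x with he
  have hep : Represents e p := hxp.of_wedge (smul_ne_zero (inv_ne_zero hi) hxp.1)
    (wedge_comm_eq_zero.1 (wedge_smul_self _ _))
  have h10 : ((1, 0) : ℝ × ℝ) ≠ 0 := fun h => one_ne_zero (congrArg Prod.fst h)
  refine ⟨hf, hg, by simp [he, hi], hf1, hg1, fun z w hz hw h => ?_, fun a b c h => ?_⟩
  · have hq := represents_mk (hf.ne_zero z hz)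
    have hq' := hq.of_wedge (hg.ne_zero w hw) h
    have hqp : Projectivization.mk ℝ _ (hf.ne_zero z hz) ∈ realImage P ∩ realImage Q := by
      rw [← projImage_polyLift hx P (inv_ne_zero hi), ← projImage_polyLift hy Q (inv_ne_zero hi')]
      exact ⟨⟨z, hz, hq⟩, ⟨w, hw, hq'⟩⟩
    rw [hp, mem_singleton_iff] at hqp
    rw [hqp] at hq hq'
    have h1 := hf.injective z (1, 0) hz h10 (by rw [hf1]; exact hq.wedge_eq_zero hep)
    have h2 := hg.injective w (1, 0) hw h10 (by rw [hg1]; exact hq'.wedge_eq_zero hep)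
    simp at h1 h2
    exact ⟨h1.symm, h2.symm⟩
  · have hsub : p.submodule = Submodule.span ℝ {e} := by
      obtain ⟨_, rfl⟩ := hep
      exact Projectivization.submodule_mk _ _
    have heP : e ∈ tangentLine P x :=
      Submodule.mem_sup_left (Submodule.smul_mem _ _ (Submodule.mem_span_singleton_self _))
    have hdP : fderiv ℝ (polyLift P (evalAt ℝ P x i)⁻¹ x x') (1, 0) (0, 1) ∈ tangentLine P x := by
      rw [fderiv_polyLift]
      refine Submodule.mem_sup_right (Submodule.smul_mem _ _ ⟨x', ?_⟩)
      simp
    have hdQ : fderiv ℝ (polyLift Q (evalAt ℝ Q y i)⁻¹ y y') (1, 0) (0, 1) ∈ tangentLine Q y := by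
      rw [fderiv_polyLift]
      refine Submodule.mem_sup_right (Submodule.smul_mem _ _ ⟨y', ?_⟩)
      simp
    set df := fderiv ℝ (polyLift P (evalAt ℝ P x i)⁻¹ x x') (1, 0) (0, 1) with hdf
    set dg := fderiv ℝ (polyLift Q (evalAt ℝ Q y i)⁻¹ y y') (1, 0) (0, 1) with hdg
    have hmem : c • dg ∈ tangentLine P x ⊓ tangentLine Q y := by
      refine ⟨?_, Submodule.smul_mem _ _ hdQ⟩
      have : c • dg = -(a • e + b • df) := by rw [eq_neg_iff_add_eq_zero, ← h]; abel
      rw [this]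
      exact Submodule.neg_mem _ (Submodule.add_mem _ (Submodule.smul_mem _ _ heP)
        (Submodule.smul_mem _ _ hdP))
    rw [htangent, hsub] at hmem
    obtain ⟨t, ht⟩ := Submodule.mem_span_singleton.1 hmem
    have hc : c = 0 := by
      by_contra hc
      have : wedge e dg = 0 := by
        have h1 : wedge e (c • dg) = 0 := by rw [← ht, wedge_smul_right, wedge_self, smul_zero]
        rw [wedge_smul_right] at h1
        exact (smul_eq_zero.1 h1).resolve_left hc
      have := hg.immersion (1, 0) (0, 1) h10 (by rw [hg1]; exact this)
      simp at this
    refine ⟨?_, hc⟩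
    by_contra hb
    have : wedge e df = 0 := by
      have h1 : b • df = (-a) • e := by
        rw [hc, zero_smul, add_zero] at h
        rw [neg_smul, eq_neg_iff_add_eq_zero, add_comm]; exact h
      have h2 : wedge e (b • df) = 0 := by rw [h1, wedge_smul_right, wedge_self, smul_zero]
      rw [wedge_smul_right] at h2
      exact (smul_eq_zero.1 h2).resolve_left hb
    have := hf.immersion (1, 0) (0, 1) h10 (by rw [hf1]; exact this)
    simp at this

/-! ### The polynomial resolution -/

/-- A multiple of a polynomial map, composed with the linear map that sends the standard basis of
the plane to the given vectors. -/
noncomputable def linearSubst (P : Fin 4 → MvPolynomial (Fin 2) ℝ) (c : ℝ) (u v : Fin 2 → ℝ)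
    (j : Fin 4) : MvPolynomial (Fin 2) ℝ :=
  .C c * MvPolynomial.aeval (fun i => .C (u i) * .X 0 + .C (v i) * .X 1) (P j)

lemma linearSubst_isHomogeneous {d : ℕ} {P : Fin 4 → MvPolynomial (Fin 2) ℝ}
    (hP : ∀ i, (P i).IsHomogeneous d) (c : ℝ) (u v : Fin 2 → ℝ) (j : Fin 4) :
    (linearSubst P c u v j).IsHomogeneous d := by
  have hlin : ∀ i, (.C (u i) * .X 0 + .C (v i) * .X 1 : MvPolynomial (Fin 2) ℝ).IsHomogeneous 1 :=
    fun i => ((MvPolynomial.isHomogeneous_X ℝ 0).C_mul (u i)).add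
      ((MvPolynomial.isHomogeneous_X ℝ 1).C_mul (v i))
  have := (hP j).aeval _ hlin
  rw [one_mul] at this
  exact this.C_mul c

lemma aeval_linearSubst (P : Fin 4 → MvPolynomial (Fin 2) ℝ) (c : ℝ) (u v : Fin 2 → ℝ) (j : Fin 4)
    (z : Fin 2 → ℝ) : MvPolynomial.aeval z (linearSubst P c u v j)
      = (c • evalAt ℝ P (z 0 • u + z 1 • v)) j := by
  rw [linearSubst, map_mul, MvPolynomial.comp_aeval_apply, MvPolynomial.aeval_C]
  simp only [evalAt, Pi.smul_apply, smul_eq_mul, Algebra.algebraMap_self_apply]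
  congr 3
  funext i
  simp [mul_comm]

/-- The polynomial map whose value is the sum of the values of two polynomial maps in the affine
chart where the coordinate `i` is one, with origin `e`. -/
noncomputable def polySum (P Q : Fin 4 → MvPolynomial (Fin 2) ℝ) (i : Fin 4) (e : Fin 4 → ℝ)
    (j : Fin 4) : MvPolynomial (Fin 2) ℝ :=
  Q i * P j + P i * Q j - .C (e j) * (P i * Q i)

lemma polySum_isHomogeneous {m n : ℕ} {P Q : Fin 4 → MvPolynomial (Fin 2) ℝ}
    (hP : ∀ i, (P i).IsHomogeneous m) (hQ : ∀ i, (Q i).IsHomogeneous n) (i : Fin 4)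
    (e : Fin 4 → ℝ) (j : Fin 4) : (polySum P Q i e j).IsHomogeneous (m + n) := by
  have h1 := (hQ i).mul (hP j)
  rw [add_comm n m] at h1
  exact (h1.add ((hP i).mul (hQ j))).sub (((hP i).mul (hQ i)).C_mul _)

/-- At `s = 0` both factors are one, so the curve is polynomial in the half-angle cosine and sine;
`κ` and the exchanged arguments of the first curve go into the linear substitutions. -/
lemma evalAt_polySum_linearSubst (P Q : Fin 4 → MvPolynomial (Fin 2) ℝ) (c c' : ℝ)
    (x x' y y' : Fin 2 → ℝ) (i : Fin 4) (e : Fin 4 → ℝ) (κ θ : ℝ) :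
    evalAt ℝ (polySum (linearSubst P c (κ • x') x) (linearSubst Q c' y (κ • y')) i e)
        ![cos (θ / 2), sin (θ / 2)]
      = resolutionCurve (polyLift P c x x') (polyLift Q c' y y') (ContinuousLinearMap.proj i) e
        κ 0 θ := by
  have e1 : ∀ a b : ℝ, a • κ • x' + b • x = b • x + (κ * a) • x' := fun a b => by
    rw [smul_smul, mul_comm, add_comm]
  have e2 : ∀ a b : ℝ, a • y + b • κ • y' = a • y + (κ * b) • y' := fun a b => by
    rw [smul_smul, mul_comm]
  funext j
  simp only [evalAt, polySum, map_sub, map_add, map_mul, aeval_linearSubst, resolutionCurve,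
    affineSum, factorA_zero, factorB_zero, mul_one, MvPolynomial.aeval_C, polyLift,
    Pi.sub_apply, Pi.add_apply, Pi.smul_apply, smul_eq_mul, ContinuousLinearMap.proj_apply,
    Matrix.cons_val_zero, Matrix.cons_val_one, Algebra.algebraMap_self_apply, e1, e2]
  ring

lemma realImage_eq_curveImage {d : ℕ} {P : Fin 4 → MvPolynomial (Fin 2) ℝ}
    (hP : ∀ i, (P i).IsHomogeneous d) :
    realImage P = curveImage fun θ => evalAt ℝ P ![cos (θ / 2), sin (θ / 2)] := by
  ext q
  constructor
  · rintro ⟨v, hv, hq⟩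
    have hv' : (v 0, v 1) ≠ (0 : ℝ × ℝ) := fun h => hv (by
      funext i; fin_cases i
      · exact congrArg Prod.fst h
      · exact congrArg Prod.snd h)
    obtain ⟨c, α, hc, -, h⟩ := exists_polar hv'
    have hvc : v = c • ![cos α, sin α] := by
      funext i; fin_cases i
      · simpa using congrArg Prod.fst h
      · simpa using congrArg Prod.snd h
    rw [hvc, evalAt_smul hP] at hq
    refine ⟨2 * α, ?_⟩
    simp only [mul_div_cancel_left₀ α (two_ne_zero' ℝ)]
    exact hq.of_wedge (fun h0 => hq.1 (by rw [h0, smul_zero])) (wedge_smul_self _ _)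
  · rintro ⟨θ, hq⟩
    refine ⟨_, fun h => ?_, hq⟩
    have h0 := congrFun h 0
    have h1 := congrFun h 1
    simp at h0 h1
    have := sin_sq_add_cos_sq (θ / 2)
    rw [h0, h1] at this
    norm_num at this

/-- The resolution of a crossing is isotopic to a knot with a rational parametrization. -/
lemma exists_parametrization_isotopic {m n : ℕ} {P Q : Fin 4 → MvPolynomial (Fin 2) ℝ}
    (hP : IsRationalParametrization m P) (hQ : IsRationalParametrization n Q) {c c' : ℝ}
    {x x' y y' : Fin 2 → ℝ} {i : Fin 4} {e : Fin 4 → ℝ}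
    (h : IsCrossing m n (polyLift P c x x') (polyLift Q c' y y') (ContinuousLinearMap.proj i) e)
    {κ : ℝ}
    (hκ : ∀ s ∈ Icc (0:ℝ) 1,
      (∀ θ θ', wedge (resolutionCurve (polyLift P c x x') (polyLift Q c' y y')
          (ContinuousLinearMap.proj i) e κ s θ)
        (resolutionCurve (polyLift P c x x') (polyLift Q c' y y')
          (ContinuousLinearMap.proj i) e κ s θ') = 0 → cos θ = cos θ' ∧ sin θ = sin θ') ∧
      ∀ θ d, HasDerivAt (resolutionCurve (polyLift P c x x') (polyLift Q c' y y')
          (ContinuousLinearMap.proj i) e κ s) d θ →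
        wedge (resolutionCurve (polyLift P c x x') (polyLift Q c' y y')
          (ContinuousLinearMap.proj i) e κ s θ) d ≠ 0) :
    ∃ R, IsRationalParametrization (m + n) R ∧ SmoothlyIsotopic (realImage R)
      (curveImage (resolutionCurve (polyLift P c x x') (polyLift Q c' y y')
        (ContinuousLinearMap.proj i) e κ 1)) := by
  have hd : 1 ≤ m + n := le_add_right hP.one_le_degree
  have hS := polySum_isHomogeneous (linearSubst_isHomogeneous hP.homogeneous c (κ • x') x)
    (linearSubst_isHomogeneous hQ.homogeneous c' y (κ • y')) i e
  have hev := h.eventually_smoothlyIsotopic hκ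
    (isHomogeneousMap_polyLift (frame_isHomogeneous ℝ hd) 1 ![1, 0] ![0, 1])
  obtain ⟨δ, hδ, hball⟩ := Metric.eventually_nhds_iff.1 hev
  obtain ⟨μ, hμ0, hμδ, hμ⟩ := exists_isRationalParametrization_perturbation hd hS hδ
  refine ⟨_, hμ, ?_⟩
  have hiso := hball (y := μ) (by rwa [dist_zero_right, norm_eq_abs, abs_of_pos hμ0])
  rw [realImage_eq_curveImage hμ.homogeneous]
  convert hiso using 3 with θ
  rw [← evalAt_polySum_linearSubst]
  funext j
  simp [evalAt, polyLift]

lemma IsCrossing.resolutionCurve_one_ne_zero {m n : ℕ} {f g : ℝ × ℝ → Fin 4 → ℝ}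
    {l : (Fin 4 → ℝ) →L[ℝ] ℝ} {e : Fin 4 → ℝ} (h : IsCrossing m n f g l e) {κ : ℝ}
    (hκ : ∀ θ d, HasDerivAt (resolutionCurve f g l e κ 1) d θ →
        wedge (resolutionCurve f g l e κ 1 θ) d ≠ 0) (θ : ℝ) :
    resolutionCurve f g l e κ 1 θ ≠ 0 := by
  intro h0
  have h1 := (h.contDiff_resolutionCurve κ).comp
    (by fun_prop : ContDiff ℝ ∞ fun θ : ℝ => ((1 : ℝ), θ))
  have h2 := (h1.differentiable (by simp) θ).hasDerivAt
  simp only [Function.comp_def, smoothTransition.one] at h2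
  refine hκ θ _ h2 ?_
  rw [h0]
  funext i j; simp [wedge]

lemma IsRationalParametrization.ne_zero_of_represents {d : ℕ}
    {P : Fin 4 → MvPolynomial (Fin 2) ℝ} (hP : IsRationalParametrization d P) {x : Fin 2 → ℝ}
    {q : RP3} (hx : Represents (evalAt ℝ P x) q) : x ≠ 0 := by
  rintro rfl
  have h := evalAt_smul hP.homogeneous (0 : ℝ) 0
  rw [smul_zero, zero_pow (by have := hP.one_le_degree; omega), zero_smul] at h
  exact hx.1 h

lemma exists_cross_ne_zero {x : Fin 2 → ℝ} (hx : x ≠ 0) :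
    ∃ x' : Fin 2 → ℝ, x 0 * x' 1 - x 1 * x' 0 ≠ 0 := by
  refine ⟨![-x 1, x 0], fun h => hx ?_⟩
  simp only [Matrix.cons_val_zero, Matrix.cons_val_one] at h
  funext i; fin_cases i <;> simp only [Fin.zero_eta, Fin.mk_one, Pi.zero_apply] <;>
    nlinarith [sq_nonneg (x 0), sq_nonneg (x 1)]

end RatKnot

/-! ### Assembly of the chart, the isotopies and the polynomial curves -/

theorem theorem4 (m n : ℕ) (P Q : Fin 4 → MvPolynomial (Fin 2) ℝ)
    (hP : RatKnot.IsRationalParametrization m P)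
    (hQ : RatKnot.IsRationalParametrization n Q)
    (p : RatKnot.RP3)
    (hp : RatKnot.realImage P ∩ RatKnot.realImage Q = {p})
    (x y : Fin 2 → ℝ)
    (hx : RatKnot.Represents (RatKnot.evalAt ℝ P x) p)
    (hy : RatKnot.Represents (RatKnot.evalAt ℝ Q y) p)
    (htangent : RatKnot.tangentLine P x ⊓ RatKnot.tangentLine Q y = p.submodule)
    (U : Set RatKnot.RP3) (hU : IsOpen U) (hpU : p ∈ U) :
    ∃ ψ : (Fin 3 → ℝ) → RatKnot.RP3,
      RatKnot.IsCrossingChart (RatKnot.realImage P) (RatKnot.realImage Q) p ψ ∧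
      Set.range ψ ⊆ U ∧
      ∀ ε : ℝ, ε = 1 ∨ ε = -1 →
        ∃ R : Fin 4 → MvPolynomial (Fin 2) ℝ,
          RatKnot.IsRationalParametrization (m + n) R ∧
          RatKnot.SmoothlyIsotopic (RatKnot.realImage R)
            (RatKnot.resolvedUnion (RatKnot.realImage P) (RatKnot.realImage Q) ψ ε) := by
  obtain ⟨i, hi⟩ := Function.ne_iff.1 hx.1
  have hi' : RatKnot.evalAt ℝ Q y i ≠ 0 := by
    obtain ⟨t, ht⟩ := RatKnot.exists_smul_of_wedge_eq_zero hy.1 (hx.wedge_eq_zero hy)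
    intro h
    rw [ht] at hi
    exact hi (by simp [h])
  obtain ⟨x', hx'⟩ := RatKnot.exists_cross_ne_zero (hP.ne_zero_of_represents hx)
  obtain ⟨y', hy'⟩ := RatKnot.exists_cross_ne_zero (hQ.ne_zero_of_represents hy)
  have h := RatKnot.isCrossing_polyLift hP hQ hp hx hy htangent hx' hy' hi hi'
  have hrefl := h.reflect
  have hep : RatKnot.Represents ((RatKnot.evalAt ℝ P x i)⁻¹ • RatKnot.evalAt ℝ P x) p :=
    hx.of_wedge (smul_ne_zero (inv_ne_zero hi) hx.1)
      (RatKnot.wedge_comm_eq_zero.1 (RatKnot.wedge_smul_self _ _))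
  have hfP := RatKnot.projImage_polyLift hx' P (inv_ne_zero hi)
  have hgQ := RatKnot.projImage_polyLift hy' Q (inv_ne_zero hi')
  obtain ⟨E, hE⟩ := h.exists_crossingChart hep hU hpU
  -- All conditions hold for every small `κ`, so one `κ` and one `ψ` serve both signs.
  obtain ⟨κ, ⟨⟨ψ, hψ, hchart, hψU⟩, hκ, hκr⟩, hκ0⟩ :=
    ((hE.and (h.eventually_resolutionCurve_embedded.and
      hrefl.eventually_resolutionCurve_embedded)).and self_mem_nhdsWithin).exists
  have h1 : (1 : ℝ) ∈ Set.Icc (0 : ℝ) 1 := ⟨zero_le_one, le_rfl⟩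
  have hend := h.curveImage_resolutionCurve_one hκ0 hchart.embedding.1
    (h.resolutionCurve_one_ne_zero (hκ 1 h1).2) hψ hchart.first_axis hchart.second_axis
  have hendr := h.curveImage_resolutionCurve_one_reflect hκ0 hchart.embedding.1
    (hrefl.resolutionCurve_one_ne_zero (hκr 1 h1).2) hψ hchart.first_axis hchart.second_axis
  rw [hfP, hgQ] at hchart hend hendr
  refine ⟨ψ, hchart, hψU, ?_⟩
  rintro ε (rfl | rfl)
  · rw [← hend]
    exact RatKnot.exists_parametrization_isotopic hP hQ h hκ
  · rw [← hendr]
    -- The reversal is absorbed into the basis vector, `-y'` for `y'`, so the second curve is again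
    -- a `polyLift`.
    rw [RatKnot.polyLift_reflect] at hrefl hκr ⊢
    exact RatKnot.exists_parametrization_isotopic hP hQ hrefl hκr
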